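/- Let $\tau\in\mathbb C$ with $\operatorname{Im}\tau>0$, $\Lambda_\tau=\mathbb Z+\mathbb Z\tau$, $E_\tau=\mathbb C/\Lambda_\tau$, and let $E_\tau[2]=\{0,\frac12,\frac\tau2,\frac{1+\tau}2\}\subset E_\tau$. Let $G$ be the Green function of $E_\tau$, i.e. the function, smooth away from $0$, with $$-\Delta G=\delta_0-\frac1{|E_\tau|}\ \text{ on }E_\tau,\qquad \int_{E_\tau}G=0,$$ and for $p\in E_\tau$ put $G_p(z)=\frac12\big(G(z-p)+G(z+p)\big)$. A critical point $a$ of $G_p$ is called trivial if $a\in E_\tau[2]$ and nontrivial otherwise; it is non-degenerate if $\det D^2G_p(a)\neq0$ and degenerate otherwise. Let $\wp$ and $\zeta$ be the Weierstrass functions of $\Lambda_\tau$, $\eta_1=2\zeta(\frac12)$, $\eta_2=2\zeta(\frac\tau2)$, and let $\Omega_\tau$ be the set of all $p\in E_\tau$ such that $$\wp(p)=\wp(r+s\tau)+\frac{\wp'(r+s\tau)}{2(\zeta(r+s\tau)-r\eta_1-s\eta_2)}\quad\text{in }\mathbb C\cup\{\infty\}\ \text{ for some }(r,s)\in\mathbb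 R^2\setminus\tfrac12\mathbb Z^2 .$$ Put $$\mathcal O_\tau=\{p\in\Omega_\tau\setminus E_\tau[2]: G_p\text{ has a degenerate nontrivial critical point}\},$$ $$\mathcal T_\tau=\{p\in E_\tau\setminus E_\tau[2]: G_p\text{ has a degenerate trivial critical point}\}.$$ Then: 1. $\mathcal O_\tau$ has Lebesgue measure zero; 2. $\mathcal T_\tau=C\setminus E_\tau[2]$, where $C\subset E_\tau$ is a union of finitely many compact regular real-analytic arcs (an arc is the image of $[0,1]$ under a real-analytic map with nowhere vanishing derivative); 3. $\Omega_\tau\setminus(E_\tau[2]\cup\mathcal O_\tau\cup\mathcal T_\tau)$ is open in $E_\tau$; 4. for almost every $p\in E_\tau\setminus E_\tau[2]$ (with respect to Lebesgue measure), all critical points of $G_p$ are non-degenerate. -/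

import Mathlib

open scoped Topology ContDiff
open MeasureTheory

noncomputable section

namespace TorusGreen

/-- The pair of periods `(1, τ)`, for `τ` in the upper half plane. -/
def periods (τ : UpperHalfPlane) : PeriodPair where
  ω₁ := 1
  ω₂ := (τ : ℂ)
  indep := by
    rw [LinearIndependent.pair_iff]
    intro s t h
    have him := congrArg Complex.im h
    have hre := congrArg Complex.re h
    simp at him hre
    have ht : t = 0 := him.resolve_right τ.im_ne_zero
    subst ht
    simpa using hre

/-- The flat torus `E_τ = ℂ / (ℤ + ℤ τ)`, with its quotient group structure, topology and
`σ`-algebra. -/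
abbrev Torus (τ : UpperHalfPlane) : Type :=
  ℂ ⧸ (periods τ).lattice.toAddSubgroup

/-- The projection `ℂ → E_τ`. -/
def proj (τ : UpperHalfPlane) (z : ℂ) : Torus τ := (z : ℂ ⧸ (periods τ).lattice.toAddSubgroup)

/-- The area (Lebesgue) measure of `E_τ`: the image of the Lebesgue measure of the half-open period
parallelogram `{r + s τ : 0 ≤ r, s < 1}`. -/
def area (τ : UpperHalfPlane) : Measure (Torus τ) :=
  (volume.restrict (ZSpan.fundamentalDomain (periods τ).basis)).map (proj τ)

/-- `E_τ[2] = {0, 1/2, τ/2, (1+τ)/2}` in `E_τ`. -/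
def twoTorsion (τ : UpperHalfPlane) : Set (Torus τ) :=
  {proj τ 0, proj τ (1 / 2), proj τ ((τ : ℂ) / 2), proj τ ((1 + (τ : ℂ)) / 2)}

/-- `G` is the Green function of `E_τ` with singularity at `0`: it is smooth away from `0`,
it satisfies `-Δ G = δ₀ - 1 / |E_τ|` in the sense of distributions, and it has zero mean.
The equation is written for the lattice-periodic lift of `G` to `ℂ`, against smooth compactly
supported test functions on `ℂ`; there the lift of `δ₀` is the sum of the Dirac masses at all the
lattice points (a sum with finitely many nonzero terms for each test function). -/
structure IsGreenFunction (τ : UpperHalfPlane) (G : Torus τ → ℝ) : Prop where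
  contDiffOn : ContDiffOn ℝ ∞ (fun z : ℂ => G (proj τ z)) ((periods τ).lattice : Set ℂ)ᶜ
  locallyIntegrable : LocallyIntegrable (fun z : ℂ => G (proj τ z)) volume
  equation : ∀ φ : ℂ → ℝ, ContDiff ℝ ∞ φ → HasCompactSupport φ →
    -(∫ z : ℂ, G (proj τ z) * Laplacian.laplacian φ z) =
      (∑' l : (periods τ).lattice, φ (l : ℂ)) - 1 / (area τ).real Set.univ * ∫ z : ℂ, φ z
  mean_zero : ∫ x, G x ∂(area τ) = 0

/-- `G_p(z) = (G(z - p) + G(z + p)) / 2`. -/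
def pairGreen {τ : UpperHalfPlane} (G : Torus τ → ℝ) (p : Torus τ) : Torus τ → ℝ :=
  fun z => (1 / 2) * (G (z - p) + G (z + p))

/-- A function on `E_τ` in the flat chart `w ↦ a + w` centred at `a`. -/
def localRep {τ : UpperHalfPlane} (f : Torus τ → ℝ) (a : Torus τ) : ℂ → ℝ :=
  fun w => f (a + proj τ w)

/-- `a` is a critical point of `f`: `f` is (real) differentiable at `a`, with zero gradient. -/
def IsCriticalPoint {τ : UpperHalfPlane} (f : Torus τ → ℝ) (a : Torus τ) : Prop :=
  HasFDerivAt (localRep f a) (0 : ℂ →L[ℝ] ℝ) 0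

/-- The Hessian matrix `D² f (a)` in the real coordinates `z = x + i y`. -/
def hessian {τ : UpperHalfPlane} (f : Torus τ → ℝ) (a : Torus τ) : Matrix (Fin 2) (Fin 2) ℝ :=
  Matrix.of fun i j => iteratedFDeriv ℝ 2 (localRep f a) 0
    ![(![1, Complex.I] : Fin 2 → ℂ) i, (![1, Complex.I] : Fin 2 → ℂ) j]

/-- Non-degeneracy of a critical point: the Hessian determinant does not vanish. -/
def IsNondegenerate {τ : UpperHalfPlane} (f : Torus τ → ℝ) (a : Torus τ) : Prop :=
  (hessian f a).det ≠ 0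

/-- The Weierstrass zeta function `1/z + ∑_{l ≠ 0} (1/(z - l) + 1/l + z/l²)`; the term of `l = 0`
in the sum below is `1/z`, because `1 / 0 = 0` and `z / 0 = 0`. -/
def weierstrassZeta (L : PeriodPair) (z : ℂ) : ℂ :=
  ∑' l : L.lattice, (1 / (z - l) + 1 / (l : ℂ) + z / (l : ℂ) ^ 2)

/-- The quasi-period `η₁ = 2 ζ(1/2)`. -/
def eta₁ (τ : UpperHalfPlane) : ℂ := 2 * weierstrassZeta (periods τ) (1 / 2)

/-- The quasi-period `η₂ = 2 ζ(τ/2)`. -/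
def eta₂ (τ : UpperHalfPlane) : ℂ := 2 * weierstrassZeta (periods τ) ((τ : ℂ) / 2)

open Classical in
/-- `℘ : E_τ → ℂ ∪ {∞}`, with `℘(0) = ∞`; the choice of the representative is immaterial. -/
def wp {τ : UpperHalfPlane} (p : Torus τ) : OnePoint ℂ :=
  if p = 0 then OnePoint.infty
  else (((periods τ).weierstrassP (Quotient.out p) : ℂ) : OnePoint ℂ)

open Classical in
/-- Hitchin's formula
`f(r,s) = ℘(r+sτ) + ℘'(r+sτ) / (2 (ζ(r+sτ) - r η₁ - s η₂)) ∈ ℂ ∪ {∞}` for real `(r,s)` with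
`r + s τ` not a half period (so that `℘'(r+sτ) ≠ 0`, and the value is `∞` where the denominator
vanishes). -/
def hitchin (τ : UpperHalfPlane) (r s : ℝ) : OnePoint ℂ :=
  let z : ℂ := r + s * (τ : ℂ)
  let d : ℂ := 2 * (weierstrassZeta (periods τ) z - r * eta₁ τ - s * eta₂ τ)
  if d = 0 then OnePoint.infty
  else (((periods τ).weierstrassP z + (periods τ).derivWeierstrassP z / d : ℂ) : OnePoint ℂ)

/-- `Ω_τ`: the points `p` with `℘(p) = f(r,s)` for some `(r,s) ∈ ℝ² ∖ ½ℤ²`. -/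
def hitchinSet (τ : UpperHalfPlane) : Set (Torus τ) :=
  {p | ∃ r s : ℝ, (¬ ∃ m n : ℤ, 2 * r = m ∧ 2 * s = n) ∧ wp p = hitchin τ r s}

/-- `𝒯_τ`: the points `p ∉ E_τ[2]` for which `G_p` has a degenerate trivial critical point. -/
def degenerateTrivialSet {τ : UpperHalfPlane} (G : Torus τ → ℝ) : Set (Torus τ) :=
  {p | p ∉ twoTorsion τ ∧ ∃ a ∈ twoTorsion τ,
    IsCriticalPoint (pairGreen G p) a ∧ ¬ IsNondegenerate (pairGreen G p) a}

/-- `𝒪_τ`: the points `p ∈ Ω_τ ∖ E_τ[2]` for which `G_p` has a degenerate nontrivial critical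
point. -/
def degenerateNontrivialSet {τ : UpperHalfPlane} (G : Torus τ → ℝ) : Set (Torus τ) :=
  {p | p ∈ hitchinSet τ \ twoTorsion τ ∧ ∃ a ∉ twoTorsion τ,
    IsCriticalPoint (pairGreen G p) a ∧ ¬ IsNondegenerate (pairGreen G p) a}

/-- A compact regular real-analytic arc in `E_τ`: the image of `[0,1]` under (the projection of)
a real-analytic map with nowhere vanishing derivative. -/
def IsAnalyticArc {τ : UpperHalfPlane} (S : Set (Torus τ)) : Prop :=
  ∃ γ : ℝ → ℂ, AnalyticOnNhd ℝ γ (Set.Icc 0 1) ∧ (∀ t ∈ Set.Icc (0 : ℝ) 1, deriv γ t ≠ 0) ∧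
    S = (fun t => proj τ (γ t)) '' Set.Icc 0 1

end TorusGreen

end

/-! Everything is made explicit in terms of Weierstrass functions. Write Λ for the lattice. Off Λ
the lift of G satisfies (∂x - i∂y)G = -Z/(2π), where Z(z) = ζ(z) - cz - r z̄ is odd and Λ-periodic,
c is some complex constant and r = π/|E_τ| > 0 (`exists_dz_lift_eq`). Indeed, once a multiple of
|z|² and, near 0, the logarithm are removed, G is distributionally harmonic. Weyl's lemma
(`exists_holomorphic_extension`) makes the gradient holomorphic up to a multiple of z̄, with the
poles of ζ, and Liouville's theorem leaves an affine ambiguity, whose constant term is killed by the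
periodicity of G. Since Z vanishes at 1/2 and τ/2, the quasi-periods are determined by c and r, and
Z(x + yτ) = ζ(x + yτ) - xη₁ - yη₂ for real x, y: this is the denominator in Hitchin's formula.

For p not a half period, a is critical for G_p iff a ≢ ±p and F(a,p) = Z(a - p) + Z(a + p) vanishes.
The a-derivative of F is h ↦ -Hh - 2r h̄ with H = ℘(a - p) + ℘(a + p) + 2c, so a is degenerate iff
|H| = 2r. The addition formula (℘(a) - ℘(p))(ζ(a + p) + ζ(a - p) - 2ζ(a)) = ℘'(a) turns F(a,p) = 0,
for a not a half period, into Hitchin's formula. Hence, away from half periods, Ω_τ consists of the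
p for which G_p has a nontrivial critical point (`GradientData.proj_mem_hitchinSet_iff`).

Claim 1: the p-derivative of F is multiplication by ℘(a - p) - ℘(a + p), nonzero when neither a nor
p is a half period. So {F = 0} is locally a graph p = φ(a), degenerate a are critical points of φ,
and Sard's theorem applies (`addHaar_snd_image_eq_zero`).

Claim 2: at a half period a one has H = 2(℘(p + a) + c), so 𝒯_τ consists of translates of the level
curve |℘ + c| = r. Near one of its points z₀ such a curve is the real locus of i log(f/f(z₀)), f = ℘
+ c. This function is a power kⁿ of a local coordinate k, so its real locus is a star of segments in
that coordinate; compactness leaves finitely many arcs.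

Claim 3: a nondegenerate nontrivial critical point persists by the implicit function theorem.
Absence of degenerate critical points is an open condition because the torus is compact and the
poles of Z repel critical points from ±p.

Claim 4 follows from claim 1 and the fact that analytic arcs are null sets. -/

noncomputable section

namespace TorusGreen

/-! ### The Weierstrass zeta function: convergence, derivative, quasi-periodicity -/

section

/-- The Weierstrass zeta function with the term of `l₀` omitted. -/
def zetaExcept (L : PeriodPair) (l₀ z : ℂ) : ℂ :=
  ∑' l : L.lattice, if (l : ℂ) = l₀ then 0 else (1 / (z - l) + 1 / (l : ℂ) + z / (l : ℂ) ^ 2)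

/-- The term equals z²/((z - l) l²): the corrections 1/l and z/l² leave cubic decay in l, which is
summable over a lattice of rank two. -/
lemma zeta_term_bound {r : ℝ} (hr : 0 < r) {z l : ℂ} (hz : ‖z‖ < r) (h : 2 * r ≤ ‖l‖) :
    ‖1 / (z - l) + 1 / l + z / l ^ 2‖ ≤ 2 * r ^ 2 * ‖l‖ ^ (-3 : ℝ) := by
  have hl : 0 < ‖l‖ := by linarith
  have hl0 : l ≠ 0 := norm_pos_iff.1 hl
  have hzl : z - l ≠ 0 := by
    intro e
    rw [sub_eq_zero] at e
    subst e
    linarith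
  have e : 1 / (z - l) + 1 / l + z / l ^ 2 = z ^ 2 / ((z - l) * l ^ 2) := by
    field_simp
    ring
  have h1 : ‖l‖ / 2 ≤ ‖z - l‖ := by
    rw [norm_sub_rev]
    exact .trans (by linarith) (norm_sub_norm_le l z)
  rw [e, norm_div, norm_mul, norm_pow, norm_pow]
  calc ‖z‖ ^ 2 / (‖z - l‖ * ‖l‖ ^ 2) ≤ r ^ 2 / (‖l‖ / 2 * ‖l‖ ^ 2) := by gcongr
    _ = 2 * r ^ 2 / ‖l‖ ^ 3 := by field_simp
    _ = _ := by norm_cast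

lemma hasSumLocallyUniformly_zetaExcept (L : PeriodPair) (l₀ : ℂ) :
    HasSumLocallyUniformly
      (fun (l : L.lattice) (z : ℂ) ↦ if (l : ℂ) = l₀ then 0 else
        (1 / (z - l) + 1 / (l : ℂ) + z / (l : ℂ) ^ 2)) (zetaExcept L l₀) := by
  refine L.hasSumLocallyUniformly_aux (u := fun r l ↦ 2 * r ^ 2 * ‖l‖ ^ (-3 : ℝ)) _
    (fun _ _ ↦ (ZLattice.summable_norm_rpow _ _ (by simp; norm_num)).mul_left _) fun r hr ↦
    Filter.eventually_atTop.mpr ⟨2 * r, ?_⟩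
  rintro _ h s hs l rfl
  split_ifs
  · rw [norm_zero]; positivity
  · exact zeta_term_bound hr hs h

lemma zeta_eq_zetaExcept_add (L : PeriodPair) (l₀ : L.lattice) (z : ℂ) :
    weierstrassZeta L z = zetaExcept L l₀ z +
      (1 / (z - l₀) + 1 / (l₀ : ℂ) + z / (l₀ : ℂ) ^ 2) := by
  symm
  trans zetaExcept L l₀ z + ∑' i : L.lattice, if (i : ℂ) = l₀ then
    (1 / (z - l₀) + 1 / (l₀ : ℂ) + z / (l₀ : ℂ) ^ 2) else 0
  · simp
  rw [zetaExcept, ← Summable.tsum_add]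
  · rw [weierstrassZeta]
    congr with w
    split_ifs <;> simp only [zero_add, add_zero, *]
  · exact ⟨_, (hasSumLocallyUniformly_zetaExcept L _).hasSum⟩
  · exact summable_of_hasFiniteSupport ((Set.finite_singleton l₀).subset (by simp))

lemma zetaExcept_of_notMem (L : PeriodPair) {l₀ : ℂ} (hl : l₀ ∉ L.lattice) :
    zetaExcept L l₀ = weierstrassZeta L := by
  ext z
  rw [zetaExcept, weierstrassZeta]
  refine tsum_congr fun l ↦ if_neg ?_
  rintro rfl
  exact hl l.2

lemma differentiableAt_zeta_term {z l : ℂ} (h : z ≠ l) :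
    DifferentiableAt ℂ (fun z : ℂ ↦ 1 / (z - l) + 1 / l + z / l ^ 2) z := by
  have : z - l ≠ 0 := sub_ne_zero.2 h
  fun_prop (disch := assumption)

lemma differentiableOn_zetaExcept (L : PeriodPair) (l₀ : ℂ) :
    DifferentiableOn ℂ (zetaExcept L l₀) (L.lattice \ {l₀})ᶜ := by
  refine (hasSumLocallyUniformly_zetaExcept L l₀).hasSumLocallyUniformlyOn.differentiableOn
    (.of_forall fun s ↦ .fun_sum fun i hi ↦ ?_) L.isOpen_compl_lattice_sdiff
  split_ifs
  · simp
  · intro x hx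
    refine (differentiableAt_zeta_term ?_).differentiableWithinAt
    rintro rfl
    simp_all

/-- Locally uniform convergence permits termwise differentiation, and each term differentiates to
minus the corresponding term of ℘. -/
lemma deriv_zetaExcept (L : PeriodPair) (l₀ : ℂ) :
    Set.EqOn (deriv (zetaExcept L l₀)) (fun z ↦ - L.weierstrassPExcept l₀ z)
      (L.lattice \ {l₀})ᶜ := by
  have key : ∀ l : L.lattice, ∀ z ∈ (L.lattice \ {l₀} : Set ℂ)ᶜ, HasDerivAt
      (fun z : ℂ ↦ if (l : ℂ) = l₀ then 0 else (1 / (z - l) + 1 / (l : ℂ) + z / (l : ℂ) ^ 2))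
      (-(if (l : ℂ) = l₀ then 0 else (1 / (z - l) ^ 2 - 1 / (l : ℂ) ^ 2))) z := by
    intro l z hz
    split_ifs with hl
    · simpa using hasDerivAt_const z (0 : ℂ)
    · have h0 : z - l ≠ 0 := by
        intro e
        rw [sub_eq_zero] at e
        subst e
        simp_all
      have h1 := (((hasDerivAt_id z).sub_const (l : ℂ)).inv h0)
      have h2 := (h1.add_const (1 / (l : ℂ))).add ((hasDerivAt_id z).div_const ((l : ℂ) ^ 2))
      refine (h2.congr_of_eventuallyEq (.of_forall fun w ↦ ?_)).congr_deriv ?_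
      · simp
      · simp only [id]
        ring
  refine ((hasSumLocallyUniformly_zetaExcept L l₀).tendstoLocallyUniformlyOn.deriv
    (.of_forall fun s ↦ ?_) L.isOpen_compl_lattice_sdiff).unique ?_
  · exact .fun_sum fun i hi z hz ↦ (key i z hz).differentiableAt.differentiableWithinAt
  · have := (L.hasSumLocallyUniformly_weierstrassPExcept l₀).tendstoLocallyUniformlyOn
      (s := (L.lattice \ {l₀} : Set ℂ)ᶜ)
    have h2 := this.neg
    refine h2.congr ?_
    intro s z hz
    have := HasDerivAt.fun_sum (u := s) fun i _ ↦ key i z hz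
    simp only [Function.comp_apply, Pi.neg_apply]
    rw [this.deriv, Finset.sum_neg_distrib]

lemma hasDerivAt_zeta (L : PeriodPair) {z : ℂ} (hz : z ∉ L.lattice) :
    HasDerivAt (weierstrassZeta L) (-L.weierstrassP z) z := by
  -- Since ω₁/2 is not a period, omitting "its" term omits nothing, so statements about `zetaExcept`
  -- specialise to ζ.
  have h1 := L.ω₁_div_two_notMem_lattice
  have hmem : z ∈ (L.lattice \ {L.ω₁ / 2} : Set ℂ)ᶜ := fun h ↦ hz h.1
  have hd := (differentiableOn_zetaExcept L (L.ω₁ / 2)).differentiableAt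
    (L.isOpen_compl_lattice_sdiff.mem_nhds hmem)
  have := hd.hasDerivAt
  rw [deriv_zetaExcept L _ hmem, zetaExcept_of_notMem L h1,
    L.weierstrassPExcept_of_notMem _ h1] at this
  exact this

lemma zeta_neg (L : PeriodPair) (z : ℂ) : weierstrassZeta L (-z) = - weierstrassZeta L z := by
  rw [weierstrassZeta, weierstrassZeta, ← (Equiv.neg L.lattice).tsum_eq, ← tsum_neg]
  refine tsum_congr fun l ↦ ?_
  have : ((Equiv.neg L.lattice l : L.lattice) : ℂ) = -(l : ℂ) := by simp
  rw [this, show -z - -(l : ℂ) = -(z - l) by ring, neg_sq]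
  simp only [one_div, inv_neg, neg_div]
  ring

lemma zetaExcept_zero_neg (L : PeriodPair) (z : ℂ) :
    zetaExcept L 0 (-z) = - zetaExcept L 0 z := by
  have h1 := zeta_eq_zetaExcept_add L 0 z
  have h2 := zeta_eq_zetaExcept_add L 0 (-z)
  rw [zeta_neg, h1] at h2
  simp only [ZeroMemClass.coe_zero, sub_zero, div_zero, add_zero, one_div, inv_neg, ne_eq,
    OfNat.ofNat_ne_zero, not_false_eq_true, zero_pow] at h2
  linear_combination -h2

lemma countable_lattice (L : PeriodPair) : (L.lattice : Set ℂ).Countable :=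
  countable_of_Lindelof_of_discrete (X := L.lattice)

lemma isOpen_compl_lattice (L : PeriodPair) : IsOpen ((L.lattice : Set ℂ)ᶜ) :=
  L.isClosed_lattice.isOpen_compl

lemma isPreconnected_compl_lattice (L : PeriodPair) : IsPreconnected ((L.lattice : Set ℂ)ᶜ) :=
  (Set.Countable.isConnected_compl_of_one_lt_rank (by simp) (countable_lattice L)).2

lemma add_mem_lattice_iff {L : PeriodPair} {z l : ℂ} (hl : l ∈ L.lattice) :
    z + l ∈ L.lattice ↔ z ∈ L.lattice :=
  ⟨fun h ↦ by simpa using sub_mem h hl, fun h ↦ add_mem h hl⟩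

/-- The zeta function is quasi-periodic. -/
lemma exists_zeta_add (L : PeriodPair) {l : ℂ} (hl : l ∈ L.lattice) :
    ∃ c : ℂ, ∀ z ∉ L.lattice, weierstrassZeta L (z + l) = weierstrassZeta L z + c := by
  -- ζ(z + l) - ζ(z) has derivative ℘(z) - ℘(z + l) = 0, and the complement of a countable set in
  -- the plane is connected.
  have hd : ∀ z ∈ (L.lattice : Set ℂ)ᶜ,
      HasDerivAt (fun z ↦ weierstrassZeta L (z + l) - weierstrassZeta L z) 0 z := by
    intro z hz
    have h1 := (hasDerivAt_zeta L (z := z + l)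
      (by rwa [add_mem_lattice_iff hl])).comp_add_const z l
    refine (h1.sub (hasDerivAt_zeta L hz)).congr_deriv ?_
    rw [L.weierstrassP_add_coe z ⟨l, hl⟩]
    ring
  obtain ⟨c, hc⟩ := (isOpen_compl_lattice L).exists_is_const_of_deriv_eq_zero
    (isPreconnected_compl_lattice L)
    (fun z hz ↦ (hd z hz).differentiableAt.differentiableWithinAt) (fun z hz ↦ (hd z hz).deriv)
  exact ⟨c, fun z hz ↦ by linear_combination hc z hz⟩

end

/-! ### The addition formula and the fibres and critical points of ℘ -/

section

open Filter Asymptotics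

/-- Riemann's removable singularity theorem applied at all points at once. The extension is the
limit through punctured neighbourhoods, so the values assigned to f at its singularities play no
role. -/
lemma exists_entire_extension {f : ℂ → ℂ} (hd : ∀ z, ∀ᶠ w in 𝓝[≠] z, DifferentiableAt ℂ f w)
    (hb : ∀ z, f =O[𝓝[≠] z] fun _ ↦ (1 : ℂ)) :
    ∃ F : ℂ → ℂ, Differentiable ℂ F ∧ ∀ z, ContinuousAt f z → F z = f z := by
  have hcont : ∀ z, ContinuousAt f z → limUnder (𝓝[≠] z) f = f z := fun z hz ↦
    (hz.tendsto.mono_left nhdsWithin_le_nhds).limUnder_eq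
  refine ⟨fun z ↦ limUnder (𝓝[≠] z) f, fun z ↦ ?_, hcont⟩
  obtain ⟨C, hC⟩ := (hb z).bound
  have h := (hd z).and hC
  rw [eventually_nhdsWithin_iff] at h
  obtain ⟨s, hs, hs'⟩ := h.exists_mem
  have h1 : DifferentiableOn ℂ f (s \ {z}) := fun w hw ↦
    (hs' w hw.1 hw.2).1.differentiableWithinAt
  have h2 := Complex.differentiableOn_update_limUnder_of_bddAbove hs h1 (by
    refine ⟨C, ?_⟩
    rintro _ ⟨w, hw, rfl⟩
    simpa using (hs' w hw.1 hw.2).2)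
  refine (h2.differentiableAt hs).congr_of_eventuallyEq ?_
  filter_upwards [hs] with w hw
  by_cases hwz : w = z
  · subst hwz; simp
  · rw [Function.update_of_ne hwz]
    exact hcont w (hs' w hw hwz).1.continuousAt

/-- Liouville's theorem: a continuous periodic function has compact range. -/
lemma eq_of_entire_periodic (L : PeriodPair) {F : ℂ → ℂ} (hF : Differentiable ℂ F)
    (hp : ∀ l ∈ L.lattice, ∀ z, F (z + l) = F z) (z w : ℂ) : F z = F w :=
  hF.apply_eq_apply_of_bounded (IsZLattice.isCompact_range_of_periodic L.lattice _
    hF.continuous fun z l hl ↦ hp l hl z).isBounded z w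

lemma tendsto_add_punctured (a z : ℂ) : Tendsto (fun w ↦ w + a) (𝓝[≠] z) (𝓝[≠] (z + a)) := by
  refine tendsto_nhdsWithin_iff.2 ⟨?_, ?_⟩
  · exact ((continuous_add_const a).tendsto z).mono_left nhdsWithin_le_nhds
  · filter_upwards [self_mem_nhdsWithin] with w hw
    simpa using hw

lemma eventually_notMem_lattice (L : PeriodPair) (z : ℂ) : ∀ᶠ w in 𝓝[≠] z, w ∉ L.lattice := by
  rw [eventually_nhdsWithin_iff]
  filter_upwards [L.compl_lattice_sdiff_singleton_mem_nhds z] with w hw hwz hwl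
  exact hw ⟨hwl, hwz⟩

lemma eventually_add_notMem_lattice (L : PeriodPair) (a z : ℂ) :
    ∀ᶠ w in 𝓝[≠] z, w + a ∉ L.lattice :=
  (tendsto_add_punctured a z).eventually (eventually_notMem_lattice L (z + a))

lemma differentiableAt_wp (L : PeriodPair) {z : ℂ} (hz : z ∉ L.lattice) :
    DifferentiableAt ℂ L.weierstrassP z :=
  L.differentiableOn_weierstrassP.differentiableAt ((isOpen_compl_lattice L).mem_nhds hz)

lemma differentiableAt_derivWp (L : PeriodPair) {z : ℂ} (hz : z ∉ L.lattice) :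
    DifferentiableAt ℂ L.derivWeierstrassP z :=
  L.differentiableOn_derivWeierstrassP.differentiableAt ((isOpen_compl_lattice L).mem_nhds hz)

lemma isBigO_zeta (L : PeriodPair) {l : ℂ} (hl : l ∈ L.lattice) :
    weierstrassZeta L =O[𝓝[≠] l] fun w ↦ (w - l)⁻¹ := by
  have h0 : ContinuousAt (fun z ↦ zetaExcept L l z + (1 / l + z / l ^ 2)) l :=
    (((differentiableOn_zetaExcept L l).differentiableAt
      (L.compl_lattice_sdiff_singleton_mem_nhds l)).continuousAt).add (by fun_prop)
  have h1 : (fun z ↦ zetaExcept L l z + (1 / l + z / l ^ 2)) =O[𝓝[≠] l] fun _ ↦ (1 : ℂ) :=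
    (h0.tendsto.isBigO_one ℂ).mono nhdsWithin_le_nhds
  have h2 : (fun _ ↦ (1 : ℂ)) =O[𝓝[≠] l] fun w ↦ (w - l)⁻¹ := by
    have h3 : Tendsto (fun w : ℂ ↦ w - l) (𝓝[≠] l) (𝓝 0) := by
      have : ContinuousAt (fun w : ℂ ↦ w - l) l := by fun_prop
      simpa using this.tendsto.mono_left nhdsWithin_le_nhds
    have h4 := (h3.isBigO_one ℂ).mul (isBigO_refl (fun w ↦ (w - l)⁻¹) (𝓝[≠] l))
    refine (h4.congr' ?_ (.of_forall fun w ↦ by simp))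
    filter_upwards [self_mem_nhdsWithin] with w hw
    exact mul_inv_cancel₀ (sub_ne_zero.2 hw)
  refine ((h1.trans h2).add (isBigO_refl (fun w ↦ (w - l)⁻¹) (𝓝[≠] l))).congr_left fun w ↦ ?_
  rw [zeta_eq_zetaExcept_add L ⟨l, hl⟩ w]
  simp only [one_div]
  ring

lemma isBigO_sq_of_deriv_eq_zero {f : ℂ → ℂ} {z : ℂ} (hf : AnalyticAt ℂ f z) (h0 : f z = 0)
    (h1 : deriv f z = 0) : f =O[𝓝 z] fun w ↦ (w - z) ^ 2 := by
  have h2 := hf.analyticOrderAt_deriv_add_one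
  have h3 : (1 : ℕ∞) ≤ analyticOrderAt (deriv f) z := by
    rw [Order.one_le_iff_ne_zero]
    exact hf.deriv.analyticOrderAt_ne_zero.2 h1
  have h4 : ((2 : ℕ) : ℕ∞) ≤ analyticOrderAt f z := by
    have h5 : analyticOrderAt (f · - f z) z = analyticOrderAt f z := by simp [h0]
    rw [← h5, ← h2, Nat.cast_ofNat, ← one_add_one_eq_two]
    gcongr
  obtain ⟨g, hg, hfg⟩ := (natCast_le_analyticOrderAt hf).1 h4
  have h6 := (isBigO_refl (fun w : ℂ ↦ (w - z) ^ 2) (𝓝 z)).mul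
    (hg.continuousAt.tendsto.isBigO_one ℂ)
  exact h6.congr' (hfg.mono fun w hw ↦ hw.symm) (.of_forall fun w ↦ by simp)

/-- The sum `ζ(z + p) + ζ(z - p) - 2 ζ(z)`. -/
def zetaDiff (L : PeriodPair) (p z : ℂ) : ℂ :=
  weierstrassZeta L (z + p) + weierstrassZeta L (z - p) - 2 * weierstrassZeta L z

/-- With B(w) = ζ(w + p) + ζ(w - p), oddness of ζ and ζ' = -℘ give B(w) = -2℘(p)w + O(w²). So
`zetaDiff` is -2/w - 2℘(p)w + O(w²), while ℘(w) - ℘(p) is 1/w² - ℘(p) + O(w). In the product the 1/w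
terms cancel, and -2/w³ is the principal part of ℘'. -/
lemma isBigO_addition_at_zero (L : PeriodPair) {p : ℂ} (hp : p ∉ L.lattice) :
    (fun z ↦ (L.weierstrassP z - L.weierstrassP p) * zetaDiff L p z - L.derivWeierstrassP z)
      =O[𝓝[≠] 0] fun _ ↦ (1 : ℂ) := by
  have hp' : -p ∉ L.lattice := by simpa using hp
  have hopen : (L.lattice \ {0} : Set ℂ)ᶜ ∈ 𝓝 (0 : ℂ) :=
    L.compl_lattice_sdiff_singleton_mem_nhds 0
  set z0 := zetaExcept L 0
  set p0 := L.weierstrassPExcept 0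
  set B : ℂ → ℂ := fun z ↦ weierstrassZeta L (z + p) + weierstrassZeta L (z - p)
  have hz0 : AnalyticAt ℂ z0 0 :=
    (differentiableOn_zetaExcept L 0).analyticAt hopen
  have hz0v : z0 0 = 0 := by
    have := zetaExcept_zero_neg L 0
    rw [neg_zero] at this
    linear_combination (1 / 2 : ℂ) * this
  have hz0d : deriv z0 0 = 0 := by
    simp [z0, deriv_zetaExcept L 0 (x := 0) (by simp)]
  have hp0 : AnalyticAt ℂ p0 0 := L.analyticAt_weierstrassPExcept 0
  have hp0v : p0 0 = 0 := L.weierstrassPExcept_zero 0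
  have hB : AnalyticAt ℂ B 0 := by
    have h1 : ∀ a ∉ L.lattice, AnalyticAt ℂ (fun z ↦ weierstrassZeta L (z + a)) 0 := by
      intro a ha
      have : AnalyticAt ℂ (weierstrassZeta L) (0 + a) := by
        refine DifferentiableOn.analyticAt (s := (L.lattice : Set ℂ)ᶜ)
          (fun w hw ↦ (hasDerivAt_zeta L hw).differentiableAt.differentiableWithinAt)
          ((isOpen_compl_lattice L).mem_nhds (by simpa using ha))
      exact this.comp (f := fun z : ℂ ↦ z + a) (by fun_prop)
    exact (h1 p hp).add (by simpa [sub_eq_add_neg] using h1 (-p) hp')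
  have hBd : HasDerivAt B (-2 * L.weierstrassP p) 0 := by
    have h1 := (hasDerivAt_zeta L (z := 0 + p) (by simpa using hp)).comp_add_const 0 p
    have h2 := (hasDerivAt_zeta L (z := 0 - p) (by simpa using hp)).comp_sub_const 0 p
    refine (h1.add h2).congr_deriv ?_
    simp only [zero_add, zero_sub, L.weierstrassP_neg]
    ring
  have hBv : B 0 = 0 := by simp [B, zeta_neg]
  have e1 : (fun w ↦ B w - 2 * z0 w + 2 * L.weierstrassP p * w) =O[𝓝[≠] 0] fun w ↦ w ^ 2 := by
    have := isBigO_sq_of_deriv_eq_zero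
      (f := fun w ↦ B w - 2 * z0 w + 2 * L.weierstrassP p * w) (z := 0)
      ((hB.sub (analyticAt_const.mul hz0)).add (analyticAt_const.mul analyticAt_id))
      (by simp [hBv, hz0v]) (by
        have h3 := (hBd.sub ((hz0.differentiableAt.hasDerivAt).const_mul 2)).add
          ((hasDerivAt_id (0 : ℂ)).const_mul (2 * L.weierstrassP p))
        refine (HasDerivAt.deriv (h3.congr_of_eventuallyEq (.of_forall fun w ↦ ?_))).trans ?_
        · simp
        · rw [hz0d]; ring)
    simpa using this.mono nhdsWithin_le_nhds
  have e2 : p0 =O[𝓝[≠] 0] fun w ↦ w := by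
    have := hp0.differentiableAt.isBigO_sub
    simpa [hp0v] using this.mono nhdsWithin_le_nhds
  have e3 : (fun w ↦ (p0 w - L.weierstrassP p) * (B w - 2 * z0 w) -
      L.derivWeierstrassPExcept 0 w) =O[𝓝[≠] 0] fun _ ↦ (1 : ℂ) := by
    have : ContinuousAt (fun w ↦ (p0 w - L.weierstrassP p) * (B w - 2 * z0 w) -
      L.derivWeierstrassPExcept 0 w) 0 := by
      have h1 := hp0.continuousAt
      have h2 := hB.continuousAt
      have h3 := hz0.continuousAt
      have h4 := (L.analyticAt_derivWeierstrassPExcept 0).continuousAt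
      fun_prop
    exact (this.tendsto.isBigO_one ℂ).mono nhdsWithin_le_nhds
  have e4 := (e1.mul (isBigO_refl (fun w : ℂ ↦ (w ^ 2)⁻¹) (𝓝[≠] 0))).congr'
    EventuallyEq.rfl (g₂ := fun _ ↦ (1 : ℂ)) (by
      filter_upwards [self_mem_nhdsWithin] with w hw
      exact mul_inv_cancel₀ (pow_ne_zero 2 hw))
  have e5 := (e2.mul (isBigO_refl (fun w : ℂ ↦ w⁻¹) (𝓝[≠] 0))).congr'
    EventuallyEq.rfl (g₂ := fun _ ↦ (1 : ℂ)) (by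
      filter_upwards [self_mem_nhdsWithin] with w hw
      exact mul_inv_cancel₀ hw)
  refine ((e4.sub (e5.const_mul_left 2)).add e3).congr' ?_ EventuallyEq.rfl
  filter_upwards [self_mem_nhdsWithin] with w hw
  have hw0 : w ≠ 0 := hw
  have h1 := L.weierstrassPExcept_add 0 w
  have h2 := zeta_eq_zetaExcept_add L 0 w
  have h3 := L.derivWeierstrassPExcept_def 0 w
  simp only [ZeroMemClass.coe_zero, sub_zero, div_zero, add_zero, ne_eq, OfNat.ofNat_ne_zero,
    not_false_eq_true, zero_pow] at h1 h2 h3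
  rw [zetaDiff, ← h1, h2, h3]
  simp only [B, z0, p0]
  field_simp
  ring

/-- The difference Φ of the two sides is periodic, as the quasi-periods cancel in `zetaDiff`. It is
bounded at periods by the Laurent expansion above, and at ±p modulo periods because the simple pole
of ζ meets a zero of ℘(z) - ℘(p). Hence Φ is constant, and being odd it is zero. -/
lemma addition_formula_aux (L : PeriodPair) {p : ℂ} (hp : p ∉ L.lattice) :
    ∀ z, z ∉ L.lattice → z + p ∉ L.lattice → z - p ∉ L.lattice →
      (L.weierstrassP z - L.weierstrassP p) * zetaDiff L p z = L.derivWeierstrassP z := by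
  set Φ : ℂ → ℂ := fun z ↦
    (L.weierstrassP z - L.weierstrassP p) * zetaDiff L p z - L.derivWeierstrassP z with hΦ
  have hdiff : ∀ z, z ∉ L.lattice → z + p ∉ L.lattice → z - p ∉ L.lattice →
      DifferentiableAt ℂ Φ z := by
    intro z h1 h2 h3
    have d1 := differentiableAt_wp L h1
    have d2 := (hasDerivAt_zeta L h1).differentiableAt
    have d3 := ((hasDerivAt_zeta L h2).comp_add_const z p).differentiableAt
    have d4 := ((hasDerivAt_zeta L h3).comp_sub_const z p).differentiableAt
    have d5 := differentiableAt_derivWp L h1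
    exact ((d1.sub_const _).mul ((d3.add d4).sub (d2.const_mul 2))).sub d5
  have hev : ∀ z, ∀ᶠ w in 𝓝[≠] z, w ∉ L.lattice ∧ w + p ∉ L.lattice ∧ w - p ∉ L.lattice := by
    intro z
    filter_upwards [eventually_notMem_lattice L z, eventually_add_notMem_lattice L p z,
      eventually_add_notMem_lattice L (-p) z] with w h1 h2 h3
    exact ⟨h1, h2, by rwa [sub_eq_add_neg]⟩
  have hper : ∀ l ∈ L.lattice, ∀ z, z ∉ L.lattice → z + p ∉ L.lattice → z - p ∉ L.lattice →
      Φ (z + l) = Φ z := by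
    intro l hl z h1 h2 h3
    obtain ⟨c, hc⟩ := exists_zeta_add L hl
    simp only [hΦ, zetaDiff]
    rw [L.weierstrassP_add_coe z ⟨l, hl⟩, L.derivWeierstrassP_add_coe z ⟨l, hl⟩, hc z h1,
      show z + l + p = z + p + l by ring, show z + l - p = z - p + l by ring, hc _ h2, hc _ h3]
    ring
  have hbdd : ∀ z, Φ =O[𝓝[≠] z] fun _ ↦ (1 : ℂ) := by
    intro z
    by_cases hz : z ∈ L.lattice
    · have h1 := (isBigO_addition_at_zero L hp).comp_tendsto
        (show Tendsto (fun w ↦ w + -z) (𝓝[≠] z) (𝓝[≠] 0) by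
          simpa using tendsto_add_punctured (-z) z)
      refine h1.congr' ?_ EventuallyEq.rfl
      filter_upwards [hev z] with w hw
      exact hper (-z) (neg_mem hz) w hw.1 hw.2.1 hw.2.2
    · have hwz := differentiableAt_wp L hz
      have key : ∀ a : ℂ, L.weierstrassP a = L.weierstrassP p →
          (fun w ↦ (L.weierstrassP w - L.weierstrassP p) * weierstrassZeta L (w + a))
            =O[𝓝[≠] z] fun _ ↦ (1 : ℂ) := by
        intro a ha
        by_cases hza : z + a ∈ L.lattice
        · have h1 : L.weierstrassP z = L.weierstrassP p := by
            have := L.weierstrassP_add_coe (-a) ⟨z + a, hza⟩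
            rw [L.weierstrassP_neg, ha] at this
            rw [← this]
            simp
          have h2 := (hwz.isBigO_sub.mono (nhdsWithin_le_nhds (s := {z}ᶜ)))
          have h3 := (isBigO_zeta L hza).comp_tendsto (tendsto_add_punctured a z)
          rw [h1] at h2
          refine (h2.mul h3).congr' EventuallyEq.rfl ?_
          filter_upwards [self_mem_nhdsWithin] with w hw
          have hw' : w - z ≠ 0 := sub_ne_zero.2 hw
          simp [hw']
        · have h1 := ((hasDerivAt_zeta L hza).comp_add_const z a).continuousAt
          have h2 := hwz.continuousAt
          have h3 : ContinuousAt (fun w ↦ (L.weierstrassP w - L.weierstrassP p) *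
            weierstrassZeta L (w + a)) z := by fun_prop
          exact (h3.tendsto.isBigO_one ℂ).mono nhdsWithin_le_nhds
      have h1 := key p rfl
      have h2 := key (-p) (L.weierstrassP_neg p)
      have h3 : ContinuousAt (fun w ↦ (L.weierstrassP w - L.weierstrassP p) *
            (2 * weierstrassZeta L w) + L.derivWeierstrassP w) z := by
        have e1 := (hasDerivAt_zeta L hz).continuousAt
        have e2 := hwz.continuousAt
        have e3 := (differentiableAt_derivWp L hz).continuousAt
        fun_prop
      refine ((h1.add h2).sub ((h3.tendsto.isBigO_one ℂ).mono nhdsWithin_le_nhds)).congr_left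
        fun w ↦ ?_
      simp only [hΦ, zetaDiff, ← sub_eq_add_neg]
      ring
  obtain ⟨F, hF, hFeq⟩ := exists_entire_extension (f := Φ)
    (fun z ↦ (hev z).mono fun w hw ↦ hdiff w hw.1 hw.2.1 hw.2.2) hbdd
  have hFev : ∀ z, ∀ᶠ w in 𝓝[≠] z, F w = Φ w ∧ (w ∉ L.lattice ∧ w + p ∉ L.lattice ∧
      w - p ∉ L.lattice) := fun z ↦ by
    filter_upwards [hev z] with w hw
    exact ⟨hFeq w (hdiff w hw.1 hw.2.1 hw.2.2).continuousAt, hw⟩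
  have hFper : ∀ l ∈ L.lattice, ∀ z, F (z + l) = F z := by
    intro l hl z
    have hc : Continuous fun w ↦ F (w + l) := hF.continuous.comp (continuous_add_const l)
    refine tendsto_nhds_unique_of_eventuallyEq (l := 𝓝[≠] z)
      ((hc.tendsto z).mono_left nhdsWithin_le_nhds)
      ((hF.continuous.tendsto z).mono_left nhdsWithin_le_nhds) ?_
    filter_upwards [hFev z, (tendsto_add_punctured l z).eventually (hFev (z + l))] with w h1 h2
    rw [h1.1, h2.1, hper l hl w h1.2.1 h1.2.2.1 h1.2.2.2]
  intro z h1 h2 h3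
  have hodd : Φ (-z) = - Φ z := by
    simp only [hΦ, zetaDiff]
    rw [L.weierstrassP_neg, L.derivWeierstrassP_neg, zeta_neg,
      show -z + p = -(z - p) by ring, show -z - p = -(z + p) by ring, zeta_neg, zeta_neg]
    ring
  have e1 := hFeq z (hdiff z h1 h2 h3).continuousAt
  have e2 := hFeq (-z) (hdiff (-z) (by simpa using h1)
    (by rwa [show -z + p = -(z - p) by ring, neg_mem_iff])
    (by rwa [show -z - p = -(z + p) by ring, neg_mem_iff])).continuousAt
  have e3 := eq_of_entire_periodic L hF hFper z (-z)
  have : Φ z = 0 := by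
    rw [← e1]
    rw [hodd, ← e1, ← e3] at e2
    linear_combination (1 / 2 : ℂ) * e2
  rw [hΦ] at this
  exact sub_eq_zero.1 this

lemma analyticAt_zeta (L : PeriodPair) {z : ℂ} (hz : z ∉ L.lattice) :
    AnalyticAt ℂ (weierstrassZeta L) z :=
  DifferentiableOn.analyticAt (s := (L.lattice : Set ℂ)ᶜ)
    (fun _ hw ↦ (hasDerivAt_zeta L hw).differentiableAt.differentiableWithinAt)
    ((isOpen_compl_lattice L).mem_nhds hz)

/-- By the identity theorem ℘ would be constant off the lattice, against its pole at 0. -/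
lemma not_eventually_wp_const (L : PeriodPair) {z : ℂ} (hz : z ∉ L.lattice) (c : ℂ) :
    ¬ ∀ᶠ w in 𝓝 z, L.weierstrassP w = c := by
  intro h
  have h1 : Set.EqOn L.weierstrassP (fun _ ↦ c) (L.lattice : Set ℂ)ᶜ :=
    L.analyticOnNhd_weierstrassP.eqOn_of_preconnected_of_eventuallyEq
      analyticOnNhd_const (isPreconnected_compl_lattice L) hz h
  have h2 : L.weierstrassP =ᶠ[𝓝[≠] 0] fun _ ↦ c := by
    filter_upwards [eventually_notMem_lattice L 0] with w hw using h1 hw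
  have h3 := L.order_weierstrassP 0 (zero_mem _)
  rw [meromorphicOrderAt_congr h2] at h3
  have h4 : 0 ≤ meromorphicOrderAt (fun _ : ℂ ↦ c) 0 :=
    (analyticAt_const (𝕜 := ℂ) (v := c) (x := (0 : ℂ))).meromorphicOrderAt_nonneg
  rw [h3] at h4
  exact absurd h4 (by decide)

/-- The Weierstrass function takes each value only at a pair of opposite points. -/
theorem wp_eq_wp (L : PeriodPair) {z p : ℂ} (hz : z ∉ L.lattice) (hp : p ∉ L.lattice)
    (h : L.weierstrassP z = L.weierstrassP p) : z + p ∈ L.lattice ∨ z - p ∈ L.lattice := by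
  by_contra! hcon
  obtain ⟨h1, h2⟩ := hcon
  have hf : AnalyticAt ℂ L.weierstrassP z := L.analyticOnNhd_weierstrassP z hz
  have hA : AnalyticAt ℂ (zetaDiff L p) z := by
    have a1 : AnalyticAt ℂ (fun w ↦ weierstrassZeta L (w + p)) z :=
      (analyticAt_zeta L h1).comp (f := fun w : ℂ ↦ w + p) (by fun_prop)
    have a2 : AnalyticAt ℂ (fun w ↦ weierstrassZeta L (w - p)) z :=
      (analyticAt_zeta L h2).comp (f := fun w : ℂ ↦ w - p) (by fun_prop)
    exact (a1.add a2).sub (analyticAt_const.mul (analyticAt_zeta L hz))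
  have hopen : ∀ a : ℂ, z + a ∉ L.lattice → ∀ᶠ w in 𝓝 z, w + a ∉ L.lattice := fun a ha ↦
    (continuous_add_const a).continuousAt.eventually
      ((isOpen_compl_lattice L).mem_nhds (x := z + a) ha)
  -- If neither z + p nor z - p is a period, the addition formula reads ℘' = (℘ - ℘(z))A near z with
  -- A analytic. Then ord(℘ - ℘(z)) = ord(℘') + 1 ≥ ord(℘ - ℘(z)) + 1 at z, so the order is infinite
  -- and ℘ is locally constant.
  have hev : deriv L.weierstrassP =ᶠ[𝓝 z]
      (fun w ↦ L.weierstrassP w - L.weierstrassP z) * zetaDiff L p := by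
    filter_upwards [hopen 0 (by simpa using hz), hopen p h1,
      hopen (-p) (by simpa [sub_eq_add_neg] using h2)] with w e1 e2 e3
    rw [L.deriv_weierstrassP, ← addition_formula_aux L hp w (by simpa using e1) e2
      (by simpa [sub_eq_add_neg] using e3), Pi.mul_apply, h]
  have h3 := hf.analyticOrderAt_deriv_add_one
  have hsub : AnalyticAt ℂ (fun w ↦ L.weierstrassP w - L.weierstrassP z) z :=
    hf.sub analyticAt_const
  rw [analyticOrderAt_congr hev, analyticOrderAt_mul hsub hA] at h3
  have h4 : analyticOrderAt (fun w ↦ L.weierstrassP w - L.weierstrassP z) z = ⊤ := by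
    by_contra hne
    lift analyticOrderAt (fun w ↦ L.weierstrassP w - L.weierstrassP z) z to ℕ using hne with n
    have h5 : (n : ℕ∞) + 1 ≤ n := by
      conv_rhs => rw [← h3]
      gcongr
      exact le_self_add
    exact absurd h5 (by exact_mod_cast (Nat.lt_succ_self n).not_ge)
  rw [analyticOrderAt_eq_top] at h4
  exact not_eventually_wp_const L hz _ (h4.mono fun w hw ↦ sub_eq_zero.1 hw)

lemma tendsto_zeta_mul (L : PeriodPair) :
    Tendsto (fun w ↦ weierstrassZeta L w * w) (𝓝[≠] 0) (𝓝 1) := by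
  have h0 : ContinuousAt (fun w ↦ zetaExcept L 0 w * w + 1) 0 :=
    ((((differentiableOn_zetaExcept L 0).differentiableAt
      (L.compl_lattice_sdiff_singleton_mem_nhds 0)).continuousAt).mul continuousAt_id).add
      continuousAt_const
  have h1 := h0.tendsto.mono_left (nhdsWithin_le_nhds (s := {0}ᶜ))
  simp only [mul_zero, zero_add] at h1
  refine h1.congr' ?_
  filter_upwards [self_mem_nhdsWithin] with w hw
  have hw' : w ≠ 0 := hw
  have := zeta_eq_zetaExcept_add L 0 w
  simp only [ZeroMemClass.coe_zero, sub_zero, div_zero, add_zero, ne_eq, OfNat.ofNat_ne_zero,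
    not_false_eq_true, zero_pow] at this
  rw [this]
  field_simp

/-- The derivative of the Weierstrass function vanishes only at half periods. -/
theorem derivWp_ne_zero (L : PeriodPair) {z : ℂ} (hz : z + z ∉ L.lattice) :
    L.derivWeierstrassP z ≠ 0 := by
  intro h0
  have hz1 : z ∉ L.lattice := fun h ↦ hz (add_mem h h)
  have hcont := (hasDerivAt_zeta L hz).comp_add_const z z |>.continuousAt
  -- If ℘'(z) = 0, the addition formula gives ζ(z - w) = 2ζ(z) - ζ(z + w) for w near z, since there
  -- ℘(w) ≠ ℘(z). The right side stays bounded as w → z because 2z is not a period, but ζ has a pole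
  -- at 0: after multiplication by z - w the limits are 0 and 1.
  have hlim : Tendsto (fun w ↦ (2 * weierstrassZeta L z - weierstrassZeta L (w + z)) * (z - w))
      (𝓝[≠] z) (𝓝 0) := by
    have : ContinuousAt (fun w ↦ (2 * weierstrassZeta L z - weierstrassZeta L (w + z)) * (z - w))
      z := by fun_prop
    simpa using this.tendsto.mono_left (nhdsWithin_le_nhds (s := {z}ᶜ))
  have hsub : Tendsto (fun w ↦ z - w) (𝓝[≠] z) (𝓝[≠] 0) := by
    refine tendsto_nhdsWithin_iff.2 ⟨?_, ?_⟩
    · have : ContinuousAt (fun w ↦ z - w) z := by fun_prop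
      simpa using this.tendsto.mono_left (nhdsWithin_le_nhds (s := {z}ᶜ))
    · filter_upwards [self_mem_nhdsWithin] with w hw
      exact sub_ne_zero.2 (Ne.symm hw)
  have hlim' := (tendsto_zeta_mul L).comp hsub
  refine zero_ne_one (tendsto_nhds_unique (hlim.congr' ?_) hlim')
  have hsub' : ∀ᶠ w in 𝓝[≠] z, z - w ∉ L.lattice :=
    hsub.eventually (eventually_notMem_lattice L 0)
  have hadd : ∀ᶠ w in 𝓝[≠] z, z + w ∉ L.lattice := by
    simpa only [add_comm] using eventually_add_notMem_lattice L z z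
  filter_upwards [hsub', hadd, eventually_notMem_lattice L z] with w h1 h2 h3
  have h4 := addition_formula_aux L h3 z hz1 h2 h1
  rw [h0] at h4
  have h5 : L.weierstrassP z - L.weierstrassP w ≠ 0 := by
    intro h6
    rcases wp_eq_wp L hz1 h3 (sub_eq_zero.1 h6) with h7 | h7
    exacts [h2 h7, h1 h7]
  have h6 := (mul_eq_zero.1 h4).resolve_left h5
  rw [zetaDiff] at h6
  rw [Function.comp_apply]
  congr 1
  rw [add_comm w z]
  linear_combination -h6

end

/-! ### The logarithm as fundamental solution of the Laplacian -/

section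

open Filter Asymptotics

/-- Directional derivative. -/
def dirD (v : ℂ) (f : ℂ → ℝ) (z : ℂ) : ℝ := fderiv ℝ f z v

lemma contDiff_dirD {f : ℂ → ℝ} {m n : ℕ∞} (hf : ContDiff ℝ n f) (hmn : m + 1 ≤ n) (v : ℂ) :
    ContDiff ℝ m (dirD v f) :=
  (hf.fderiv_right (by exact_mod_cast hmn)).clm_apply contDiff_const

lemma tsupport_dirD_subset (f : ℂ → ℝ) (v : ℂ) : tsupport (dirD v f) ⊆ tsupport f := by
  refine closure_minimal (fun z hz ↦ ?_) isClosed_closure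
  refine support_fderiv_subset ℝ (f := f) ?_
  intro h
  apply hz
  rw [dirD, h, zero_apply]

lemma hasCompactSupport_dirD {f : ℂ → ℝ} (hf : HasCompactSupport f) (v : ℂ) :
    HasCompactSupport (dirD v f) :=
  hf.of_isClosed_subset isClosed_closure (tsupport_dirD_subset f v)

lemma laplacian_eq_dirD {f : ℂ → ℝ} {z : ℂ} (hf : ContDiffAt ℝ 2 f z) :
    Laplacian.laplacian f z = dirD 1 (dirD 1 f) z + dirD Complex.I (dirD Complex.I f) z := by
  have h : DifferentiableAt ℝ (fderiv ℝ f) z :=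
    (hf.fderiv_right (m := 1) (by norm_num)).differentiableAt (by norm_num)
  have key : ∀ v, dirD v (dirD v f) z = fderiv ℝ (fderiv ℝ f) z v v := by
    intro v
    have : dirD v f = fun w ↦ fderiv ℝ f w v := rfl
    rw [dirD, this, fderiv_clm_apply h (by fun_prop)]
    simp
  rw [InnerProductSpace.laplacian_eq_iteratedFDeriv_complexPlane, key, key]
  simp [iteratedFDeriv_two_apply]

lemma integral_mul_dirD {f g : ℂ → ℝ} (hf : ContDiff ℝ 1 f) (hg : ContDiff ℝ 1 g)
    (hgs : HasCompactSupport g) (v : ℂ) :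
    ∫ z, f z * dirD v g z = - ∫ z, dirD v f z * g z := by
  have c1 : Continuous (dirD v f) := (contDiff_dirD (m := 0) (n := 1) hf (by simp) v).continuous
  have c2 : Continuous (dirD v g) := (contDiff_dirD (m := 0) (n := 1) hg (by simp) v).continuous
  refine integral_mul_fderiv_eq_neg_fderiv_mul_of_integrable ?_ ?_ ?_ ?_ ?_
  · exact (c1.mul hg.continuous).integrable_of_hasCompactSupport hgs.mul_left
  · exact (hf.continuous.mul c2).integrable_of_hasCompactSupport
      (hasCompactSupport_dirD hgs v).mul_left
  · exact (hf.continuous.mul hg.continuous).integrable_of_hasCompactSupport hgs.mul_left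
  · exact fun z _ ↦ hf.differentiable (by norm_num) z
  · exact fun z _ ↦ hg.differentiable (by norm_num) z

lemma integral_mul_dirD_dirD {f g : ℂ → ℝ} (hf : ContDiff ℝ 2 f) (hg : ContDiff ℝ 2 g)
    (hgs : HasCompactSupport g) (v : ℂ) :
    ∫ z, f z * dirD v (dirD v g) z = ∫ z, dirD v (dirD v f) z * g z := by
  have c1 : ContDiff ℝ 1 (dirD v f) :=
    contDiff_dirD (m := 1) (n := 2) hf (by norm_num [one_add_one_eq_two]) v
  have c2 : ContDiff ℝ 1 (dirD v g) :=
    contDiff_dirD (m := 1) (n := 2) hg (by norm_num [one_add_one_eq_two]) v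
  rw [integral_mul_dirD (hf.of_le (by norm_num)) c2 (hasCompactSupport_dirD hgs v),
    integral_mul_dirD c1 (hg.of_le (by norm_num)) hgs, neg_neg]

/-- Green's second identity. -/
lemma integral_mul_laplacian {f g : ℂ → ℝ} (hf : ContDiff ℝ 2 f) (hg : ContDiff ℝ 2 g)
    (hgs : HasCompactSupport g) :
    ∫ z, f z * Laplacian.laplacian g z = ∫ z, Laplacian.laplacian f z * g z := by
  have e1 : ∀ v : ℂ, ContDiff ℝ 0 (dirD v (dirD v f)) ∧ ContDiff ℝ 0 (dirD v (dirD v g)) :=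
    fun v ↦ ⟨contDiff_dirD (m := 0) (n := 1) (contDiff_dirD (m := 1) (n := 2) hf
      (by norm_num [one_add_one_eq_two]) v) (by simp) v,
      contDiff_dirD (m := 0) (n := 1) (contDiff_dirD (m := 1) (n := 2) hg
      (by norm_num [one_add_one_eq_two]) v) (by simp) v⟩
  have i1 : ∀ v, Integrable fun z ↦ f z * dirD v (dirD v g) z := fun v ↦
    (hf.continuous.mul (e1 v).2.continuous).integrable_of_hasCompactSupport
      (hasCompactSupport_dirD (hasCompactSupport_dirD hgs v) v).mul_left
  have i2 : ∀ v, Integrable fun z ↦ dirD v (dirD v f) z * g z := fun v ↦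
    ((e1 v).1.continuous.mul hg.continuous).integrable_of_hasCompactSupport hgs.mul_left
  simp_rw [laplacian_eq_dirD hf.contDiffAt, laplacian_eq_dirD hg.contDiffAt, mul_add, add_mul]
  rw [integral_add (i1 1) (i1 _), integral_add (i2 1) (i2 _), integral_mul_dirD_dirD hf hg hgs,
    integral_mul_dirD_dirD hf hg hgs]

lemma hasCompactSupport_laplacian {g : ℂ → ℝ} (hg : ContDiff ℝ 2 g) (hgs : HasCompactSupport g) :
    HasCompactSupport (Laplacian.laplacian g) := by
  have : Laplacian.laplacian g = dirD 1 (dirD 1 g) + dirD Complex.I (dirD Complex.I g) := by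
    ext z
    exact laplacian_eq_dirD hg.contDiffAt
  rw [this]
  exact (hasCompactSupport_dirD (hasCompactSupport_dirD hgs _) _).add
    (hasCompactSupport_dirD (hasCompactSupport_dirD hgs _) _)

lemma continuous_laplacian {g : ℂ → ℝ} (hg : ContDiff ℝ 2 g) :
    Continuous (Laplacian.laplacian g) := by
  have : Laplacian.laplacian g = dirD 1 (dirD 1 g) + dirD Complex.I (dirD Complex.I g) := by
    ext z
    exact laplacian_eq_dirD hg.contDiffAt
  rw [this]
  have (v : ℂ) : Continuous (dirD v (dirD v g)) :=
    (contDiff_dirD (m := 0) (n := 1) (contDiff_dirD (m := 1) (n := 2) hg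
      (by norm_num [one_add_one_eq_two]) v) (by simp) v).continuous
  exact (this 1).add (this _)

lemma contDiff_re : ContDiff ℝ 2 Complex.re := Complex.reCLM.contDiff
lemma contDiff_im : ContDiff ℝ 2 Complex.im := Complex.imCLM.contDiff

lemma hasFDerivAt_sq_add_sq (e : ℝ) (z : ℂ) :
    HasFDerivAt (fun z : ℂ ↦ z.re ^ 2 + z.im ^ 2 + e)
      ((2 * z.re) • Complex.reCLM + (2 * z.im) • Complex.imCLM) z := by
  have h1 := (Complex.reCLM.hasFDerivAt (x := z)).pow 2
  have h2 := (Complex.imCLM.hasFDerivAt (x := z)).pow 2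
  refine ((h1.add h2).add_const e).congr_fderiv ?_
  ext v
  simp

lemma laplacian_sq_add_sq (z : ℂ) :
    Laplacian.laplacian (fun z : ℂ ↦ z.re ^ 2 + z.im ^ 2) z = 4 := by
  have h0 : ContDiff ℝ 2 (fun z : ℂ ↦ z.re ^ 2 + z.im ^ 2) :=
    (contDiff_re.pow 2).add (contDiff_im.pow 2)
  have h1 : ∀ v : ℂ, dirD v (fun z : ℂ ↦ z.re ^ 2 + z.im ^ 2) =
      fun z ↦ 2 * z.re * v.re + 2 * z.im * v.im := by
    intro v
    ext z
    have := (hasFDerivAt_sq_add_sq 0 z).fderiv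
    simp only [add_zero] at this
    rw [dirD, this]
    simp
  have h2 : ∀ v w : ℂ, dirD w (fun z ↦ 2 * z.re * v.re + 2 * z.im * v.im) z =
      2 * w.re * v.re + 2 * w.im * v.im := by
    intro v w
    have e1 := ((Complex.reCLM.hasFDerivAt (x := z)).const_mul 2).mul_const v.re
    have e2 := ((Complex.imCLM.hasFDerivAt (x := z)).const_mul 2).mul_const v.im
    have := (e1.add e2).fderiv
    rw [dirD]
    erw [this]
    simp
    ring
  rw [laplacian_eq_dirD h0.contDiffAt, h1, h1, h2, h2]
  simp
  norm_num

/-- The smoothed logarithm `log (|z|² + e) / 2`. -/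
def smoothLog (e : ℝ) (z : ℂ) : ℝ := Real.log (z.re ^ 2 + z.im ^ 2 + e) / 2

lemma contDiff_smoothLog {e : ℝ} (he : 0 < e) : ContDiff ℝ 2 (smoothLog e) := by
  refine ContDiff.div_const (ContDiff.log ?_ fun z ↦ by positivity) 2
  exact ((contDiff_re.pow 2).add (contDiff_im.pow 2)).add contDiff_const

lemma laplacian_smoothLog {e : ℝ} (he : 0 < e) (z : ℂ) :
    Laplacian.laplacian (smoothLog e) z = 2 * e / (z.re ^ 2 + z.im ^ 2 + e) ^ 2 := by
  have hq : ∀ z : ℂ, z.re ^ 2 + z.im ^ 2 + e ≠ 0 := fun z ↦ by positivity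
  have h1 : ∀ v : ℂ, dirD v (smoothLog e) =
      fun z ↦ (z.re * v.re + z.im * v.im) * (z.re ^ 2 + z.im ^ 2 + e)⁻¹ := by
    intro v
    ext z
    have h := ((hasFDerivAt_sq_add_sq e z).log (hq z)).mul_const (2⁻¹ : ℝ)
    have := h.fderiv
    have h' : smoothLog e = fun z ↦ Real.log (z.re ^ 2 + z.im ^ 2 + e) * 2⁻¹ := by
      ext z; rw [smoothLog, div_eq_mul_inv]
    rw [dirD, h', this]
    simp
    field_simp
  have h2 : ∀ v : ℂ, dirD v (fun z ↦ (z.re * v.re + z.im * v.im) *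
      (z.re ^ 2 + z.im ^ 2 + e)⁻¹) z =
      (v.re * v.re + v.im * v.im) / (z.re ^ 2 + z.im ^ 2 + e) -
        2 * (z.re * v.re + z.im * v.im) ^ 2 / (z.re ^ 2 + z.im ^ 2 + e) ^ 2 := by
    intro v
    have e1 := (Complex.reCLM.hasFDerivAt (x := z)).mul_const v.re
    have e2 := (Complex.imCLM.hasFDerivAt (x := z)).mul_const v.im
    have e3 := (hasDerivAt_inv (hq z)).comp_hasFDerivAt z (hasFDerivAt_sq_add_sq e z)
    have := ((e1.add e2).mul e3).fderiv
    rw [dirD]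
    erw [this]
    have := hq z
    simp
    field_simp
    ring
  rw [laplacian_eq_dirD (contDiff_smoothLog he).contDiffAt, h1, h1, h2, h2]
  have := hq z
  simp
  field_simp
  ring

lemma sq_norm_eq (z : ℂ) : z.re ^ 2 + z.im ^ 2 = ‖z‖ ^ 2 := by
  rw [Complex.sq_norm, Complex.normSq_apply]
  ring

lemma integral_one_add_sq_norm : ∫ z : ℂ, ((1 + ‖z‖ ^ 2) ^ 2)⁻¹ = Real.pi := by
  rw [integral_fun_norm_addHaar volume (fun r : ℝ ↦ ((1 + r ^ 2) ^ 2)⁻¹)]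
  have h1 : ∫ y in Set.Ioi (0 : ℝ), y * ((1 + y ^ 2) ^ 2)⁻¹ = 0 - (-(1 + (0 : ℝ) ^ 2)⁻¹ / 2) := by
    refine integral_Ioi_of_hasDerivAt_of_nonneg' (g := fun y : ℝ ↦ -(1 + y ^ 2)⁻¹ / 2) ?_ ?_ ?_
    · intro y _
      have hy : 1 + y ^ 2 ≠ 0 := by positivity
      have := (((hasDerivAt_pow 2 y).const_add 1).inv hy).neg.div_const 2
      refine this.congr_deriv ?_
      field_simp
      norm_num
      ring
    · intro y hy
      have : (0 : ℝ) < y := hy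
      positivity
    · have : Tendsto (fun y : ℝ ↦ 1 + y ^ 2) atTop atTop :=
        tendsto_atTop_add_const_left _ _ (tendsto_pow_atTop (by norm_num))
      simpa using (this.inv_tendsto_atTop.neg).div_const 2
  have hb : (volume : Measure ℂ).real (Metric.ball 0 1) = Real.pi := by
    rw [Measure.real, Complex.volume_ball]
    simp
  rw [Complex.finrank_real_complex, hb]
  simp only [smul_eq_mul, nsmul_eq_mul]
  norm_num at h1 ⊢
  rw [h1]
  ring

/-- The Laplacian of `smoothLog (c ^ 2)⁻¹` is 2π · c²ψ(cz), where ψ(z) = (1 + |z|²)⁻²/π has mass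
one; this is 2π times an approximate identity as c → ∞. -/
lemma tendsto_integral_laplacian_smoothLog {φ : ℂ → ℝ} (hφ : Continuous φ)
    (hs : HasCompactSupport φ) :
    Tendsto (fun c : ℝ ↦ ∫ z, Laplacian.laplacian (smoothLog (c ^ 2)⁻¹) z * φ z) atTop
      (𝓝 (2 * Real.pi * φ 0)) := by
  have h := tendsto_integral_comp_smul_smul_of_integrable (μ := (volume : Measure ℂ))
    (φ := fun z : ℂ ↦ Real.pi⁻¹ * ((1 + ‖z‖ ^ 2) ^ 2)⁻¹) (g := φ)
    (fun z ↦ by positivity) (by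
      rw [integral_const_mul, integral_one_add_sq_norm, inv_mul_cancel₀ Real.pi_ne_zero]) (by
      rw [Complex.finrank_real_complex]
      have : Tendsto (fun r : ℝ ↦ Real.pi⁻¹ * r⁻¹) atTop (𝓝 0) := by
        simpa using tendsto_inv_atTop_zero.const_mul Real.pi⁻¹
      refine squeeze_zero (fun z ↦ by positivity) (fun z ↦ ?_)
        (this.comp (tendsto_atTop_add_const_left _ (1 : ℝ)
          ((tendsto_pow_atTop two_ne_zero).comp (tendsto_norm_cobounded_atTop (E := ℂ)))))
      simp only [Function.comp_apply]
      rw [mul_left_comm]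
      gcongr
      rw [← div_eq_mul_inv, div_le_iff₀ (by positivity), pow_two (1 + ‖z‖ ^ 2), ← mul_assoc,
        inv_mul_cancel₀ (by positivity)]
      linarith)
    (hφ.integrable_of_hasCompactSupport hs) hφ.continuousAt
  have h2 := h.const_mul (2 * Real.pi)
  refine h2.congr' ?_
  filter_upwards [eventually_gt_atTop 0] with c hc
  rw [← integral_const_mul]
  congr 1
  ext z
  rw [laplacian_smoothLog (by positivity), sq_norm_eq, Complex.finrank_real_complex, norm_smul,
    Real.norm_eq_abs, abs_of_pos hc, smul_eq_mul]
  have := Real.pi_ne_zero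
  field_simp
  ring

/-- The bound is by a multiple of 1/|z|, which is locally integrable in dimension two. -/
lemma abs_log_norm_le {R : ℝ} {z : ℂ} (hz : z ≠ 0) (hzR : ‖z‖ < R) :
    |Real.log ‖z‖| ≤ (1 + R ^ 2) * ‖z‖ ^ (-1 : ℝ) := by
  have h0 : 0 < ‖z‖ := norm_pos_iff.2 hz
  have h1 := Real.log_le_sub_one_of_pos h0
  have h2 := Real.log_le_sub_one_of_pos (inv_pos.2 h0)
  rw [Real.log_inv] at h2
  have h3 : ‖z‖ ≤ R ^ 2 * ‖z‖⁻¹ := by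
    rw [← div_eq_mul_inv, le_div_iff₀ h0]
    nlinarith
  rw [Real.rpow_neg_one, add_mul, one_mul]
  have h4 : 0 ≤ R ^ 2 * ‖z‖⁻¹ := by positivity
  have h5 := inv_pos.2 h0
  rw [abs_le]
  constructor <;> linarith

lemma locallyIntegrable_log_norm : LocallyIntegrable (fun z : ℂ ↦ Real.log ‖z‖) volume := by
  rw [locallyIntegrable_iff]
  intro K hK
  obtain ⟨R, hR_pos, hR⟩ := hK.isBounded.exists_pos_norm_lt
  refine (integrableOn_ball_of_norm_le_rpow (C := 1 + R ^ 2) (α := 1) (r := R) (by simp)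
    (by simp) ?_ ?_).mono_set (fun z hz ↦ mem_ball_zero_iff.2 (hR z hz))
  · rw [ae_restrict_iff' Metric.isOpen_ball.measurableSet]
    have : ∀ᵐ z : ℂ, z ≠ 0 := by simp [ae_iff]
    filter_upwards [this] with z hz hzR
    exact abs_log_norm_le hz (by simpa using hzR)
  · exact (Real.measurable_log.comp measurable_norm).aestronglyMeasurable

/-- `log |z| / (2 π)` is a fundamental solution of the Laplacian. -/
theorem integral_log_norm_mul_laplacian {φ : ℂ → ℝ} (hφ : ContDiff ℝ 2 φ)
    (hs : HasCompactSupport φ) :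
    ∫ z : ℂ, Real.log ‖z‖ * Laplacian.laplacian φ z = 2 * Real.pi * φ 0 := by
  have hc := continuous_laplacian hφ
  have hcs := hasCompactSupport_laplacian hφ hs
  have h1 := tendsto_integral_laplacian_smoothLog hφ.continuous hs
  have h2 : Tendsto (fun c : ℝ ↦ ∫ z, smoothLog (c ^ 2)⁻¹ z * Laplacian.laplacian φ z) atTop
      (𝓝 (∫ z : ℂ, Real.log ‖z‖ * Laplacian.laplacian φ z)) := by
    refine tendsto_integral_filter_of_dominated_convergence
      (fun z ↦ (|Real.log ‖z‖| + |smoothLog 1 z|) * |Laplacian.laplacian φ z|) ?_ ?_ ?_ ?_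
    · filter_upwards [eventually_gt_atTop 0] with c hc0
      exact (((contDiff_smoothLog (e := (c ^ 2)⁻¹) (by positivity)).continuous).mul
        hc).aestronglyMeasurable
    -- For c ≥ 1 the smoothed logarithm lies between log |z| and `smoothLog 1 z`, whence the
    -- dominating function.
    · filter_upwards [eventually_ge_atTop 1] with c hc1
      have : ∀ᵐ z : ℂ, z ≠ 0 := by simp [ae_iff]
      filter_upwards [this] with z hz
      have hz0 : 0 < ‖z‖ := norm_pos_iff.2 hz
      rw [norm_mul, Real.norm_eq_abs, Real.norm_eq_abs]
      gcongr
      have a1 : Real.log ‖z‖ ≤ smoothLog (c ^ 2)⁻¹ z := by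
        have : Real.log ‖z‖ = Real.log (‖z‖ ^ 2) / 2 := by
          rw [Real.log_pow]; push_cast; ring
        rw [this, smoothLog, sq_norm_eq]
        gcongr
        have : 0 ≤ (c ^ 2)⁻¹ := by positivity
        linarith
      have a2 : smoothLog (c ^ 2)⁻¹ z ≤ smoothLog 1 z := by
        rw [smoothLog, smoothLog, sq_norm_eq]
        gcongr
        exact inv_le_one_of_one_le₀ (one_le_pow₀ hc1)
      rw [abs_le]
      have b1 := neg_abs_le (Real.log ‖z‖)
      have b2 := le_abs_self (smoothLog 1 z)
      have b3 := abs_nonneg (Real.log ‖z‖)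
      have b4 := abs_nonneg (smoothLog 1 z)
      constructor <;> linarith
    · have i1 := (locallyIntegrable_log_norm.integrable_smul_right_of_hasCompactSupport hc
        hcs).abs
      have i2 := (((contDiff_smoothLog one_pos).continuous.mul hc).integrable_of_hasCompactSupport
        (μ := (volume : Measure ℂ)) hcs.mul_left).abs
      refine (i1.add i2).congr (.of_forall fun z ↦ ?_)
      simp only [Pi.add_apply, Pi.mul_apply, smul_eq_mul, abs_mul]
      ring
    · have : ∀ᵐ z : ℂ, z ≠ 0 := by simp [ae_iff]
      filter_upwards [this] with z hz
      have hz0 : 0 < ‖z‖ := norm_pos_iff.2 hz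
      refine Tendsto.mul_const _ ?_
      have a1 : Tendsto (fun c : ℝ ↦ ‖z‖ ^ 2 + (c ^ 2)⁻¹) atTop (𝓝 (‖z‖ ^ 2 + 0)) :=
        (tendsto_pow_atTop two_ne_zero).inv_tendsto_atTop.const_add _
      rw [add_zero] at a1
      have a2 := (a1.log (by positivity)).div_const 2
      have : Real.log (‖z‖ ^ 2) / 2 = Real.log ‖z‖ := by
        rw [Real.log_pow]; push_cast; ring
      rw [this] at a2
      simpa only [smoothLog, sq_norm_eq] using a2
  refine tendsto_nhds_unique (h2.congr' ?_) h1
  filter_upwards [eventually_gt_atTop 0] with c hc0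
  exact integral_mul_laplacian (contDiff_smoothLog (by positivity)) hφ hs

end

/-! ### Mollification and Weyl's lemma at an isolated singularity -/

section

open Filter Asymptotics
open scoped Convolution

/-- Convolution against a locally integrable function commutes with directional derivatives. -/
lemma dirD_convolution {η u : ℂ → ℝ} (hη : ContDiff ℝ 1 η) (hs : HasCompactSupport η)
    (hu : LocallyIntegrable u volume) (v : ℂ) :
    dirD v (η ⋆[ContinuousLinearMap.lsmul ℝ ℝ, volume] u) =
      (dirD v η ⋆[ContinuousLinearMap.lsmul ℝ ℝ, volume] u) := by
  ext z
  have h := hs.hasFDerivAt_convolution_left (ContinuousLinearMap.lsmul ℝ ℝ) hη hu z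
  have hex : ConvolutionExistsAt (fderiv ℝ η) u z
      ((ContinuousLinearMap.lsmul ℝ ℝ).precompL ℂ) volume :=
    (hs.fderiv ℝ).convolutionExists_left _ (hη.continuous_fderiv one_ne_zero) hu z
  rw [dirD, h.fderiv, convolution_def, ContinuousLinearMap.integral_apply hex, convolution_def]
  rfl

lemma dirD_comp_const_sub {η : ℂ → ℝ} (hη : Differentiable ℝ η) (z v : ℂ) :
    dirD v (fun s ↦ η (z - s)) = fun s ↦ - dirD v η (z - s) := by
  ext s
  have h1 : HasFDerivAt (fun s : ℂ ↦ z - s) (-(ContinuousLinearMap.id ℝ ℂ)) s :=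
    (hasFDerivAt_id s).const_sub z
  have := ((hη (z - s)).hasFDerivAt.comp s h1).fderiv
  rw [dirD]
  erw [this]
  simp [dirD]

lemma convolution_eq_integral {η u : ℂ → ℝ} (z : ℂ) :
    (η ⋆[ContinuousLinearMap.lsmul ℝ ℝ, volume] u) z = ∫ s, u s * η (z - s) := by
  rw [convolution_def, ← integral_sub_left_eq_self _ volume z]
  simp [mul_comm]

lemma laplacian_comp_const_sub {η : ℂ → ℝ} (hη : ContDiff ℝ 2 η) (z s : ℂ) :
    Laplacian.laplacian (fun s ↦ η (z - s)) s = Laplacian.laplacian η (z - s) := by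
  have h1 : ContDiff ℝ 2 (fun s ↦ η (z - s)) := hη.comp (contDiff_const.sub contDiff_id)
  have h2 : ∀ v : ℂ, dirD v (dirD v (fun s ↦ η (z - s))) s = dirD v (dirD v η) (z - s) := by
    intro v
    have hd : ContDiff ℝ 1 (dirD v η) :=
      contDiff_dirD (m := 1) (n := 2) hη (by norm_num [one_add_one_eq_two]) v
    rw [dirD_comp_const_sub (hη.differentiable (by norm_num))]
    have h3 := congrFun (dirD_comp_const_sub (hd.differentiable (by norm_num)) z v) s
    have h4 : dirD v (fun s ↦ -dirD v η (z - s)) s = - dirD v (fun s ↦ dirD v η (z - s)) s := by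
      simp only [dirD]
      rw [fderiv_fun_neg]; rfl
    rw [h4, h3, neg_neg]
  rw [laplacian_eq_dirD h1.contDiffAt, laplacian_eq_dirD hη.contDiffAt, h2, h2]

/-- Mollifications of a distributionally harmonic function are harmonic. -/
lemma harmonicAt_convolution {η u : ℂ → ℝ} (hη : ContDiff ℝ ∞ η) (hs : HasCompactSupport η)
    (hu : LocallyIntegrable u volume) {U : Set ℂ} (hU : IsOpen U)
    (h : ∀ z ∈ U, ∫ s, u s * Laplacian.laplacian (fun s ↦ η (z - s)) s = 0) {z : ℂ} (hz : z ∈ U) :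
    InnerProductSpace.HarmonicAt (η ⋆[ContinuousLinearMap.lsmul ℝ ℝ, volume] u) z := by
  have hη2 : ContDiff ℝ 2 η := hη.of_le (by norm_cast)
  have hc : ContDiff ℝ 2 (η ⋆[ContinuousLinearMap.lsmul ℝ ℝ, volume] u) :=
    hs.contDiff_convolution_left (n := 2) _ hη2 hu
  have h1 (v : ℂ) : ContDiff ℝ 1 (dirD v η) :=
    contDiff_dirD (m := 1) (n := 2) hη2 (by norm_num [one_add_one_eq_two]) v
  have h2 (v : ℂ) : Continuous (dirD v (dirD v η)) :=
    (contDiff_dirD (m := 0) (n := 1) (h1 v) (by simp) v).continuous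
  refine ⟨hc.contDiffAt, ?_⟩
  filter_upwards [hU.mem_nhds hz] with w hw
  have key := h w hw
  have i1 (v : ℂ) : Integrable (fun s ↦ u s * dirD v (dirD v η) (w - s)) := by
    have hcs : HasCompactSupport (fun s ↦ dirD v (dirD v η) (w - s)) :=
      (hasCompactSupport_dirD (hasCompactSupport_dirD hs v) v).comp_homeomorph
        (Homeomorph.subLeft w)
    exact hu.integrable_smul_right_of_hasCompactSupport
      ((h2 v).comp (continuous_const.sub continuous_id)) hcs
  simp_rw [laplacian_comp_const_sub hη2, laplacian_eq_dirD hη2.contDiffAt, mul_add] at key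
  rw [integral_add (i1 1) (i1 _)] at key
  rw [laplacian_eq_dirD hc.contDiffAt, dirD_convolution (hη2.of_le (by norm_num)) hs hu,
    dirD_convolution (h1 1) (hasCompactSupport_dirD hs _) hu,
    dirD_convolution (hη2.of_le (by norm_num)) hs hu,
    dirD_convolution (h1 _) (hasCompactSupport_dirD hs _) hu, convolution_eq_integral,
    convolution_eq_integral, key]
  rfl

/-- Twice the Wirtinger derivative, `∂u/∂x - i ∂u/∂y`. -/
def dz (u : ℂ → ℝ) (z : ℂ) : ℂ := fderiv ℝ u z 1 - Complex.I * fderiv ℝ u z Complex.I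

/-- The standard mollifier of radius `δ`. -/
def bump (δ : ℝ) (hδ : 0 < δ) : ContDiffBump (0 : ℂ) where
  rIn := δ / 2
  rOut := δ
  rIn_pos := by linarith
  rIn_lt_rOut := by linarith

lemma tsupport_normed_bump {δ : ℝ} (hδ : 0 < δ) :
    tsupport ((bump δ hδ).normed volume) = Metric.closedBall 0 δ :=
  (bump δ hδ).tsupport_normed_eq

lemma hasCompactSupport_normed_bump {δ : ℝ} (hδ : 0 < δ) :
    HasCompactSupport ((bump δ hδ).normed volume) :=
  (bump δ hδ).hasCompactSupport_normed

/-- The mollification of `u`. -/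
def mollify (u : ℂ → ℝ) (δ : ℝ) (hδ : 0 < δ) : ℂ → ℝ :=
  ((bump δ hδ).normed volume) ⋆[ContinuousLinearMap.lsmul ℝ ℝ, volume] u

lemma tsupport_comp_const_sub_bump {δ : ℝ} (hδ : 0 < δ) (z : ℂ) :
    tsupport (fun s ↦ (bump δ hδ).normed volume (z - s)) = Metric.closedBall z δ := by
  have := tsupport_comp_eq_preimage ((bump δ hδ).normed volume) (Homeomorph.subLeft z)
  have h2 : ((bump δ hδ).normed volume) ∘ (Homeomorph.subLeft z) =
      fun s ↦ (bump δ hδ).normed volume (z - s) := rfl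
  rw [← h2, this, tsupport_normed_bump]
  ext s
  simp [dist_eq_norm, norm_sub_rev]

/-- As u is differentiable only on U, the derivative is first put on the bump and then moved to u by
parts; the translated bump is supported in a closed disc inside U. -/
lemma dirD_mollify_eq {u : ℂ → ℝ} (hu : LocallyIntegrable u volume) {δ : ℝ} (hδ : 0 < δ) {z : ℂ}
    {U : Set ℂ} (hU : IsOpen U) (hUu : ContDiffOn ℝ 1 u U) (hz : Metric.closedBall z δ ⊆ U)
    (v : ℂ) : dirD v (mollify u δ hδ) z = mollify (dirD v u) δ hδ z := by
  set η := (bump δ hδ).normed volume with hη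
  have hη1 : ContDiff ℝ 1 η := (bump δ hδ).contDiff_normed
  have hs := hasCompactSupport_normed_bump hδ
  set f : ℂ → ℝ := fun s ↦ η (z - s) with hf
  have hf1 : ContDiff ℝ 1 f := hη1.comp (contDiff_const.sub contDiff_id)
  have hfs : tsupport f = Metric.closedBall z δ := tsupport_comp_const_sub_bump hδ z
  have hfc : HasCompactSupport f := by
    rw [HasCompactSupport, hfs]
    exact isCompact_closedBall z δ
  have hfd : Continuous (dirD v f) := (contDiff_dirD (m := 0) (n := 1) hf1 (by simp) v).continuous
  have hdu : ContinuousOn (dirD v u) U :=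
    (hUu.continuousOn_fderiv_of_isOpen hU (by norm_num)).clm_apply continuousOn_const
  rw [mollify, dirD_convolution hη1 hs hu, mollify, convolution_eq_integral,
    convolution_eq_integral]
  have h1 : ∀ s, u s * dirD v η (z - s) = -(dirD v f s * u s) := by
    intro s
    rw [hf, dirD_comp_const_sub (hη1.differentiable (by norm_num))]
    ring
  simp_rw [h1]
  rw [integral_neg]
  have h2 := integral_mul_fderiv_eq_neg_fderiv_mul_of_integrable (μ := (volume : Measure ℂ))
    (f := f) (g := u) (v := v) ?_ ?_ ?_ ?_ ?_
  · rw [← hη]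
    simp_rw [mul_comm (dirD v u _)]
    exact h2.symm
  · exact hu.integrable_smul_left_of_hasCompactSupport hfd (hasCompactSupport_dirD hfc v)
  · have h3 : ContinuousOn (fun x ↦ f x * fderiv ℝ u x v) (Metric.closedBall z δ) :=
      hf1.continuous.continuousOn.mul (hdu.mono hz)
    refine (integrableOn_iff_integrable_of_support_subset ?_).1
      (h3.integrableOn_compact (isCompact_closedBall z δ))
    rw [← hfs]
    exact (Function.support_mul_subset_left _ _).trans subset_closure
  · exact hu.integrable_smul_left_of_hasCompactSupport hf1.continuous hfc
  · intro x _
    exact hf1.differentiable (by norm_num) x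
  · intro x hx
    rw [hfs] at hx
    exact (hUu.contDiffAt (hU.mem_nhds (hz hx))).differentiableAt (by norm_num)

/-- Derivatives of mollifications converge uniformly on compact subsets of the domain of
smoothness. -/
lemma exists_forall_dirD_mollify_le {u : ℂ → ℝ} (hu : LocallyIntegrable u volume)
    {U : Set ℂ} (hU : IsOpen U) (hUu : ContDiffOn ℝ 1 u U) {K : Set ℂ} (hK : IsCompact K)
    (hKU : K ⊆ U) (v : ℂ) {ε : ℝ} (hε : 0 < ε) :
    ∃ δ₀ > 0, ∀ δ (hδ : 0 < δ), δ ≤ δ₀ → ∀ z ∈ K,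
      |dirD v (mollify u δ hδ) z - dirD v u z| ≤ ε := by
  obtain ⟨r, hr, hrU⟩ := hK.exists_cthickening_subset_open hU hKU
  have hK' : IsCompact (Metric.cthickening r K) := hK.cthickening
  have hdu : ContinuousOn (dirD v u) (Metric.cthickening r K) :=
    ((hUu.continuousOn_fderiv_of_isOpen hU (by norm_num)).clm_apply continuousOn_const).mono hrU
  have huc := hK'.uniformContinuousOn_of_continuous hdu
  rw [Metric.uniformContinuousOn_iff] at huc
  obtain ⟨d, hd, hd'⟩ := huc ε hε
  refine ⟨min r d, lt_min hr hd, fun δ hδ hδ' z hz ↦ ?_⟩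
  have hsub : Metric.closedBall z δ ⊆ Metric.cthickening r K :=
    (Metric.closedBall_subset_closedBall (hδ'.trans (min_le_left _ _))).trans
      (Metric.closedBall_subset_cthickening hz r)
  rw [dirD_mollify_eq hu hδ hU hUu (hsub.trans hrU), ← Real.dist_eq]
  refine (bump δ hδ).dist_normed_convolution_le ?_ ?_
  · exact (measurable_fderiv_apply_const ℝ u v).aestronglyMeasurable
  · intro x hx
    have hx' : dist x z < δ := hx
    refine (hd' x (hsub (Metric.ball_subset_closedBall hx)) z
      (hsub (Metric.mem_closedBall_self hδ.le)) ?_).le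
    exact hx'.trans_le (hδ'.trans (min_le_right _ _))

lemma norm_dz_sub_le (u v : ℂ → ℝ) (z : ℂ) : ‖dz u z - dz v z‖ ≤
    |dirD 1 u z - dirD 1 v z| + |dirD Complex.I u z - dirD Complex.I v z| := by
  have : dz u z - dz v z = ((dirD 1 u z - dirD 1 v z : ℝ) : ℂ) -
      Complex.I * ((dirD Complex.I u z - dirD Complex.I v z : ℝ) : ℂ) := by
    simp only [dz, dirD]
    push_cast
    ring
  rw [this]
  refine (norm_sub_le _ _).trans ?_
  rw [norm_mul, Complex.norm_I, one_mul, Complex.norm_real, Complex.norm_real, Real.norm_eq_abs,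
    Real.norm_eq_abs]

/-- Weyl's lemma at an isolated singularity: the Wirtinger derivative of a function that is smooth
in a punctured disc and distributionally harmonic in the disc extends holomorphically. -/
theorem exists_holomorphic_extension {u : ℂ → ℝ} (hu : LocallyIntegrable u volume) {z₀ : ℂ}
    {ρ : ℝ} (hρ : 0 < ρ) (hsm : ContDiffOn ℝ 1 u (Metric.ball z₀ ρ \ {z₀}))
    (hw : ∀ φ : ℂ → ℝ, ContDiff ℝ ∞ φ → HasCompactSupport φ → tsupport φ ⊆ Metric.ball z₀ ρ →
      ∫ z, u z * Laplacian.laplacian φ z = 0) :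
    ∃ H : ℂ → ℂ, DifferentiableOn ℂ H (Metric.ball z₀ (ρ / 2)) ∧
      ∀ z ∈ Metric.ball z₀ (ρ / 2), z ≠ z₀ → H z = dz u z := by
  set r := ρ / 2 with hr
  have hr0 : 0 < r := by positivity
  set U := Metric.ball z₀ ρ \ {z₀} with hUdef
  have hU : IsOpen U := Metric.isOpen_ball.sdiff isClosed_singleton
  have hsphere : Metric.sphere z₀ r ⊆ U := by
    intro z hz
    rw [mem_sphere_iff_norm] at hz
    refine ⟨?_, ?_⟩
    · rw [mem_ball_iff_norm, hz]; linarith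
    · rintro rfl
      simp at hz
      linarith
  have hdzc : ContinuousOn (dz u) U := by
    have h1 (v : ℂ) : ContinuousOn (fun z ↦ ((fderiv ℝ u z v : ℝ) : ℂ)) U :=
      Complex.continuous_ofReal.comp_continuousOn
        ((hsm.continuousOn_fderiv_of_isOpen hU (by norm_num)).clm_apply continuousOn_const)
    exact (h1 1).sub (continuousOn_const.mul (h1 _))
  have hci : CircleIntegrable (dz u) z₀ r := (hdzc.mono hsphere).circleIntegrable hr0.le
  -- The Cauchy integral of `dz u` over a circle around z₀ is holomorphic in the whole disc.
  -- Mollifications of u are harmonic across z₀, so their `dz` satisfies Cauchy's formula. Letting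
  -- the radius of mollification shrink, convergence is needed only on the circle and at z ≠ z₀,
  -- where u is smooth.
  set H : ℂ → ℂ := fun z ↦ (2 * Real.pi * Complex.I : ℂ)⁻¹ • ∮ w in C(z₀, r), (w - z)⁻¹ • dz u w
    with hH
  set R : NNReal := ⟨r, hr0.le⟩ with hR
  have hps := hasFPowerSeriesOn_cauchy_integral (R := R) hci hr0
  refine ⟨H, ?_, ?_⟩
  · have := hps.differentiableOn
    have e : Metric.eball z₀ (R : ENNReal) = Metric.ball z₀ r := by
      rw [Metric.eball_coe]; rfl
    rwa [e] at this
  · intro z hz hzne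
    have hzU : z ∈ U := ⟨Metric.ball_subset_ball (by linarith) hz, hzne⟩
    set K : Set ℂ := insert z (Metric.sphere z₀ r) with hKdef
    have hK : IsCompact K := (isCompact_sphere z₀ r).insert z
    have hKU : K ⊆ U := Set.insert_subset hzU hsphere
    set d := r - ‖z - z₀‖ with hd
    have hd0 : 0 < d := by
      rw [mem_ball_iff_norm] at hz
      linarith
    rw [← sub_eq_zero, ← norm_le_zero_iff]
    refine le_of_forall_pos_le_add fun ε' hε' ↦ ?_
    -- Two directional derivatives give an error 2ε for `dz`. On the circle it is multiplied by the
    -- kernel bound 1/d and by length over 2π, which is r; the last 2ε is the error at z itself.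
    obtain ⟨ε, hε, hεε⟩ : ∃ ε > 0, r * (d⁻¹ * (2 * ε)) + 2 * ε ≤ ε' := by
      have hpos : 0 < 2 * (r * d⁻¹ + 1) := by positivity
      refine ⟨ε' / (2 * (r * d⁻¹ + 1)), by positivity, le_of_eq ?_⟩
      field_simp
    obtain ⟨δ₁, hδ₁, h1⟩ := exists_forall_dirD_mollify_le hu hU hsm hK hKU 1 hε
    obtain ⟨δ₂, hδ₂, h2⟩ := exists_forall_dirD_mollify_le hu hU hsm hK hKU Complex.I hε
    set δ := min (min δ₁ δ₂) (r / 2) with hδdef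
    have hδ : 0 < δ := lt_min (lt_min hδ₁ hδ₂) (by positivity)
    have hclose : ∀ w ∈ K, ‖dz (mollify u δ hδ) w - dz u w‖ ≤ 2 * ε := fun w hw ↦ by
      have e1 := h1 δ hδ ((min_le_left _ _).trans (min_le_left _ _)) w hw
      have e2 := h2 δ hδ ((min_le_left _ _).trans (min_le_right _ _)) w hw
      have := norm_dz_sub_le (mollify u δ hδ) u w
      linarith
    have hharm : ∀ w ∈ Metric.ball z₀ (ρ - δ),
        InnerProductSpace.HarmonicAt (mollify u δ hδ) w := by
      intro w hw'
      refine harmonicAt_convolution (bump δ hδ).contDiff_normed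
        (hasCompactSupport_normed_bump hδ) hu (Metric.isOpen_ball (x := z₀) (ε := ρ - δ)) ?_ hw'
      intro y hy
      have hts := tsupport_comp_const_sub_bump hδ y
      refine hw _ ((bump δ hδ).contDiff_normed.comp (contDiff_const.sub contDiff_id)) ?_ ?_
      · rw [HasCompactSupport, hts]
        exact isCompact_closedBall y δ
      · rw [hts]
        refine Metric.closedBall_subset_ball' ?_
        have := Metric.mem_ball.1 hy
        linarith
    have hδr : δ ≤ r / 2 := min_le_right _ _
    have hhol : DifferentiableOn ℂ (dz (mollify u δ hδ)) (Metric.ball z₀ (ρ - δ)) := fun w hw ↦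
      (HarmonicAt.differentiableAt_complex_partial (hharm w hw)).differentiableWithinAt
    have hsub : Metric.closedBall z₀ r ⊆ Metric.ball z₀ (ρ - δ) :=
      Metric.closedBall_subset_ball (by linarith)
    have hcauchy := (hhol.mono hsub).circleIntegral_sub_inv_smul hz
    have hHm : dz (mollify u δ hδ) z = (2 * Real.pi * Complex.I : ℂ)⁻¹ •
        ∮ w in C(z₀, r), (w - z)⁻¹ • dz (mollify u δ hδ) w := by
      rw [hcauchy, smul_smul, inv_mul_cancel₀ Complex.two_pi_I_ne_zero, one_smul]
    have hinv : ContinuousOn (fun w ↦ (w - z)⁻¹) (Metric.sphere z₀ r) := by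
      refine ContinuousOn.inv₀ (by fun_prop) fun w hw h0 ↦ ?_
      rw [sub_eq_zero] at h0
      subst h0
      rw [mem_sphere_iff_norm] at hw
      linarith
    have hint : ‖∮ w in C(z₀, r), (w - z)⁻¹ • (dz u w - dz (mollify u δ hδ) w)‖ ≤
        2 * Real.pi * r * (d⁻¹ * (2 * ε)) := by
      refine circleIntegral.norm_integral_le_of_norm_le_const hr0.le fun w hw ↦ ?_
      rw [norm_smul, norm_inv]
      have a1 : d ≤ ‖w - z‖ := by
        rw [mem_sphere_iff_norm] at hw
        have := norm_sub_norm_le (w - z₀) (z - z₀)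
        rw [sub_sub_sub_cancel_right] at this
        linarith
      have a2 := hclose w (Set.mem_insert_of_mem _ hw)
      rw [norm_sub_rev] at a2
      gcongr
    have heq : H z - dz (mollify u δ hδ) z = (2 * Real.pi * Complex.I : ℂ)⁻¹ •
        ∮ w in C(z₀, r), (w - z)⁻¹ • (dz u w - dz (mollify u δ hδ) w) := by
      have i1 : CircleIntegrable (fun w ↦ (w - z)⁻¹ • dz u w) z₀ r :=
        (hinv.smul (hdzc.mono hsphere)).circleIntegrable hr0.le
      have i2 : CircleIntegrable (fun w ↦ (w - z)⁻¹ • dz (mollify u δ hδ) w) z₀ r :=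
        (hinv.smul (hhol.continuousOn.mono
          (Metric.sphere_subset_closedBall.trans hsub))).circleIntegrable hr0.le
      simp_rw [smul_sub _ (dz u _)]
      rw [circleIntegral.integral_sub i1 i2, smul_sub, hHm]
    have hfin : ‖H z - dz (mollify u δ hδ) z‖ ≤ r * (d⁻¹ * (2 * ε)) := by
      rw [heq, norm_smul, norm_inv]
      have : ‖(2 * Real.pi * Complex.I : ℂ)‖ = 2 * Real.pi := by
        simp [abs_of_pos Real.pi_pos]
      rw [this, inv_mul_le_iff₀ (by positivity)]
      linarith
    have h3 := hclose z (Set.mem_insert _ _)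
    calc ‖H z - dz u z‖ ≤ ‖H z - dz (mollify u δ hδ) z‖ + ‖dz (mollify u δ hδ) z - dz u z‖ :=
          norm_sub_le_norm_sub_add_norm_sub _ _ _
      _ ≤ 0 + ε' := by linarith

end

/-! ### The gradient of the Green function in terms of ζ -/

section

open Filter Asymptotics
open scoped ComplexConjugate

lemma proj_eq_proj_iff {τ : UpperHalfPlane} {z w : ℂ} :
    proj τ z = proj τ w ↔ z - w ∈ (periods τ).lattice := by
  rw [proj, proj, QuotientAddGroup.eq, Submodule.mem_toAddSubgroup, neg_add_eq_sub,
    ← neg_mem_iff, neg_sub]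

lemma proj_add_lattice {τ : UpperHalfPlane} {z l : ℂ} (hl : l ∈ (periods τ).lattice) :
    proj τ (z + l) = proj τ z := by
  rw [proj_eq_proj_iff]
  simpa using hl

lemma proj_add (τ : UpperHalfPlane) (z w : ℂ) : proj τ (z + w) = proj τ z + proj τ w := rfl

lemma proj_sub (τ : UpperHalfPlane) (z w : ℂ) : proj τ (z - w) = proj τ z - proj τ w := rfl

lemma measurable_proj (τ : UpperHalfPlane) : Measurable (proj τ) := QuotientAddGroup.measurable_coe

lemma area_univ (τ : UpperHalfPlane) :
    (area τ) Set.univ = volume (ZSpan.fundamentalDomain (periods τ).basis) := by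
  rw [area, Measure.map_apply (measurable_proj τ) MeasurableSet.univ, Set.preimage_univ,
    Measure.restrict_apply_univ]

lemma area_real_univ_pos (τ : UpperHalfPlane) : 0 < (area τ).real Set.univ := by
  rw [Measure.real, area_univ]
  refine ENNReal.toReal_pos (ZSpan.measure_fundamentalDomain_ne_zero _) ?_
  exact (ZSpan.fundamentalDomain_isBounded (periods τ).basis).measure_lt_top.ne

lemma fderiv_eq_re_dz (u : ℂ → ℝ) (z v : ℂ) : fderiv ℝ u z v = (dz u z * v).re := by
  have hv : v = v.re • (1 : ℂ) + v.im • Complex.I := by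
    simp
  conv_lhs => rw [hv, map_add, map_smul, map_smul]
  simp [dz]
  ring

lemma dz_of_hasFDerivAt {u : ℂ → ℝ} {u' : ℂ →L[ℝ] ℝ} {z : ℂ} (h : HasFDerivAt u u' z) :
    dz u z = u' 1 - Complex.I * u' Complex.I := by
  rw [dz, h.fderiv]

lemma dz_sq (z : ℂ) : dz (fun z : ℂ ↦ z.re ^ 2 + z.im ^ 2) z = 2 * conj z := by
  have := hasFDerivAt_sq_add_sq 0 z
  simp only [add_zero] at this
  rw [dz_of_hasFDerivAt this]
  apply Complex.ext <;> simp

lemma hasFDerivAt_log_norm {z : ℂ} (hz : z ≠ 0) :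
    ∃ u' : ℂ →L[ℝ] ℝ, HasFDerivAt (fun z : ℂ ↦ Real.log ‖z‖) u' z ∧
      u' 1 - Complex.I * u' Complex.I = z⁻¹ := by
  have h0 : z.re ^ 2 + z.im ^ 2 + 0 ≠ 0 := by
    rw [add_zero, sq_norm_eq]
    exact pow_ne_zero 2 (norm_ne_zero_iff.2 hz)
  have h := ((hasFDerivAt_sq_add_sq 0 z).log h0).mul_const (2⁻¹ : ℝ)
  have he : (fun z : ℂ ↦ Real.log (z.re ^ 2 + z.im ^ 2 + 0) * 2⁻¹) = fun z : ℂ ↦ Real.log ‖z‖ := by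
    ext z
    rw [add_zero, sq_norm_eq, Real.log_pow]
    push_cast
    ring
  rw [he] at h
  refine ⟨_, h, ?_⟩
  have h1 : Complex.normSq z = z.re ^ 2 + z.im ^ 2 := by
    rw [Complex.normSq_apply]; ring
  simp only [smul_apply, add_apply, Complex.reCLM_apply, Complex.imCLM_apply, smul_eq_mul,
    Complex.one_re, Complex.one_im, Complex.I_re, Complex.I_im, mul_one, mul_zero, add_zero,
    zero_add]
  apply Complex.ext
  · simp only [Complex.sub_re, Complex.mul_re, Complex.I_re, Complex.I_im, Complex.ofReal_re,
      Complex.ofReal_im, Complex.inv_re, h1]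
    ring
  · simp only [Complex.sub_im, Complex.mul_im, Complex.I_re, Complex.I_im, Complex.ofReal_re,
      Complex.ofReal_im, Complex.inv_im, h1]
    ring

section Gradient

variable {τ : UpperHalfPlane} {G : Torus τ → ℝ}

/-- The lift of a function on the torus to the plane. -/
def lift (G : Torus τ → ℝ) (z : ℂ) : ℝ := G (proj τ z)

lemma lift_add (G : Torus τ → ℝ) {z l : ℂ} (hl : l ∈ (periods τ).lattice) :
    lift G (z + l) = lift G z := by
  rw [lift, proj_add_lattice hl, lift]

lemma dz_lift_add (G : Torus τ → ℝ) {z l : ℂ} (hl : l ∈ (periods τ).lattice) :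
    dz (lift G) (z + l) = dz (lift G) z := by
  have h : (fun w ↦ lift G (w + l)) = lift G := funext fun w ↦ lift_add G hl
  have := fderiv_comp_add_right (𝕜 := ℝ) (f := lift G) (x := z) l
  rw [h] at this
  rw [dz, ← this, dz]

/-- The inverse of the area of the torus. -/
def invArea (τ : UpperHalfPlane) : ℝ := 1 / (area τ).real Set.univ

lemma invArea_pos (τ : UpperHalfPlane) : 0 < invArea τ := one_div_pos.2 (area_real_univ_pos τ)

lemma contDiffAt_lift (hG : IsGreenFunction τ G) {z : ℂ} (hz : z ∉ (periods τ).lattice) :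
    ContDiffAt ℝ ∞ (lift G) z :=
  hG.contDiffOn.contDiffAt ((isOpen_compl_lattice _).mem_nhds hz)

lemma differentiableAt_lift (hG : IsGreenFunction τ G) {z : ℂ} (hz : z ∉ (periods τ).lattice) :
    DifferentiableAt ℝ (lift G) z := (contDiffAt_lift hG hz).differentiableAt (by simp)

lemma contDiff_sq : ContDiff ℝ ∞ (fun z : ℂ ↦ z.re ^ 2 + z.im ^ 2) :=
  (Complex.reCLM.contDiff.pow 2).add (Complex.imCLM.contDiff.pow 2)

/-- The Green function with the quadratic part and `s` times the logarithmic part removed. -/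
def regularPart (G : Torus τ → ℝ) (s : ℝ) (z : ℂ) : ℝ :=
  lift G z - invArea τ / 4 * (z.re ^ 2 + z.im ^ 2) + s / (2 * Real.pi) * Real.log ‖z‖

lemma locallyIntegrable_const_mul {f : ℂ → ℝ} (hf : LocallyIntegrable f volume) (a : ℝ) :
    LocallyIntegrable (fun z ↦ a * f z) volume := hf.smul a

lemma locallyIntegrable_regularPart (hG : IsGreenFunction τ G) (s : ℝ) :
    LocallyIntegrable (regularPart G s) volume :=
  (hG.locallyIntegrable.sub (locallyIntegrable_const_mul
    (contDiff_sq.continuous.locallyIntegrable) _)).add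
    (locallyIntegrable_const_mul locallyIntegrable_log_norm _)

lemma contDiffAt_regularPart (hG : IsGreenFunction τ G) {s : ℝ} {z : ℂ}
    (hz : z ∉ (periods τ).lattice) : ContDiffAt ℝ 1 (regularPart G s) z := by
  have hz0 : z ≠ 0 := by
    rintro rfl
    exact hz (zero_mem _)
  have h1 : ContDiffAt ℝ 1 (lift G) z :=
    (contDiffAt_lift hG hz).of_le (by norm_cast)
  have h2 : ContDiffAt ℝ 1 (fun z : ℂ ↦ z.re ^ 2 + z.im ^ 2) z :=
    (contDiff_sq.of_le (by norm_cast)).contDiffAt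
  have h3 : ContDiffAt ℝ 1 (fun z : ℂ ↦ Real.log ‖z‖) z :=
    (contDiffAt_norm ℝ hz0).log (norm_ne_zero_iff.2 hz0)
  exact (h1.sub (contDiffAt_const.mul h2)).add (contDiffAt_const.mul h3)

lemma dz_regularPart (hG : IsGreenFunction τ G) {s : ℝ} {z : ℂ} (hz : z ∉ (periods τ).lattice) :
    dz (regularPart G s) z = dz (lift G) z - invArea τ / 2 * conj z +
      s / (2 * Real.pi) * z⁻¹ := by
  have hz0 : z ≠ 0 := by
    rintro rfl
    exact hz (zero_mem _)
  obtain ⟨u', hu', hu''⟩ := hasFDerivAt_log_norm hz0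
  have h1 := (differentiableAt_lift hG hz).hasFDerivAt
  have h2 := hasFDerivAt_sq_add_sq 0 z
  simp only [add_zero] at h2
  have h2' := dz_of_hasFDerivAt h2
  rw [dz_sq] at h2'
  have h := (h1.sub (h2.const_mul (invArea τ / 4))).add (hu'.const_mul (s / (2 * Real.pi)))
  have h4 := dz_of_hasFDerivAt (u := regularPart G s) h
  rw [h4, dz, ← hu'']
  simp only [add_apply, sub_apply, smul_apply, smul_eq_mul] at h2' ⊢
  push_cast at h2' ⊢
  linear_combination (-(invArea τ : ℂ) / 4) * (-h2')

/-- The Laplacians of G, |z|²/4 and log|z|/(2π) are 1/|E_τ| - Σδ_l, 1 and δ₀. The hypothesis on φ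
says that it sees only s times the mass at 0: s = 0 serves away from the lattice, s = 1 near 0. -/
lemma integral_regularPart (hG : IsGreenFunction τ G) {s : ℝ} {φ : ℂ → ℝ} (hφ : ContDiff ℝ ∞ φ)
    (hs : HasCompactSupport φ) (hsum : (∑' l : (periods τ).lattice, φ (l : ℂ)) = s * φ 0) :
    ∫ z, regularPart G s z * Laplacian.laplacian φ z = 0 := by
  have hφ2 : ContDiff ℝ 2 φ := hφ.of_le (by norm_cast)
  have hq2 : ContDiff ℝ 2 (fun z : ℂ ↦ z.re ^ 2 + z.im ^ 2) := contDiff_sq.of_le (by norm_cast)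
  have hc := continuous_laplacian hφ2
  have hcs := hasCompactSupport_laplacian hφ2 hs
  have key : ∀ {f : ℂ → ℝ}, LocallyIntegrable f volume →
      Integrable fun z ↦ f z * Laplacian.laplacian φ z := fun hf ↦
    hf.integrable_smul_right_of_hasCompactSupport hc hcs
  have i1 := key hG.locallyIntegrable
  have i2 := key contDiff_sq.continuous.locallyIntegrable
  have i3 := key locallyIntegrable_log_norm
  have e1 := hG.equation φ hφ hs
  have e2 := integral_mul_laplacian hq2 hφ2 hs
  simp_rw [laplacian_sq_add_sq] at e2
  rw [integral_const_mul] at e2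
  have e3 := integral_log_norm_mul_laplacian hφ2 hs
  have h : ∀ z, regularPart G s z * Laplacian.laplacian φ z =
      G (proj τ z) * Laplacian.laplacian φ z -
      invArea τ / 4 * ((z.re ^ 2 + z.im ^ 2) * Laplacian.laplacian φ z) +
      s / (2 * Real.pi) * (Real.log ‖z‖ * Laplacian.laplacian φ z) := by
    intro z
    rw [regularPart, lift]
    ring
  simp_rw [h]
  have i4 : Integrable fun z ↦ G (proj τ z) * Laplacian.laplacian φ z -
      invArea τ / 4 * ((z.re ^ 2 + z.im ^ 2) * Laplacian.laplacian φ z) :=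
    i1.sub (i2.const_mul _)
  rw [integral_add i4 (i3.const_mul _), integral_sub i1 (i2.const_mul _),
    integral_const_mul, integral_const_mul, e2, e3]
  rw [hsum, ← invArea] at e1
  have := Real.pi_ne_zero
  field_simp
  linear_combination -e1

/-- The Wirtinger derivative of the Green function, normalised to have residue `1` and made
holomorphic by a linear term. -/
def gradHol (G : Torus τ → ℝ) (z : ℂ) : ℂ :=
  -(2 * Real.pi) * dz (lift G) z + Real.pi * invArea τ * conj z

lemma differentiableAt_gradHol (hG : IsGreenFunction τ G) {z : ℂ} (hz : z ∉ (periods τ).lattice) :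
    DifferentiableAt ℂ (gradHol G) z := by
  obtain ⟨r, hr, hrL⟩ := Metric.isOpen_iff.1 (isOpen_compl_lattice (periods τ)) z hz
  -- The extension result identifies H with the Wirtinger derivative only off the centre of the
  -- disc, so the disc is centred at a nearby point other than z.
  set z₁ : ℂ := z + ((r / 8 : ℝ) : ℂ) with hz₁
  have hd : dist z z₁ = r / 8 := by
    rw [hz₁, dist_self_add_right, Complex.norm_real, Real.norm_eq_abs, abs_of_pos (by positivity)]
  have hball : Metric.ball z₁ (r / 2) ⊆ ((periods τ).lattice : Set ℂ)ᶜ := by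
    refine (Metric.ball_subset_ball' ?_).trans hrL
    rw [dist_comm, hd]
    linarith
  obtain ⟨H, hH, hHeq⟩ := exists_holomorphic_extension (u := regularPart G 0)
    (locallyIntegrable_regularPart hG 0) (z₀ := z₁) (ρ := r / 2) (by positivity)
    (fun w hw ↦ (contDiffAt_regularPart hG (hball hw.1)).contDiffWithinAt) (by
      intro φ hφ hs hsupp
      refine integral_regularPart hG hφ hs ?_
      have : ∀ l : (periods τ).lattice, φ l = 0 := fun l ↦
        image_eq_zero_of_notMem_tsupport fun h ↦ hball (hsupp h) l.2
      simp [this])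
  have hzne : z ≠ z₁ := by
    rw [← dist_pos, hd]
    positivity
  have hzb : z ∈ Metric.ball z₁ (r / 2 / 2) := by
    rw [Metric.mem_ball, hd]
    linarith
  have hnb : ∀ᶠ w in 𝓝 z, w ∈ Metric.ball z₁ (r / 2 / 2) ∧ w ≠ z₁ :=
    (Metric.isOpen_ball.eventually_mem hzb).and (isOpen_ne.eventually_mem hzne)
  refine ((hH.differentiableAt (Metric.isOpen_ball.mem_nhds hzb)).const_mul
    (-(2 * Real.pi : ℂ))).congr_of_eventuallyEq ?_
  filter_upwards [hnb] with w hw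
  have hwL : w ∉ (periods τ).lattice :=
    hball (Metric.ball_subset_ball (by linarith) hw.1)
  rw [hHeq w hw.1 hw.2, dz_regularPart hG hwL, gradHol]
  push_cast
  ring

lemma gradHol_isBigO_zero (hG : IsGreenFunction τ G) :
    (fun z ↦ gradHol G z - z⁻¹) =O[𝓝[≠] 0] fun _ ↦ (1 : ℂ) := by
  obtain ⟨r, hr, hrL⟩ := Metric.isOpen_iff.1 ((periods τ).isOpen_compl_lattice_sdiff (s := {0})) 0
    (by simp)
  have hball : ∀ w ∈ Metric.ball (0 : ℂ) r, w ≠ 0 → w ∉ (periods τ).lattice :=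
    fun w hw hw0 hwl ↦ hrL hw ⟨hwl, hw0⟩
  obtain ⟨H, hH, hHeq⟩ := exists_holomorphic_extension (u := regularPart G 1)
    (locallyIntegrable_regularPart hG 1) (z₀ := 0) (ρ := r) hr
    (fun w hw ↦ (contDiffAt_regularPart hG (hball w hw.1 hw.2)).contDiffWithinAt) (by
      intro φ hφ hs hsupp
      refine integral_regularPart hG hφ hs ?_
      rw [tsum_eq_single (0 : (periods τ).lattice)]
      · simp
      · intro l hl
        refine image_eq_zero_of_notMem_tsupport fun h ↦ hball l (hsupp h) ?_ l.2
        simpa using hl)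
  have h0 : (0 : ℂ) ∈ Metric.ball (0 : ℂ) (r / 2) := by simp [hr]
  have hHc : ContinuousAt (fun z ↦ -(2 * Real.pi : ℂ) * H z) 0 :=
    continuousAt_const.mul (hH.differentiableAt (Metric.isOpen_ball.mem_nhds h0)).continuousAt
  refine ((hHc.tendsto.isBigO_one ℂ).mono nhdsWithin_le_nhds).congr' ?_ EventuallyEq.rfl
  filter_upwards [self_mem_nhdsWithin,
    mem_nhdsWithin_of_mem_nhds (Metric.isOpen_ball.mem_nhds h0)] with w hw hwb
  have hwL := hball w (Metric.ball_subset_ball (by linarith) hwb) hw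
  have hw0 : w ≠ 0 := hw
  have hpi : (Real.pi : ℂ) ≠ 0 := by exact_mod_cast Real.pi_ne_zero
  rw [hHeq w hwb hw, dz_regularPart hG hwL, gradHol]
  push_cast
  field_simp
  ring

lemma gradHol_add (G : Torus τ → ℝ) {z l : ℂ} (hl : l ∈ (periods τ).lattice) :
    gradHol G (z + l) = gradHol G z + Real.pi * invArea τ * conj l := by
  rw [gradHol, dz_lift_add G hl, gradHol, map_add]
  ring

/-- `gradHol` and ζ have the same principal parts, and both change by a constant under a period.
Their difference extends to an entire function with periodic, hence constant, derivative. -/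
lemma exists_gradHol_eq_affine (hG : IsGreenFunction τ G) :
    ∃ c d : ℂ, ∀ z ∉ (periods τ).lattice,
      gradHol G z = weierstrassZeta (periods τ) z - c * z + d := by
  set L := periods τ
  set T : ℂ → ℂ := fun z ↦ gradHol G z - weierstrassZeta L z with hT
  have hTd : ∀ z ∉ L.lattice, DifferentiableAt ℂ T z := fun z hz ↦
    (differentiableAt_gradHol hG hz).sub (hasDerivAt_zeta L hz).differentiableAt
  have hTper : ∀ l ∈ L.lattice, ∃ a : ℂ, ∀ z ∉ L.lattice, T (z + l) = T z + a := by
    intro l hl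
    obtain ⟨c, hc⟩ := exists_zeta_add L hl
    refine ⟨Real.pi * invArea τ * conj l - c, fun z hz ↦ ?_⟩
    simp only [hT]
    rw [gradHol_add G hl, hc z hz]
    ring
  have hT0 : T =O[𝓝[≠] 0] fun _ ↦ (1 : ℂ) := by
    have h0 : ContinuousAt (zetaExcept L 0) 0 :=
      ((differentiableOn_zetaExcept L 0).differentiableAt
        (L.compl_lattice_sdiff_singleton_mem_nhds 0)).continuousAt
    refine ((gradHol_isBigO_zero hG).sub
      ((h0.tendsto.isBigO_one ℂ).mono nhdsWithin_le_nhds)).congr_left fun z ↦ ?_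
    have := zeta_eq_zetaExcept_add L 0 z
    simp only [ZeroMemClass.coe_zero, sub_zero, div_zero, add_zero, ne_eq, OfNat.ofNat_ne_zero,
      not_false_eq_true, zero_pow, one_div] at this
    simp only [hT]
    rw [this]
    ring
  have hTb : ∀ z, T =O[𝓝[≠] z] fun _ ↦ (1 : ℂ) := by
    intro z
    by_cases hz : z ∈ L.lattice
    · obtain ⟨a, ha⟩ := hTper (-z) (neg_mem hz)
      have h1 := hT0.comp_tendsto
        (show Tendsto (fun w ↦ w + -z) (𝓝[≠] z) (𝓝[≠] 0) by
          simpa using tendsto_add_punctured (-z) z)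
      refine (h1.sub (isBigO_const_one ℂ a _)).congr' ?_ EventuallyEq.rfl
      filter_upwards [eventually_notMem_lattice L z] with w hw
      rw [Function.comp_apply, ha w hw]
      ring
    · exact ((hTd z hz).continuousAt.tendsto.isBigO_one ℂ).mono nhdsWithin_le_nhds
  obtain ⟨F, hF, hFeq⟩ := exists_entire_extension (f := T)
    (fun z ↦ (eventually_notMem_lattice L z).mono fun w hw ↦ hTd w hw) hTb
  have hFT : ∀ z ∉ L.lattice, F z = T z := fun z hz ↦ hFeq z (hTd z hz).continuousAt
  have hFper : ∀ l ∈ L.lattice, ∃ a : ℂ, ∀ z, F (z + l) = F z + a := by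
    intro l hl
    obtain ⟨a, ha⟩ := hTper l hl
    refine ⟨a, fun z ↦ ?_⟩
    have hc : Continuous fun w ↦ F (w + l) := hF.continuous.comp (continuous_add_const l)
    refine tendsto_nhds_unique_of_eventuallyEq (l := 𝓝[≠] z)
      ((hc.tendsto z).mono_left nhdsWithin_le_nhds)
      (((hF.continuous.add_const a).tendsto z).mono_left nhdsWithin_le_nhds) ?_
    filter_upwards [eventually_notMem_lattice L z] with w hw
    rw [hFT w hw, hFT (w + l) (by rwa [add_mem_lattice_iff hl]), ha w hw]
  have hF' : Differentiable ℂ (deriv F) := fun z ↦ (hF.analyticAt z).deriv.differentiableAt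
  have hF'per : ∀ l ∈ L.lattice, ∀ z, deriv F (z + l) = deriv F z := by
    intro l hl z
    obtain ⟨a, ha⟩ := hFper l hl
    rw [← deriv_comp_add_const, show (fun w ↦ F (w + l)) = fun w ↦ F w + a from funext ha,
      deriv_add_const]
  have hconst : ∀ z, deriv F z = deriv F 0 := fun z ↦ eq_of_entire_periodic L hF' hF'per z 0
  have hlin : ∀ z, F z - deriv F 0 * z = F 0 - deriv F 0 * 0 := by
    intro z
    refine is_const_of_deriv_eq_zero (f := fun z ↦ F z - deriv F 0 * z)
      (hF.sub (differentiable_id.const_mul _)) (fun w ↦ ?_) z 0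
    have : HasDerivAt (fun z ↦ F z - deriv F 0 * z) (deriv F w - deriv F 0 * 1) w :=
      (hF w).hasDerivAt.sub ((hasDerivAt_id w).const_mul (deriv F 0))
    rw [this.deriv, hconst w]
    ring
  refine ⟨-deriv F 0, F 0, fun z hz ↦ ?_⟩
  have h1 := hlin z
  rw [hFT z hz] at h1
  simp only [hT] at h1
  linear_combination h1

lemma half_notMem_lattice (τ : UpperHalfPlane) : (1 / 2 : ℂ) ∉ (periods τ).lattice :=
  (periods τ).ω₁_div_two_notMem_lattice

lemma half_tau_notMem_lattice (τ : UpperHalfPlane) : (τ : ℂ) / 2 ∉ (periods τ).lattice :=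
  (periods τ).ω₂_div_two_notMem_lattice

lemma one_mem_lattice (τ : UpperHalfPlane) : (1 : ℂ) ∈ (periods τ).lattice :=
  (periods τ).ω₁_mem_lattice

lemma tau_mem_lattice (τ : UpperHalfPlane) : (τ : ℂ) ∈ (periods τ).lattice :=
  (periods τ).ω₂_mem_lattice

/-- The doubly periodic function `ζ(z) - c z - r conj z`. -/
def zetaPer (L : PeriodPair) (c : ℂ) (r : ℝ) (z : ℂ) : ℂ :=
  weierstrassZeta L z - c * z - r * conj z

lemma zetaPer_neg (L : PeriodPair) (c : ℂ) (r : ℝ) (z : ℂ) :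
    zetaPer L c r (-z) = - zetaPer L c r z := by
  rw [zetaPer, zetaPer, zeta_neg, map_neg]
  ring

/-- The gradient of the Green function. -/
theorem exists_dz_lift_eq (hG : IsGreenFunction τ G) :
    ∃ c : ℂ, ∀ z ∉ (periods τ).lattice, dz (lift G) z =
      -(2 * Real.pi : ℂ)⁻¹ * zetaPer (periods τ) c (Real.pi * invArea τ) z := by
  obtain ⟨c, d, hcd⟩ := exists_gradHol_eq_affine hG
  have hpi : (Real.pi : ℂ) ≠ 0 := by exact_mod_cast Real.pi_ne_zero
  suffices hd : d = 0 by
    refine ⟨c, fun z hz ↦ ?_⟩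
    have := hcd z hz
    rw [gradHol, hd] at this
    rw [zetaPer]
    push_cast
    field_simp
    linear_combination (-1 : ℂ) * this
  set L := periods τ
  -- G(z) - G(-z) has `dz` equal to -d/π, so it differs from Re(-dz/π) by a constant. Periodicity of
  -- G forces Re(-dl/π) = 0 for l = 1 and l = τ, which span ℂ over ℝ.
  set w : ℂ → ℝ := fun z ↦ lift G z - lift G (-z) - (-d / Real.pi * z).re with hw
  have hw' : ∀ z ∈ (L.lattice : Set ℂ)ᶜ, HasFDerivAt w (0 : ℂ →L[ℝ] ℝ) z := by
    intro z hz
    have hz' : -z ∉ L.lattice := by rwa [neg_mem_iff]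
    have h1 := (differentiableAt_lift hG hz).hasFDerivAt
    have h2 : HasFDerivAt (fun z ↦ lift G (-z))
        ((fderiv ℝ (lift G) (-z)).comp (-ContinuousLinearMap.id ℝ ℂ)) z :=
      (differentiableAt_lift hG hz').hasFDerivAt.comp z (hasFDerivAt_id (𝕜 := ℝ) z).neg
    have h3 : HasFDerivAt (fun z ↦ (-d / Real.pi * z).re) (Complex.reCLM.comp
        ((-d / Real.pi : ℂ) • ContinuousLinearMap.id ℝ ℂ)) z :=
      (Complex.reCLM.hasFDerivAt (x := -d / Real.pi * z)).comp z
      ((hasFDerivAt_id (𝕜 := ℝ) z).const_smul (-d / Real.pi : ℂ))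
    refine ((h1.sub h2).sub h3).congr_fderiv ?_
    ext v
    have e1 := hcd z hz
    have e2 := hcd (-z) hz'
    rw [zeta_neg, gradHol, map_neg] at e2
    rw [gradHol] at e1
    have e3 : dz (lift G) z + dz (lift G) (-z) = -d / Real.pi := by
      field_simp
      linear_combination (-1 / 2 : ℂ) * (e1 + e2)
    have e4 : (dz (lift G) z * v).re + (dz (lift G) (-z) * v).re = (-d / Real.pi * v).re := by
      rw [← Complex.add_re, ← add_mul, e3]
    simp only [sub_apply, ContinuousLinearMap.comp_apply, neg_apply,
      ContinuousLinearMap.id_apply, fderiv_eq_re_dz, zero_apply]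
    simp only [mul_neg, Complex.neg_re]
    simp [-Complex.mul_re] at e4 ⊢
    linarith
  obtain ⟨k, hk⟩ := (isOpen_compl_lattice L).exists_is_const_of_fderiv_eq_zero
    (isPreconnected_compl_lattice L)
    (fun z hz ↦ (hw' z hz).differentiableAt.differentiableWithinAt) (fun z hz ↦ (hw' z hz).fderiv)
  have key : ∀ l ∈ L.lattice, (-d / Real.pi * l).re = 0 := by
    intro l hl
    have h0 := half_notMem_lattice τ
    have h1 := hk (1 / 2) h0
    have h2 := hk (1 / 2 + l) (by simpa [add_mem_lattice_iff hl] using h0)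
    simp only [hw] at h1 h2
    rw [lift_add G hl, neg_add, lift_add G (neg_mem hl), mul_add, Complex.add_re] at h2
    linarith
  have k1 := key 1 (one_mem_lattice τ)
  have k2 := key τ (tau_mem_lattice τ)
  rw [mul_one] at k1
  have k3 : (-d / Real.pi : ℂ).im = 0 := by
    rw [Complex.mul_re, k1, zero_mul, zero_sub, neg_eq_zero] at k2
    exact (mul_eq_zero.1 k2).resolve_right τ.im_ne_zero
  have k4 : (-d / Real.pi : ℂ) = 0 := Complex.ext k1 k3
  simpa [hpi] using k4

end Gradient

end

/-! ### Critical points of G_p, their Hessians, and Hitchin's formula -/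

section

open Filter Asymptotics
open scoped ComplexConjugate

lemma mem_lattice_iff {τ : UpperHalfPlane} {z : ℂ} :
    z ∈ (periods τ).lattice ↔ ∃ m n : ℤ, (m : ℂ) + n * τ = z := by
  rw [PeriodPair.mem_lattice]
  simp [periods]

lemma exists_real_coords (τ : UpperHalfPlane) (z : ℂ) : ∃ r s : ℝ, (r : ℂ) + s * τ = z := by
  have h := τ.im_ne_zero
  refine ⟨z.re - z.im / τ.im * τ.re, z.im / τ.im, Complex.ext ?_ ?_⟩
  · simp
  · simp
    field_simp

lemma real_coords_injective {τ : UpperHalfPlane} {r s r' s' : ℝ}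
    (h : (r : ℂ) + s * τ = r' + s' * τ) : r = r' ∧ s = s' := by
  have him := congrArg Complex.im h
  have hre := congrArg Complex.re h
  simp at him hre
  have hs : s = s' := him.resolve_right τ.im_ne_zero
  subst hs
  exact ⟨by linarith, rfl⟩

lemma add_self_mem_lattice_iff {τ : UpperHalfPlane} {r s : ℝ} {z : ℂ} (hz : (r : ℂ) + s * τ = z) :
    z + z ∈ (periods τ).lattice ↔ ∃ m n : ℤ, 2 * r = m ∧ 2 * s = n := by
  rw [mem_lattice_iff, ← hz]
  refine exists_congr fun m ↦ exists_congr fun n ↦ ⟨fun h ↦ ?_, fun h ↦ ?_⟩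
  · have := real_coords_injective (τ := τ) (r := m) (s := n) (r' := 2 * r) (s' := 2 * s)
      (by push_cast; rw [h]; ring)
    exact ⟨this.1.symm, this.2.symm⟩
  · have h1 : (2 * r : ℂ) = m := by exact_mod_cast h.1
    have h2 : (2 * s : ℂ) = n := by exact_mod_cast h.2
    rw [← h1, ← h2]
    ring

lemma proj_mem_twoTorsion_iff {τ : UpperHalfPlane} {z : ℂ} :
    proj τ z ∈ twoTorsion τ ↔ z + z ∈ (periods τ).lattice := by
  simp only [twoTorsion, Set.mem_insert_iff, Set.mem_singleton_iff, proj_eq_proj_iff]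
  have h1 := one_mem_lattice τ
  have ht := tau_mem_lattice τ
  constructor
  · have key : ∀ w, w + w ∈ (periods τ).lattice → z - w ∈ (periods τ).lattice →
        z + z ∈ (periods τ).lattice := fun w hw hzw ↦ by
      have := add_mem (add_mem hzw hzw) hw
      convert this using 1
      ring
    rintro (h | h | h | h)
    · exact key 0 (by simp) h
    · exact key _ (by ring_nf; exact h1) h
    · exact key _ (by ring_nf; exact ht) h
    · exact key _ (by ring_nf; exact add_mem h1 ht) h
  · intro h
    obtain ⟨m, n, hmn⟩ := mem_lattice_iff.1 h
    have hz : z = (m + n * τ) / 2 := by rw [hmn]; ring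
    rcases Int.even_or_odd' m with ⟨k, rfl | rfl⟩ <;> rcases Int.even_or_odd' n with ⟨l, rfl | rfl⟩
    · exact Or.inl (mem_lattice_iff.2 ⟨k, l, by rw [hz]; push_cast; ring⟩)
    · exact Or.inr (Or.inr (Or.inl (mem_lattice_iff.2 ⟨k, l, by rw [hz]; push_cast; ring⟩)))
    · exact Or.inr (Or.inl (mem_lattice_iff.2 ⟨k, l, by rw [hz]; push_cast; ring⟩))
    · exact Or.inr (Or.inr (Or.inr (mem_lattice_iff.2 ⟨k, l, by rw [hz]; push_cast; ring⟩)))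

lemma proj_surjective (τ : UpperHalfPlane) : Function.Surjective (proj τ) :=
  QuotientAddGroup.mk_surjective

/-- `c` and `r` are the constants for which `-ζ(z) + c z + r conj z` is the Wirtinger derivative of
`G`, up to a factor. -/
structure GradientData {τ : UpperHalfPlane} (G : Torus τ → ℝ) (c : ℂ) (r : ℝ) : Prop where
  pos : 0 < r
  differentiableAt : ∀ z ∉ (periods τ).lattice, DifferentiableAt ℝ (lift G) z
  dz_eq : ∀ z ∉ (periods τ).lattice, dz (lift G) z =
    -(2 * Real.pi : ℂ)⁻¹ * zetaPer (periods τ) c r z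

lemma IsGreenFunction.exists_gradientData {τ : UpperHalfPlane} {G : Torus τ → ℝ}
    (hG : IsGreenFunction τ G) : ∃ c r, GradientData G c r := by
  obtain ⟨c, hc⟩ := exists_dz_lift_eq hG
  refine ⟨c, Real.pi * invArea τ, mul_pos Real.pi_pos (invArea_pos τ),
    fun z hz ↦ differentiableAt_lift hG hz, ?_⟩
  simpa using hc

/-- The real linear map `h ↦ m h + n conj h`. -/
def wirtinger (m n : ℂ) : ℂ →L[ℝ] ℂ :=
  m • ContinuousLinearMap.id ℝ ℂ + n • (Complex.conjCLE : ℂ →L[ℝ] ℂ)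

@[simp] lemma wirtinger_apply (m n h : ℂ) : wirtinger m n h = m * h + n * conj h := rfl

lemma hasStrictFDerivAt_zetaPer (L : PeriodPair) (c : ℂ) (r : ℝ) {z : ℂ} (hz : z ∉ L.lattice) :
    HasStrictFDerivAt (zetaPer L c r) (wirtinger (-L.weierstrassP z - c) (-r)) z := by
  have h1 : HasStrictDerivAt (weierstrassZeta L) (-L.weierstrassP z) z := by
    have := (analyticAt_zeta L hz).hasStrictDerivAt
    rwa [(hasDerivAt_zeta L hz).deriv] at this
  have h1' := h1.hasStrictFDerivAt.restrictScalars ℝ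
  have h2 : HasStrictFDerivAt (fun z : ℂ ↦ c * z) (c • ContinuousLinearMap.id ℝ ℂ) z :=
    (hasStrictFDerivAt_id z).const_smul c
  have h3 : HasStrictFDerivAt (fun z : ℂ ↦ (r : ℂ) * conj z)
      ((r : ℂ) • (Complex.conjCLE : ℂ →L[ℝ] ℂ)) z :=
    (Complex.conjCLE : ℂ →L[ℝ] ℂ).hasStrictFDerivAt.const_smul (r : ℂ)
  refine ((h1'.sub h2).sub h3).congr_fderiv ?_
  refine ContinuousLinearMap.ext fun h ↦ ?_
  simp
  ring

section Critical

variable {τ : UpperHalfPlane} {G : Torus τ → ℝ} {c : ℂ} {r : ℝ}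

/-- Periodicity is inherited from the gradient of G, so the Legendre relation is not needed. -/
lemma GradientData.zetaPer_add (hd : GradientData G c r) {z l : ℂ} (hl : l ∈ (periods τ).lattice)
    (hz : z ∉ (periods τ).lattice) :
    zetaPer (periods τ) c r (z + l) = zetaPer (periods τ) c r z := by
  have h1 := hd.dz_eq z hz
  have h2 := hd.dz_eq (z + l) (by rwa [add_mem_lattice_iff hl])
  rw [dz_lift_add G hl, h1] at h2
  have hpi : (-(2 * Real.pi : ℂ)⁻¹) ≠ 0 := by
    simp [Real.pi_ne_zero]
  exact (mul_left_cancel₀ hpi h2).symm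

lemma GradientData.zetaPer_half (hd : GradientData G c r) {z : ℂ} (hz : z ∉ (periods τ).lattice)
    (hzz : z + z ∈ (periods τ).lattice) : zetaPer (periods τ) c r z = 0 := by
  have h1 := hd.zetaPer_add hzz (z := -z) (by rwa [neg_mem_iff])
  rw [neg_add_cancel_left, zetaPer_neg] at h1
  linear_combination (1 / 2 : ℂ) * h1

/-- This is the vanishing of `zetaPer` at 1/2. Together with its analogue at τ/2 it identifies ζ(z)
- xη₁ - yη₂, for z = x + yτ with x, y real, with `zetaPer` at z. -/
lemma GradientData.eta₁_eq (hd : GradientData G c r) : eta₁ τ = c + r := by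
  have h := hd.zetaPer_half (half_notMem_lattice τ) (by ring_nf; exact one_mem_lattice τ)
  rw [zetaPer] at h
  simp only [one_div, map_inv₀, Complex.conj_ofNat] at h
  rw [eta₁, one_div]
  linear_combination 2 * h

lemma GradientData.eta₂_eq (hd : GradientData G c r) : eta₂ τ = c * τ + r * conj (τ : ℂ) := by
  have h := hd.zetaPer_half (half_tau_notMem_lattice τ) (by ring_nf; exact tau_mem_lattice τ)
  rw [zetaPer] at h
  simp only [map_div₀, Complex.conj_ofNat] at h
  rw [eta₂]
  linear_combination 2 * h

lemma GradientData.hasFDerivAt_lift (hd : GradientData G c r) {z : ℂ}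
    (hz : z ∉ (periods τ).lattice) :
    HasFDerivAt (lift G) (Complex.reCLM.comp
      ((-(2 * Real.pi : ℂ)⁻¹ * zetaPer (periods τ) c r z) • ContinuousLinearMap.id ℝ ℂ)) z := by
  refine (hd.differentiableAt z hz).hasFDerivAt.congr_fderiv ?_
  refine ContinuousLinearMap.ext fun v ↦ ?_
  rw [fderiv_eq_re_dz, hd.dz_eq z hz]
  rfl

/-- The Green function has a genuine singularity at the lattice points. -/
lemma GradientData.not_continuousAt (hd : GradientData G c r) : ¬ ContinuousAt (lift G) 0 := by
  intro hcont
  set L := periods τ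
  obtain ⟨ρ, hρ, hρL⟩ := Metric.isOpen_iff.1 (L.isOpen_compl_lattice_sdiff (s := {0})) 0 (by simp)
  have hnot : ∀ t : ℝ, 0 < t → t < ρ → (t : ℂ) ∉ L.lattice := by
    intro t ht htρ hmem
    refine hρL (a := (t : ℂ)) ?_ ⟨hmem, ?_⟩
    · simpa [abs_of_pos ht] using htρ
    · simpa using ht.ne'
  set b := ρ / 2 with hb
  have hb0 : 0 < b := by positivity
  set k : ℝ → ℂ := fun t ↦ zetaExcept L 0 t - c * t - r * t with hk
  have hkc : ContinuousOn k (Set.Icc 0 b) := by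
    intro t ht
    have hmem : (t : ℂ) ∈ (L.lattice \ {0} : Set ℂ)ᶜ := by
      apply hρL
      rw [Metric.mem_ball, dist_zero_right, Complex.norm_real, Real.norm_eq_abs, abs_of_nonneg ht.1]
      linarith [ht.2]
    have h1 : ContinuousAt (zetaExcept L 0) (t : ℂ) :=
      ((differentiableOn_zetaExcept L 0).differentiableAt
        (L.isOpen_compl_lattice_sdiff.mem_nhds hmem)).continuousAt
    have h2 : ContinuousAt (fun t : ℝ ↦ zetaExcept L 0 t) t :=
      ContinuousAt.comp (f := fun t : ℝ ↦ (t : ℂ)) h1 Complex.continuous_ofReal.continuousAt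
    have : ContinuousAt k t := by fun_prop
    exact this.continuousWithinAt
  obtain ⟨M, hM⟩ := isCompact_Icc.exists_bound_of_continuousOn hkc
  -- The logarithm cancels the pole of ζ, so f has bounded derivative on (0, b] and is bounded below
  -- there. Continuity of G at 0 would instead force f → -∞.
  set f : ℝ → ℝ := fun t ↦ lift G t + (2 * Real.pi)⁻¹ * Real.log t with hf
  have hderiv : ∀ t ∈ Set.Ioc 0 b, HasDerivAt f ((-(2 * Real.pi : ℂ)⁻¹ * k t).re) t := by
    intro t ht
    have h1 := (hd.hasFDerivAt_lift (hnot t ht.1 (by linarith [ht.2]))).comp_hasDerivAt t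
      (Complex.ofRealCLM.hasDerivAt : HasDerivAt (fun t : ℝ ↦ (t : ℂ)) _ t)
    have h2 := (Real.hasDerivAt_log ht.1.ne').const_mul (2 * Real.pi)⁻¹
    refine (h1.add h2).congr_deriv ?_
    have ht0 : (t : ℂ) ≠ 0 := by exact_mod_cast ht.1.ne'
    have h3 := zeta_eq_zetaExcept_add L 0 t
    simp only [ZeroMemClass.coe_zero, sub_zero, div_zero, add_zero, ne_eq, OfNat.ofNat_ne_zero,
      not_false_eq_true, zero_pow] at h3
    have h4 : -(2 * Real.pi : ℂ)⁻¹ * zetaPer L c r t =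
        -(2 * Real.pi : ℂ)⁻¹ * k t - (((2 * Real.pi)⁻¹ * t⁻¹ : ℝ) : ℂ) := by
      rw [zetaPer, h3, Complex.conj_ofReal]
      push_cast
      simp only [hk]
      ring
    have h5 : (-(2 * Real.pi : ℂ)⁻¹ * zetaPer L c r t).re =
        (-(2 * Real.pi : ℂ)⁻¹ * k t).re - (2 * Real.pi)⁻¹ * t⁻¹ := by
      rw [h4, Complex.sub_re, Complex.ofReal_re]
    have h6 : (Complex.reCLM.comp ((-(2 * Real.pi : ℂ)⁻¹ * zetaPer L c r t) •
        ContinuousLinearMap.id ℝ ℂ)) (Complex.ofRealCLM 1) =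
        (-(2 * Real.pi : ℂ)⁻¹ * zetaPer L c r t).re := by
      simp
    rw [h6, h5]
    ring
  have hbound : ∀ t ∈ Set.Ioc 0 b, ‖f b - f t‖ ≤ (2 * Real.pi)⁻¹ * M * ‖b - t‖ := by
    intro t ht
    refine (convex_Ioc 0 b).norm_image_sub_le_of_norm_hasDerivWithin_le
      (fun x hx ↦ (hderiv x hx).hasDerivWithinAt) (fun x hx ↦ ?_) ht ⟨hb0, le_rfl⟩
    rw [Real.norm_eq_abs]
    refine (Complex.abs_re_le_norm _).trans ?_
    rw [norm_mul, norm_neg, norm_inv, norm_mul, Complex.norm_ofNat, Complex.norm_real,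
      Real.norm_eq_abs, abs_of_pos Real.pi_pos]
    have := hM x ⟨hx.1.le, hx.2⟩
    gcongr
  have hM0 : 0 ≤ M := (norm_nonneg _).trans (hM 0 ⟨le_rfl, hb0.le⟩)
  have hlow : ∀ᶠ t in 𝓝[>] (0 : ℝ), f b - (2 * Real.pi)⁻¹ * M * b ≤ f t := by
    filter_upwards [Ioc_mem_nhdsGT hb0] with t ht
    have h1 := hbound t ht
    rw [Real.norm_eq_abs, Real.norm_eq_abs, abs_of_nonneg (by linarith [ht.2] : 0 ≤ b - t)] at h1
    have h2 := (abs_le.1 h1).2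
    have h3 : (2 * Real.pi)⁻¹ * M * (b - t) ≤ (2 * Real.pi)⁻¹ * M * b := by
      have : 0 ≤ (2 * Real.pi)⁻¹ * M := by positivity
      have h4 := ht.1
      gcongr
      linarith
    linarith
  have hlim : Tendsto f (𝓝[>] 0) atBot := by
    have h1 : Tendsto (fun t : ℝ ↦ lift G t) (𝓝[>] 0) (𝓝 (lift G 0)) := by
      have hcont' : ContinuousAt (lift G) ((0 : ℝ) : ℂ) := by rwa [Complex.ofReal_zero]
      have : ContinuousAt (fun t : ℝ ↦ lift G t) 0 :=
        ContinuousAt.comp (g := lift G) (f := fun t : ℝ ↦ (t : ℂ)) hcont'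
          Complex.continuous_ofReal.continuousAt
      simpa using this.tendsto.mono_left nhdsWithin_le_nhds
    refine h1.add_atBot ?_
    exact Tendsto.const_mul_atBot (by positivity) Real.tendsto_log_nhdsGT_zero
  have := (hlim.eventually (eventually_lt_atBot (f b - (2 * Real.pi)⁻¹ * M * b))).and hlow
  obtain ⟨t, ht1, ht2⟩ := this.exists
  linarith

/-- Up to a factor, the gradient of `G_p` at `a`. -/
def pairGrad (τ : UpperHalfPlane) (c : ℂ) (r : ℝ) (a p : ℂ) : ℂ :=
  zetaPer (periods τ) c r (a - p) + zetaPer (periods τ) c r (a + p)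

/-- Up to a factor, the holomorphic part of the Hessian of `G_p` at `a`. -/
def pairHess (τ : UpperHalfPlane) (c : ℂ) (a p : ℂ) : ℂ :=
  (periods τ).weierstrassP (a - p) + (periods τ).weierstrassP (a + p) + 2 * c

lemma localRep_pairGreen (G : Torus τ → ℝ) (a p : ℂ) :
    localRep (pairGreen G (proj τ p)) (proj τ a) =
      fun w ↦ (1 / 2) * (lift G (w + (a - p)) + lift G (w + (a + p))) := by
  ext w
  have e1 : proj τ a + proj τ w - proj τ p = proj τ (w + (a - p)) := by
    rw [← proj_add, ← proj_sub]
    congr 1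
    ring
  have e2 : proj τ a + proj τ w + proj τ p = proj τ (w + (a + p)) := by
    rw [← proj_add, ← proj_add]
    congr 1
    ring
  rw [localRep, pairGreen, e1, e2, lift, lift]

/-- The real linear functional `v ↦ Re (k v)`, as a linear function of `k`. -/
def reMul : ℂ →L[ℝ] ℂ →L[ℝ] ℝ :=
  (ContinuousLinearMap.compL ℝ ℂ ℂ ℝ Complex.reCLM).comp (ContinuousLinearMap.mul ℝ ℂ)

@[simp] lemma reMul_apply (k v : ℂ) : reMul k v = (k * v).re := rfl

lemma GradientData.hasFDerivAt_localRep (hd : GradientData G c r) {a p w : ℂ}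
    (h1 : w + (a - p) ∉ (periods τ).lattice) (h2 : w + (a + p) ∉ (periods τ).lattice) :
    HasFDerivAt (localRep (pairGreen G (proj τ p)) (proj τ a))
      (reMul (-(4 * Real.pi : ℂ)⁻¹ * pairGrad τ c r (w + a) p)) w := by
  rw [localRep_pairGreen]
  have e1 := (hasFDerivAt_comp_add_right (a - p)).2 (hd.hasFDerivAt_lift h1)
  have e2 := (hasFDerivAt_comp_add_right (a + p)).2 (hd.hasFDerivAt_lift h2)
  refine ((e1.add e2).const_mul (1 / 2)).congr_fderiv ?_
  refine ContinuousLinearMap.ext fun v ↦ ?_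
  have e3 : -(4 * Real.pi : ℂ)⁻¹ * pairGrad τ c r (w + a) p * v =
      ((1 / 2 : ℝ) : ℂ) * (-(2 * Real.pi : ℂ)⁻¹ * zetaPer (periods τ) c r (w + (a - p)) * v +
        -(2 * Real.pi : ℂ)⁻¹ * zetaPer (periods τ) c r (w + (a + p)) * v) := by
    rw [pairGrad, ← add_sub_assoc, ← add_assoc]
    push_cast
    field_simp
    ring
  rw [reMul_apply, e3, Complex.re_ofReal_mul, Complex.add_re]
  rfl

lemma reMul_eq_zero {k : ℂ} (h : reMul k = 0) : k = 0 := by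
  have h1 := congrArg (fun l : ℂ →L[ℝ] ℝ ↦ l 1) h
  have h2 := congrArg (fun l : ℂ →L[ℝ] ℝ ↦ l Complex.I) h
  simp at h1 h2
  exact Complex.ext h1 h2

/-- Exactly one summand is singular, so the sum is discontinuous whatever value G takes at 0. As a
critical point requires differentiability, this excludes a ≡ ±p. -/
lemma GradientData.not_isCriticalPoint (hd : GradientData G c r) {a p : ℂ}
    (h1 : a - p ∈ (periods τ).lattice) (h2 : a + p ∉ (periods τ).lattice)
    (f : ℂ → ℝ) (hf : f = fun w ↦ (1 / 2) * (lift G (w + (a - p)) + lift G (w + (a + p)))) :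
    ¬ ContinuousAt f 0 := by
  intro h
  apply hd.not_continuousAt
  have h3 : ContinuousAt (fun w ↦ lift G (w + (a + p))) 0 :=
    ((hasFDerivAt_comp_add_right (a + p)).2
      (hd.hasFDerivAt_lift (z := 0 + (a + p)) (by simpa using h2))).continuousAt
  have h4 : lift G = fun w ↦ 2 * f w - lift G (w + (a + p)) := by
    ext w
    rw [hf]
    simp only
    rw [lift_add G h1]
    ring
  rw [h4]
  fun_prop

lemma GradientData.isCriticalPoint_iff (hd : GradientData G c r) {a p : ℂ}
    (hp : p + p ∉ (periods τ).lattice) :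
    IsCriticalPoint (pairGreen G (proj τ p)) (proj τ a) ↔
      a - p ∉ (periods τ).lattice ∧ a + p ∉ (periods τ).lattice ∧ pairGrad τ c r a p = 0 := by
  rw [IsCriticalPoint]
  constructor
  · intro h
    have hc := h.continuousAt
    rw [localRep_pairGreen] at hc
    have hnot : ¬ (a - p ∈ (periods τ).lattice ∧ a + p ∈ (periods τ).lattice) := by
      rintro ⟨h1, h2⟩
      apply hp
      have := sub_mem h2 h1
      rwa [add_sub_sub_cancel] at this
    have h1 : a - p ∉ (periods τ).lattice := fun h1 ↦
      hd.not_isCriticalPoint h1 (fun h2 ↦ hnot ⟨h1, h2⟩) _ rfl hc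
    have h2 : a + p ∉ (periods τ).lattice := fun h2 ↦
      hd.not_isCriticalPoint (a := a) (p := -p) (by rwa [sub_neg_eq_add])
        (by rwa [← sub_eq_add_neg]) _ (by
          ext w
          rw [sub_neg_eq_add, ← sub_eq_add_neg, add_comm (lift G (w + (a - p)))]) hc
    refine ⟨h1, h2, ?_⟩
    have h3 := hd.hasFDerivAt_localRep (w := 0) (a := a) (p := p) (by simpa using h1)
      (by simpa using h2)
    have h4 := reMul_eq_zero (h3.unique h)
    rw [zero_add] at h4
    refine (mul_eq_zero.1 h4).resolve_left ?_
    simp [Real.pi_ne_zero]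
  · rintro ⟨h1, h2, h3⟩
    have h4 := hd.hasFDerivAt_localRep (w := 0) (a := a) (p := p) (by simpa using h1)
      (by simpa using h2)
    rw [zero_add, h3, mul_zero, map_zero] at h4
    exact h4

lemma hasStrictFDerivAt_pairGrad_left {a p : ℂ} (h1 : a - p ∉ (periods τ).lattice)
    (h2 : a + p ∉ (periods τ).lattice) :
    HasStrictFDerivAt (fun a ↦ pairGrad τ c r a p)
      (wirtinger (-pairHess τ c a p) (-(2 * r : ℝ))) a := by
  have e1 := (hasStrictFDerivAt_zetaPer (periods τ) c r h1).comp a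
    ((hasStrictFDerivAt_id (𝕜 := ℝ) a).sub_const p)
  have e2 := (hasStrictFDerivAt_zetaPer (periods τ) c r h2).comp a
    ((hasStrictFDerivAt_id (𝕜 := ℝ) a).add_const p)
  refine (e1.add e2).congr_fderiv ?_
  refine ContinuousLinearMap.ext fun v ↦ ?_
  simp [pairHess]
  ring

/-- The map h ↦ mh + n h̄ has real determinant |m|² - n²; the pairing Re(uv), of determinant -1 in
the basis 1, i, accounts for the sign. -/
lemma det_wirtinger_matrix (k : ℝ) (m : ℂ) (n : ℝ) :
    (Matrix.of fun i j ↦ (k * (wirtinger m n ((![1, Complex.I] : Fin 2 → ℂ) i)) *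
      (![1, Complex.I] : Fin 2 → ℂ) j).re).det = k ^ 2 * (n ^ 2 - ‖m‖ ^ 2) := by
  rw [Matrix.det_fin_two, Complex.sq_norm, Complex.normSq_apply]
  simp
  ring

/-- Up to a real factor the Hessian is the form given by the derivative h ↦ -`pairHess`·h - 2r h̄ of
`pairGrad`, and such a map is singular exactly when the two coefficients have equal modulus. -/
lemma GradientData.isNondegenerate_iff (hd : GradientData G c r) {a p : ℂ}
    (h1 : a - p ∉ (periods τ).lattice) (h2 : a + p ∉ (periods τ).lattice) :
    IsNondegenerate (pairGreen G (proj τ p)) (proj τ a) ↔ ‖pairHess τ c a p‖ ≠ 2 * r := by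
  set f := localRep (pairGreen G (proj τ p)) (proj τ a) with hf
  have hev : fderiv ℝ f =ᶠ[𝓝 0] fun w ↦ reMul (-(4 * Real.pi : ℂ)⁻¹ * pairGrad τ c r (w + a) p) := by
    have hopen : ∀ b : ℂ, b ∉ (periods τ).lattice → ∀ᶠ w in 𝓝 (0 : ℂ),
        w + b ∉ (periods τ).lattice := fun b hb ↦
      (continuous_add_const b).continuousAt.eventually
        ((isOpen_compl_lattice (periods τ)).mem_nhds (x := 0 + b) (by simpa using hb))
    filter_upwards [hopen _ h1, hopen _ h2] with w e1 e2
    exact (hd.hasFDerivAt_localRep e1 e2).fderiv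
  have hgrad : HasFDerivAt (fun w ↦ pairGrad τ c r (w + a) p)
      (wirtinger (-pairHess τ c a p) (-(2 * r : ℝ))) 0 := by
    refine (hasFDerivAt_comp_add_right (f := fun a ↦ pairGrad τ c r a p) a).2 ?_
    rw [zero_add]
    exact (hasStrictFDerivAt_pairGrad_left h1 h2).hasFDerivAt
  have hsnd : HasFDerivAt (fderiv ℝ f) (reMul.comp ((-(4 * Real.pi : ℂ)⁻¹) •
      wirtinger (-pairHess τ c a p) (-(2 * r : ℝ)))) 0 :=
    (reMul.hasFDerivAt.comp (0 : ℂ) (hgrad.const_smul (-(4 * Real.pi : ℂ)⁻¹))).congr_of_eventuallyEq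
      hev
  have hhess : hessian (pairGreen G (proj τ p)) (proj τ a) = Matrix.of fun i j ↦
      (((-(4 * Real.pi)⁻¹ : ℝ) : ℂ) * (wirtinger (-pairHess τ c a p) ((-(2 * r) : ℝ) : ℂ)
        ((![1, Complex.I] : Fin 2 → ℂ) i)) * (![1, Complex.I] : Fin 2 → ℂ) j).re := by
    ext i j
    rw [hessian, Matrix.of_apply, Matrix.of_apply, iteratedFDeriv_two_apply, ← hf, hsnd.fderiv]
    simp
  rw [IsNondegenerate, hhess, det_wirtinger_matrix, norm_neg]
  have hpi := Real.pi_ne_zero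
  have hr := hd.pos
  have h3 : (-(4 * Real.pi)⁻¹) ^ 2 ≠ 0 := by
    refine pow_ne_zero 2 ?_
    simp [hpi]
  rw [mul_ne_zero_iff, and_iff_right h3, sub_ne_zero, neg_sq, ne_comm, Ne, Ne,
    sq_eq_sq₀ (norm_nonneg _) (by positivity)]

/-- `a` is a critical point of `G_p`, in coordinates, for `p` not a half period. -/
def IsCrit (τ : UpperHalfPlane) (c : ℂ) (r : ℝ) (a p : ℂ) : Prop :=
  a - p ∉ (periods τ).lattice ∧ a + p ∉ (periods τ).lattice ∧ pairGrad τ c r a p = 0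

lemma half_sub_notMem {a p : ℂ} (ha : a + a ∈ (periods τ).lattice)
    (hp : p + p ∉ (periods τ).lattice) :
    a - p ∉ (periods τ).lattice ∧ a + p ∉ (periods τ).lattice := by
  constructor
  · intro h
    apply hp
    have := sub_mem ha (add_mem h h)
    convert this using 1
    ring
  · intro h
    apply hp
    have := sub_mem (add_mem h h) ha
    convert this using 1
    ring

/-- a + p and -(a - p) differ by the period 2a, so the two terms of `pairGrad` cancel by oddness. -/
lemma GradientData.isCrit_of_half (hd : GradientData G c r) {a p : ℂ}
    (ha : a + a ∈ (periods τ).lattice) (hp : p + p ∉ (periods τ).lattice) : IsCrit τ c r a p := by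
  obtain ⟨h1, h2⟩ := half_sub_notMem ha hp
  refine ⟨h1, h2, ?_⟩
  have h3 := hd.zetaPer_add (z := a + p) (neg_mem ha) h2
  have h4 : a + p + -(a + a) = -(a - p) := by ring
  rw [h4, zetaPer_neg] at h3
  rw [pairGrad, ← h3]
  ring

lemma pairHess_of_half {a p : ℂ} (ha : a + a ∈ (periods τ).lattice) :
    pairHess τ c a p = 2 * ((periods τ).weierstrassP (p + a) + c) := by
  have h1 := (periods τ).weierstrassP_add_coe (-(p + a)) ⟨a + a, ha⟩
  have h2 : -(p + a) + (a + a) = a - p := by ring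
  simp only [(periods τ).weierstrassP_neg, h2] at h1
  rw [pairHess, h1, add_comm a p]
  ring

/-- Trivial degenerate critical points, in coordinates. -/
lemma GradientData.proj_mem_degenerateTrivialSet_iff (hd : GradientData G c r) {p : ℂ} :
    proj τ p ∈ degenerateTrivialSet G ↔ p + p ∉ (periods τ).lattice ∧
      ∃ a, a + a ∈ (periods τ).lattice ∧ ‖(periods τ).weierstrassP (p + a) + c‖ = r := by
  rw [degenerateTrivialSet, Set.mem_ofPred_eq, proj_mem_twoTorsion_iff]
  refine and_congr_right fun hp ↦ ?_
  have key : ∀ a, a + a ∈ (periods τ).lattice →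
      (IsCriticalPoint (pairGreen G (proj τ p)) (proj τ a) ∧
        ¬ IsNondegenerate (pairGreen G (proj τ p)) (proj τ a) ↔
        ‖(periods τ).weierstrassP (p + a) + c‖ = r) := by
    intro a ha
    have hcrit := hd.isCrit_of_half ha hp
    rw [hd.isCriticalPoint_iff hp, hd.isNondegenerate_iff hcrit.1 hcrit.2.1, pairHess_of_half ha,
      norm_mul, Complex.norm_ofNat, not_not, mul_right_inj' two_ne_zero]
    exact and_iff_right hcrit
  constructor
  · rintro ⟨a, ha, h⟩
    obtain ⟨a, rfl⟩ := proj_surjective τ a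
    rw [proj_mem_twoTorsion_iff] at ha
    exact ⟨a, ha, (key a ha).1 h⟩
  · rintro ⟨a, ha, h⟩
    exact ⟨proj τ a, proj_mem_twoTorsion_iff.2 ha, (key a ha).2 h⟩

lemma pairGrad_eq (a p : ℂ) :
    pairGrad τ c r a p = zetaDiff (periods τ) p a + 2 * zetaPer (periods τ) c r a := by
  simp only [pairGrad, zetaDiff, zetaPer, map_add, map_sub]
  ring

lemma wp_proj {p : ℂ} (hp : p ∉ (periods τ).lattice) :
    wp (proj τ p) = (((periods τ).weierstrassP p : ℂ) : OnePoint ℂ) := by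
  have h0 : proj τ p ≠ 0 := by
    intro h
    have : proj τ p = proj τ 0 := h
    rw [proj_eq_proj_iff, sub_zero] at this
    exact hp this
  rw [wp, if_neg h0]
  have h1 : proj τ (Quotient.out (proj τ p)) = proj τ p := Quotient.out_eq _
  rw [proj_eq_proj_iff] at h1
  have h2 := (periods τ).weierstrassP_add_coe p ⟨_, h1⟩
  simp only [add_sub_cancel] at h2
  rw [h2]

lemma GradientData.hitchin_eq (hd : GradientData G c r) {s t : ℝ} {a : ℂ}
    (ha : (s : ℂ) + t * τ = a) :
    hitchin τ s t = if 2 * zetaPer (periods τ) c r a = 0 then OnePoint.infty else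
      (((periods τ).weierstrassP a + (periods τ).derivWeierstrassP a /
        (2 * zetaPer (periods τ) c r a) : ℂ) : OnePoint ℂ) := by
  have h : 2 * (weierstrassZeta (periods τ) a - s * eta₁ τ - t * eta₂ τ) =
      2 * zetaPer (periods τ) c r a := by
    rw [hd.eta₁_eq, hd.eta₂_eq, zetaPer, ← ha]
    simp only [map_add, map_mul, Complex.conj_ofReal]
    ring
  simp only [hitchin]
  rw [ha, h]

/-- Hitchin's formula describes the points with nontrivial critical points. -/
lemma GradientData.proj_mem_hitchinSet_iff (hd : GradientData G c r) {p : ℂ}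
    (hp : p + p ∉ (periods τ).lattice) :
    proj τ p ∈ hitchinSet τ ↔ ∃ a, a + a ∉ (periods τ).lattice ∧ IsCrit τ c r a p := by
  have hp1 : p ∉ (periods τ).lattice := fun h ↦ hp (add_mem h h)
  -- By the addition formula, vanishing of `pairGrad` reads ℘'(a) = -2Z(a)(℘(a) - ℘(p)) with Z =
  -- `zetaPer`, which is Hitchin's formula solved for ℘'(a). As ℘'(a) ≠ 0, one direction rules out a
  -- ≡ ±p and the other rules out Z(a) = 0, the value ∞.
  have key : ∀ a, a + a ∉ (periods τ).lattice → ∀ s t : ℝ, (s : ℂ) + t * τ = a →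
      (wp (proj τ p) = hitchin τ s t ↔ IsCrit τ c r a p) := by
    intro a ha s t hst
    have ha1 : a ∉ (periods τ).lattice := fun h ↦ ha (add_mem h h)
    have ha' := derivWp_ne_zero (periods τ) ha
    rw [wp_proj hp1, hd.hitchin_eq hst]
    constructor
    · intro h
      split_ifs at h with h0
      · exact absurd h (OnePoint.coe_ne_infty _)
      · have h := OnePoint.coe_injective h
        have hne : (periods τ).weierstrassP p ≠ (periods τ).weierstrassP a := by
          intro e
          rw [e, left_eq_add, div_eq_zero_iff] at h
          exact h.elim ha' h0
        have h1 : a - p ∉ (periods τ).lattice := by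
          intro hl
          have := (periods τ).weierstrassP_add_coe p ⟨_, hl⟩
          simp only [add_sub_cancel] at this
          exact hne this.symm
        have h2 : a + p ∉ (periods τ).lattice := by
          intro hl
          have := (periods τ).weierstrassP_add_coe (-p) ⟨_, hl⟩
          simp only [neg_add_cancel_comm_assoc, PeriodPair.weierstrassP_neg] at this
          exact hne this.symm
        refine ⟨h1, h2, ?_⟩
        have h3 := addition_formula_aux (periods τ) hp1 a ha1 h2 h1
        rw [pairGrad_eq]
        rw [h, sub_add_cancel_left, neg_mul, div_mul_eq_mul_div, neg_eq_iff_eq_neg,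
          div_eq_iff h0] at h3
        have h4 : (periods τ).derivWeierstrassP a *
            (zetaDiff (periods τ) p a + 2 * zetaPer (periods τ) c r a) = 0 := by
          linear_combination h3
        exact (mul_eq_zero.1 h4).resolve_left ha'
    · rintro ⟨h1, h2, h3⟩
      have h4 := addition_formula_aux (periods τ) hp1 a ha1 h2 h1
      rw [pairGrad_eq] at h3
      have h5 : zetaDiff (periods τ) p a = -(2 * zetaPer (periods τ) c r a) := by
        linear_combination h3
      rw [h5] at h4
      have h0 : 2 * zetaPer (periods τ) c r a ≠ 0 := by
        intro h0
        rw [h0, neg_zero, mul_zero] at h4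
        exact ha' h4.symm
      rw [if_neg h0]
      congr 1
      rw [← h4, mul_div_assoc, neg_div, div_self h0]
      ring
  constructor
  · rintro ⟨s, t, hst, h⟩
    have ha : (s + t * τ : ℂ) + (s + t * τ) ∉ (periods τ).lattice := by
      rwa [add_self_mem_lattice_iff rfl]
    exact ⟨_, ha, (key _ ha s t rfl).1 h⟩
  · rintro ⟨a, ha, h⟩
    obtain ⟨s, t, hst⟩ := exists_real_coords τ a
    refine ⟨s, t, ?_, (key a ha s t hst).2 h⟩
    rwa [← add_self_mem_lattice_iff hst]

/-- The points `p`, in coordinates, for which `G_p` has a degenerate nontrivial critical point. -/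
def degenerateNontrivialLift (τ : UpperHalfPlane) (c : ℂ) (r : ℝ) : Set ℂ :=
  {p | p + p ∉ (periods τ).lattice ∧ ∃ a, a + a ∉ (periods τ).lattice ∧ IsCrit τ c r a p ∧
    ‖pairHess τ c a p‖ = 2 * r}

lemma GradientData.exists_degenerate_iff (hd : GradientData G c r) {p : ℂ}
    (hp : p + p ∉ (periods τ).lattice) :
    (∃ a ∉ twoTorsion τ, IsCriticalPoint (pairGreen G (proj τ p)) a ∧
      ¬ IsNondegenerate (pairGreen G (proj τ p)) a) ↔ p ∈ degenerateNontrivialLift τ c r := by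
  rw [degenerateNontrivialLift, Set.mem_ofPred_eq, and_iff_right hp]
  constructor
  · rintro ⟨a, ha, h1, h2⟩
    obtain ⟨a, rfl⟩ := proj_surjective τ a
    rw [proj_mem_twoTorsion_iff] at ha
    have hcrit := (hd.isCriticalPoint_iff hp).1 h1
    rw [hd.isNondegenerate_iff hcrit.1 hcrit.2.1, not_not] at h2
    exact ⟨a, ha, hcrit, h2⟩
  · rintro ⟨a, ha, h1, h2⟩
    refine ⟨proj τ a, by rwa [proj_mem_twoTorsion_iff], (hd.isCriticalPoint_iff hp).2 h1, ?_⟩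
    rwa [hd.isNondegenerate_iff h1.1 h1.2.1, not_not]

lemma GradientData.proj_mem_degenerateNontrivialSet_iff (hd : GradientData G c r) {p : ℂ} :
    proj τ p ∈ degenerateNontrivialSet G ↔ p ∈ degenerateNontrivialLift τ c r := by
  rw [degenerateNontrivialSet, Set.mem_ofPred_eq, Set.mem_sdiff, proj_mem_twoTorsion_iff]
  constructor
  · rintro ⟨⟨-, hp⟩, h⟩
    exact (hd.exists_degenerate_iff hp).1 h
  · intro h
    have hp := h.1
    refine ⟨⟨?_, hp⟩, (hd.exists_degenerate_iff hp).2 h⟩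
    obtain ⟨a, ha, hcrit, -⟩ := h.2
    exact (hd.proj_mem_hitchinSet_iff hp).2 ⟨a, ha, hcrit⟩

end Critical

end

/-! ### Sard's theorem and the null sets -/

section

open Filter Asymptotics
open scoped ComplexConjugate

section Sard

variable {E : Type*} [NormedAddCommGroup E] [NormedSpace ℝ E] [FiniteDimensional ℝ E]

lemma isInvertible_of_forall_eq_zero {T : E →L[ℝ] E} (h : ∀ k, T k = 0 → k = 0) :
    T.IsInvertible := by
  have hinj : Function.Injective (T : E →ₗ[ℝ] E) := by
    rw [injective_iff_map_eq_zero]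
    exact h
  exact ⟨(LinearEquiv.ofInjectiveEndo (T : E →ₗ[ℝ] E) hinj).toContinuousLinearEquiv, by
    ext; rfl⟩

lemma det_eq_zero_of_apply_eq_zero {T : E →L[ℝ] E} {h : E} (h0 : h ≠ 0) (hT : T h = 0) :
    T.det = 0 := by
  rw [ContinuousLinearMap.det]
  apply LinearMap.det_eq_zero_iff_ker_ne_bot.2
  intro hker
  have : h ∈ (T : E →ₗ[ℝ] E).ker := hT
  rw [hker] at this
  exact h0 this

/-- The critical values of the projection of the zero set of `f` to the second factor form a null
set, where the partial derivative of `f` along the second factor is invertible. -/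
lemma addHaar_snd_image_eq_zero [MeasurableSpace E] [BorelSpace E] (μ : Measure E)
    [μ.IsAddHaarMeasure] {f : E × E → E} {D : Set (E × E)}
    (hf : ∀ u ∈ D, ContDiffAt ℝ 1 f u) (h0 : ∀ u ∈ D, f u = 0)
    (hinj : ∀ u ∈ D, ∀ k, fderiv ℝ f u (0, k) = 0 → k = 0)
    (hker : ∀ u ∈ D, ∃ h ≠ 0, fderiv ℝ f u (h, 0) = 0) :
    μ (Prod.snd '' D) = 0 := by
  have : CompleteSpace E := FiniteDimensional.complete ℝ E
  have hloc : ∀ u ∈ D, ∃ W ∈ 𝓝[D] u, μ (Prod.snd '' (D ∩ W)) = 0 := by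
    intro u hu
    have hinv : (fderiv ℝ f u ∘L .inr ℝ E E).IsInvertible :=
      isInvertible_of_forall_eq_zero fun k hk ↦ hinj u hu k (by simpa using hk)
    -- The zero set is locally the graph of φ. Differentiating f(y, φ(y)) = const along a vector h
    -- killed by the first partial derivative gives φ'h = 0. So the points in question are critical
    -- values of φ, a map between spaces of equal dimension.
    set φ := (hf u hu).implicitFunction one_ne_zero hinv with hφ
    have h1 : ∀ᶠ v in 𝓝 u, f v = f u ↔ φ v.1 = v.2 :=
      (hf u hu).eventually_apply_eq_iff_implicitFunction one_ne_zero hinv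
    have h2 : ∀ᶠ x in 𝓝 u.1, ∀ᶠ y in 𝓝 x, f (y, φ y) = f u :=
      ((hf u hu).eventually_apply_implicitFunction one_ne_zero hinv).eventually_nhds
    have h3 : ∀ᶠ x in 𝓝 u.1, DifferentiableAt ℝ φ x :=
      (((hf u hu).contDiffAt_implicitFunction one_ne_zero hinv).eventually (by simp)).mono
        fun x hx ↦ hx.differentiableAt one_ne_zero
    have h4 : ∀ᶠ v in 𝓝 u, (φ v.1 = v.2 ↔ f v = f u) ∧ (∀ᶠ y in 𝓝 v.1, f (y, φ y) = f u) ∧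
        DifferentiableAt ℝ φ v.1 := by
      filter_upwards [h1, continuous_fst.continuousAt.eventually h2,
        continuous_fst.continuousAt.eventually h3] with v e1 e2 e3
      exact ⟨e1.symm, e2, e3⟩
    refine ⟨_, mem_nhdsWithin_of_mem_nhds h4, ?_⟩
    set s : Set E := {x | DifferentiableAt ℝ φ x ∧ (fderiv ℝ φ x).det = 0} with hs
    refine measure_mono_null (t := φ '' s) ?_
      (addHaar_image_eq_zero_of_det_fderivWithin_eq_zero μ
        (fun x hx ↦ hx.1.hasFDerivAt.hasFDerivWithinAt) fun x hx ↦ hx.2)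
    rintro _ ⟨v, ⟨hv, e1, e2, e3⟩, rfl⟩
    have e4 : φ v.1 = v.2 := e1.2 (by rw [h0 v hv, h0 u hu])
    refine ⟨v.1, ⟨e3, ?_⟩, e4⟩
    obtain ⟨h, hh0, hh⟩ := hker v hv
    refine det_eq_zero_of_apply_eq_zero hh0 (hinj v hv _ ?_)
    have hfv : HasFDerivAt f (fderiv ℝ f v) (v.1, φ v.1) := by
      rw [e4]
      exact ((hf v hv).differentiableAt one_ne_zero).hasFDerivAt
    have e5 := hfv.comp v.1 ((hasFDerivAt_id v.1).prodMk e3.hasFDerivAt)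
    have e6 : HasFDerivAt (f ∘ fun y ↦ (y, φ y)) (0 : E →L[ℝ] E) v.1 :=
      (hasFDerivAt_const (f u) v.1).congr_of_eventuallyEq e2
    have e7 := congrArg (fun T : E →L[ℝ] E ↦ T h) (e5.unique e6)
    have e8 : fderiv ℝ f v (h, fderiv ℝ φ v.1 h) = 0 := e7
    have e9 : (h, fderiv ℝ φ v.1 h) = (h, (0 : E)) + (0, fderiv ℝ φ v.1 h) := by simp
    rwa [e9, map_add, hh, zero_add] at e8
  choose! W hW hWnull using hloc
  obtain ⟨t, htD, htc, ht⟩ := TopologicalSpace.countable_cover_nhdsWithin hW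
  refine measure_mono_null (t := ⋃ u ∈ t, Prod.snd '' (D ∩ W u)) ?_
    ((measure_biUnion_null_iff htc).2 fun u hu ↦ hWnull u (htD hu))
  rintro _ ⟨v, hv, rfl⟩
  obtain ⟨u, hu, hvu⟩ := Set.mem_iUnion₂.1 (ht hv)
  exact Set.mem_biUnion hu ⟨v, ⟨hv, hvu⟩, rfl⟩

end Sard

/-- A real linear map `h ↦ m h + n conj h` with `‖m‖ = ‖n‖` is singular. -/
lemma exists_wirtinger_eq_zero {m n : ℂ} (h : ‖m‖ = ‖n‖) : ∃ v ≠ 0, wirtinger m n v = 0 := by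
  by_cases hm : m = 0
  · subst hm
    have hn : n = 0 := by simpa using h.symm
    exact ⟨1, one_ne_zero, by simp [hn]⟩
  -- A square root w of -n/m is unimodular, so multiplying mw + n w̄ by w gives mw² + n = 0.
  obtain ⟨w, hw⟩ := IsAlgClosed.exists_pow_nat_eq (-(n / m)) two_pos
  have hnorm : ‖w‖ = 1 := by
    have : ‖w‖ ^ 2 = 1 := by
      rw [← norm_pow, hw, norm_neg, norm_div, ← h, div_self (norm_ne_zero_iff.2 hm)]
    nlinarith [norm_nonneg w, this]
  have hw0 : w ≠ 0 := by
    rintro rfl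
    simp at hnorm
  refine ⟨w, hw0, ?_⟩
  have h1 : w * conj w = 1 := by
    rw [Complex.mul_conj, Complex.normSq_eq_norm_sq, hnorm]
    simp
  rw [wirtinger_apply]
  apply mul_left_cancel₀ hw0
  have h2 : m * w ^ 2 = -n := by
    rw [hw]
    field_simp
  linear_combination h2 + n * h1

/-- A real linear map `h ↦ m h + n conj h` with `‖m‖ ≠ ‖n‖` is injective. -/
lemma eq_zero_of_wirtinger_eq_zero {m n v : ℂ} (h : ‖m‖ ≠ ‖n‖) (hv : wirtinger m n v = 0) :
    v = 0 := by
  by_contra hv0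
  apply h
  have h1 : m * v = -(n * conj v) := by
    rw [wirtinger_apply] at hv
    linear_combination hv
  have h2 := congrArg norm h1
  rw [norm_neg, norm_mul, norm_mul, Complex.norm_conj] at h2
  exact mul_right_cancel₀ (norm_ne_zero_iff.2 hv0) h2

section Null

variable {τ : UpperHalfPlane} {G : Torus τ → ℝ} {c : ℂ} {r : ℝ}

lemma contDiffAt_zetaPer (L : PeriodPair) (c : ℂ) (r : ℝ) {z : ℂ} (hz : z ∉ L.lattice) :
    ContDiffAt ℝ 1 (zetaPer L c r) z := by
  have h1 : ContDiffAt ℝ 1 (weierstrassZeta L) z :=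
    ((analyticAt_zeta L hz).contDiffAt (n := 1)).restrict_scalars ℝ
  have h2 : ContDiffAt ℝ 1 (fun z : ℂ ↦ conj z) z :=
    (Complex.conjCLE : ℂ →L[ℝ] ℂ).contDiff.contDiffAt
  exact (h1.sub (contDiffAt_const.mul contDiffAt_id)).sub (contDiffAt_const.mul h2)

lemma contDiffAt_pairGrad {u : ℂ × ℂ} (h1 : u.1 - u.2 ∉ (periods τ).lattice)
    (h2 : u.1 + u.2 ∉ (periods τ).lattice) :
    ContDiffAt ℝ 1 (fun u : ℂ × ℂ ↦ pairGrad τ c r u.1 u.2) u :=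
  ((contDiffAt_zetaPer (periods τ) c r h1).comp u (contDiffAt_fst.sub contDiffAt_snd)).add
    ((contDiffAt_zetaPer (periods τ) c r h2).comp u (contDiffAt_fst.add contDiffAt_snd))

lemma fderiv_pairGrad_left {u : ℂ × ℂ} (h1 : u.1 - u.2 ∉ (periods τ).lattice)
    (h2 : u.1 + u.2 ∉ (periods τ).lattice) (h : ℂ) :
    fderiv ℝ (fun u : ℂ × ℂ ↦ pairGrad τ c r u.1 u.2) u (h, 0) =
      wirtinger (-pairHess τ c u.1 u.2) (-(2 * r : ℝ)) h := by
  have e1 := ((contDiffAt_pairGrad h1 h2 (c := c) (r := r)).differentiableAt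
    one_ne_zero).hasFDerivAt
  have e2 := HasFDerivAt.comp (f := fun a : ℂ ↦ (a, u.2)) u.1 e1
    ((hasFDerivAt_id u.1).prodMk (hasFDerivAt_const u.2 u.1))
  have e3 := e2.unique (hasStrictFDerivAt_pairGrad_left h1 h2).hasFDerivAt
  exact congrArg (fun T : ℂ →L[ℝ] ℂ ↦ T h) e3

lemma fderiv_pairGrad_right {u : ℂ × ℂ} (h1 : u.1 - u.2 ∉ (periods τ).lattice)
    (h2 : u.1 + u.2 ∉ (periods τ).lattice) (k : ℂ) :
    fderiv ℝ (fun u : ℂ × ℂ ↦ pairGrad τ c r u.1 u.2) u (0, k) =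
      ((periods τ).weierstrassP (u.1 - u.2) - (periods τ).weierstrassP (u.1 + u.2)) * k := by
  have e1 := ((contDiffAt_pairGrad h1 h2 (c := c) (r := r)).differentiableAt
    one_ne_zero).hasFDerivAt
  have e2 := HasFDerivAt.comp (f := fun p : ℂ ↦ (u.1, p)) u.2 e1
    ((hasFDerivAt_const u.1 u.2).prodMk (hasFDerivAt_id u.2))
  have e4 := ((hasStrictFDerivAt_zetaPer (periods τ) c r h1).hasFDerivAt.comp u.2
    ((hasFDerivAt_id (𝕜 := ℝ) u.2).const_sub u.1)).add
    ((hasStrictFDerivAt_zetaPer (periods τ) c r h2).hasFDerivAt.comp u.2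
      ((hasFDerivAt_id (𝕜 := ℝ) u.2).const_add u.1))
  have e5 := congrArg (fun T : ℂ →L[ℝ] ℂ ↦ T k) (e2.unique e4)
  refine Eq.trans e5 ?_
  simp
  ring

/-- The difference of these values is the p-derivative of `pairGrad`. Its nonvanishing is where
nontriviality of a enters: equality would make 2a or 2p a period. -/
lemma wp_sub_ne_wp_add {a p : ℂ} (ha : a + a ∉ (periods τ).lattice)
    (hp : p + p ∉ (periods τ).lattice) (h1 : a - p ∉ (periods τ).lattice)
    (h2 : a + p ∉ (periods τ).lattice) :
    (periods τ).weierstrassP (a - p) ≠ (periods τ).weierstrassP (a + p) := by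
  intro h
  rcases wp_eq_wp (periods τ) h1 h2 h with h | h
  · apply ha
    convert h using 1
    ring
  · apply hp
    rw [← neg_mem_iff]
    convert h using 1
    ring

/-- The equation `pairGrad` = 0 can be solved locally for p, and degeneracy is singularity of the
a-derivative, so these p are critical values covered by `addHaar_snd_image_eq_zero`. -/
lemma volume_degenerateNontrivialLift (hr : 0 < r) :
    volume (degenerateNontrivialLift τ c r) = 0 := by
  set D : Set (ℂ × ℂ) := {u | u.2 + u.2 ∉ (periods τ).lattice ∧ u.1 + u.1 ∉ (periods τ).lattice ∧
    IsCrit τ c r u.1 u.2 ∧ ‖pairHess τ c u.1 u.2‖ = 2 * r} with hD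
  have hset : degenerateNontrivialLift τ c r = Prod.snd '' D := by
    ext p
    constructor
    · rintro ⟨hp, a, ha, h1, h2⟩
      exact ⟨(a, p), ⟨hp, ha, h1, h2⟩, rfl⟩
    · rintro ⟨⟨a, p⟩, ⟨hp, ha, h1, h2⟩, rfl⟩
      exact ⟨hp, a, ha, h1, h2⟩
  rw [hset]
  refine addHaar_snd_image_eq_zero volume (f := fun u : ℂ × ℂ ↦ pairGrad τ c r u.1 u.2)
    (fun u hu ↦ contDiffAt_pairGrad hu.2.2.1.1 hu.2.2.1.2.1) (fun u hu ↦ hu.2.2.1.2.2)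
    (fun u hu k hk ↦ ?_) fun u hu ↦ ?_
  · rw [fderiv_pairGrad_right hu.2.2.1.1 hu.2.2.1.2.1] at hk
    exact (mul_eq_zero.1 hk).resolve_left
      (sub_ne_zero.2 (wp_sub_ne_wp_add hu.2.1 hu.1 hu.2.2.1.1 hu.2.2.1.2.1))
  · obtain ⟨h, h0, hh⟩ := exists_wirtinger_eq_zero (m := -pairHess τ c u.1 u.2)
      (n := ((-(2 * r) : ℝ) : ℂ)) (by
        rw [norm_neg, hu.2.2.2, Complex.norm_real, norm_neg, Real.norm_eq_abs,
          abs_of_pos (by positivity)])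
    refine ⟨h, h0, ?_⟩
    rw [fderiv_pairGrad_left hu.2.2.1.1 hu.2.2.1.2.1]
    simpa using hh

lemma measurableSet_torus_iff {T : Set (Torus τ)} :
    MeasurableSet T ↔ MeasurableSet (proj τ ⁻¹' T) := Iff.rfl

/-- A set of the torus with null preimage is null. -/
lemma area_eq_zero_of_volume_preimage {S : Set (Torus τ)} (hS : volume (proj τ ⁻¹' S) = 0) :
    area τ S = 0 := by
  set L := periods τ
  set N := toMeasurable volume (proj τ ⁻¹' S) with hN
  have hN0 : volume N = 0 := by rw [hN, measure_toMeasurable, hS]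
  have hNm : MeasurableSet N := measurableSet_toMeasurable _ _
  -- A pushforward measure is evaluated on measurable sets. Saturating the measurable hull under the
  -- countable lattice keeps it null and makes its image in the torus measurable.
  set M : Set ℂ := ⋃ l ∈ (L.lattice : Set ℂ), (fun z ↦ z + l) ⁻¹' N with hM
  have hMm : MeasurableSet M :=
    MeasurableSet.biUnion (countable_lattice L) fun l _ ↦ (measurable_add_const l) hNm
  have hM0 : volume M = 0 := by
    refine (measure_biUnion_null_iff (countable_lattice L)).2 fun l _ ↦ ?_
    rw [measure_preimage_add_right, hN0]
  have hpre : proj τ ⁻¹' (proj τ '' M) = M := by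
    refine Set.Subset.antisymm ?_ (Set.subset_preimage_image _ _)
    rintro z ⟨w, hw, hwz⟩
    obtain ⟨l, hl, hwl⟩ := Set.mem_iUnion₂.1 hw
    rw [proj_eq_proj_iff] at hwz
    refine Set.mem_iUnion₂.2 ⟨l + (w - z), add_mem hl hwz, ?_⟩
    change z + (l + (w - z)) ∈ N
    convert (show w + l ∈ N from hwl) using 1
    ring
  have hT : MeasurableSet (proj τ '' M) := by rwa [measurableSet_torus_iff, hpre]
  refine measure_mono_null (t := proj τ '' M) ?_ ?_
  · intro x hx
    obtain ⟨z, rfl⟩ := proj_surjective τ x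
    refine ⟨z, Set.mem_iUnion₂.2 ⟨0, zero_mem L.lattice, ?_⟩, rfl⟩
    change z + 0 ∈ N
    rw [add_zero]
    exact subset_toMeasurable _ _ hx
  · rw [area, Measure.map_apply (measurable_proj τ) hT, hpre]
    exact Measure.restrict_apply_eq_zero' (by measurability) |>.2
      (measure_mono_null Set.inter_subset_left hM0)

lemma GradientData.area_degenerateNontrivialSet (hd : GradientData G c r) :
    area τ (degenerateNontrivialSet G) = 0 := by
  refine area_eq_zero_of_volume_preimage ?_
  refine measure_mono_null ?_ (volume_degenerateNontrivialLift (τ := τ) (c := c) hd.pos)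
  exact fun p hp ↦ hd.proj_mem_degenerateNontrivialSet_iff.1 hp

/-- The curve is the image of a strip under z ↦ γ(Re z), whose derivative kills i and so has
determinant zero; only countably many translates lie over the arc. -/
lemma area_analyticArc {S : Set (Torus τ)} (hS : IsAnalyticArc S) : area τ S = 0 := by
  obtain ⟨γ, hγ, -, rfl⟩ := hS
  refine area_eq_zero_of_volume_preimage ?_
  have h0 : volume (γ '' Set.Icc 0 1) = 0 := by
    have h1 : γ '' Set.Icc 0 1 = (fun z : ℂ ↦ γ z.re) '' (Complex.re ⁻¹' Set.Icc 0 1) := by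
      ext w
      constructor
      · rintro ⟨t, ht, rfl⟩
        exact ⟨t, by simpa using ht, by simp⟩
      · rintro ⟨z, hz, rfl⟩
        exact ⟨z.re, hz, rfl⟩
    rw [h1]
    refine addHaar_image_eq_zero_of_det_fderivWithin_eq_zero volume (fun z hz ↦
      ((hγ z.re hz).differentiableAt.hasFDerivAt.comp z
        Complex.reCLM.hasFDerivAt).hasFDerivWithinAt) fun z hz ↦ ?_
    exact det_eq_zero_of_apply_eq_zero Complex.I_ne_zero (by simp)
  refine measure_mono_null (t := ⋃ l ∈ ((periods τ).lattice : Set ℂ),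
    (fun z ↦ z + l) ⁻¹' (γ '' Set.Icc 0 1)) ?_ ?_
  · rintro z ⟨t, ht, hz⟩
    simp only [proj_eq_proj_iff] at hz
    refine Set.mem_iUnion₂.2 ⟨_, hz, ?_⟩
    exact ⟨t, ht, by ring⟩
  · refine (measure_biUnion_null_iff (countable_lattice _)).2 fun l _ ↦ ?_
    rw [measure_preimage_add_right, h0]

lemma GradientData.ae_nondegenerate (hd : GradientData G c r)
    (hT : area τ (degenerateTrivialSet G) = 0) :
    ∀ᵐ p ∂(area τ), p ∉ twoTorsion τ → ∀ a : Torus τ, IsCriticalPoint (pairGreen G p) a →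
      IsNondegenerate (pairGreen G p) a := by
  have h1 : ∀ᵐ p ∂(area τ), p ∉ degenerateTrivialSet G := measure_eq_zero_iff_ae_notMem.1 hT
  have h2 : ∀ᵐ p ∂(area τ), p ∉ degenerateNontrivialSet G :=
    measure_eq_zero_iff_ae_notMem.1 hd.area_degenerateNontrivialSet
  filter_upwards [h1, h2] with p e1 e2 hp a ha
  by_contra hdeg
  by_cases hat : a ∈ twoTorsion τ
  · exact e1 ⟨hp, a, hat, ha, hdeg⟩
  · obtain ⟨p, rfl⟩ := proj_surjective τ p
    rw [proj_mem_twoTorsion_iff] at hp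
    exact e2 (hd.proj_mem_degenerateNontrivialSet_iff.2
      ((hd.exists_degenerate_iff hp).1 ⟨a, hat, ha, hdeg⟩))

end Null

end

/-! ### Level sets of |℘ + c| as finite unions of analytic arcs -/

section

open Filter Asymptotics
open scoped ComplexConjugate

/-- A compact regular real-analytic arc in the plane. -/
def IsPlaneArc (S : Set ℂ) : Prop :=
  ∃ γ : ℝ → ℂ, AnalyticOnNhd ℝ γ (Set.Icc 0 1) ∧ (∀ t ∈ Set.Icc (0 : ℝ) 1, deriv γ t ≠ 0) ∧
    S = γ '' Set.Icc 0 1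

lemma IsPlaneArc.isAnalyticArc {τ : UpperHalfPlane} {S : Set ℂ} (hS : IsPlaneArc S) (a : ℂ) :
    IsAnalyticArc ((fun z ↦ proj τ (z - a)) '' S) := by
  obtain ⟨γ, hγ, hγ', rfl⟩ := hS
  refine ⟨fun t ↦ γ t - a, fun t ht ↦ (hγ t ht).sub analyticAt_const, fun t ht ↦ ?_, ?_⟩
  · rw [deriv_sub_const]
    exact hγ' t ht
  · rw [Set.image_image]

/-- An analytic function vanishing at a point is locally a power of a local coordinate. -/
lemma exists_eventually_eq_pow {h : ℂ → ℂ} {z₀ : ℂ} (hh : AnalyticAt ℂ h z₀) (h0 : h z₀ = 0)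
    (hne : ¬ ∀ᶠ z in 𝓝 z₀, h z = 0) :
    ∃ n : ℕ, n ≠ 0 ∧ ∃ k : ℂ → ℂ, AnalyticAt ℂ k z₀ ∧ k z₀ = 0 ∧ deriv k z₀ ≠ 0 ∧
      ∀ᶠ z in 𝓝 z₀, h z = k z ^ n := by
  obtain ⟨g, hg, hg0, hgh⟩ := hh.analyticOrderAt_ne_top.1 (mt analyticOrderAt_eq_top.1 hne)
  set n := analyticOrderNatAt h z₀
  have hn : n ≠ 0 := by
    intro hn
    have := hgh.self_of_nhds
    simp only [h0, hn, pow_zero, one_smul] at this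
    exact hg0 this.symm
  obtain ⟨w, hw⟩ := IsAlgClosed.exists_pow_nat_eq (g z₀) (Nat.pos_of_ne_zero hn)
  have hw0 : w ≠ 0 := by
    rintro rfl
    rw [zero_pow hn] at hw
    exact hg0 hw.symm
  -- An analytic n-th root of g near z₀: g/g(z₀) is close to 1, where the principal logarithm is
  -- analytic.
  set q : ℂ → ℂ := fun z ↦ w * Complex.exp (Complex.log (g z / g z₀) / n) with hq
  have h1 : g z₀ / g z₀ = 1 := div_self hg0
  have hqa : AnalyticAt ℂ q z₀ := by
    have h2 : AnalyticAt ℂ (fun z ↦ Complex.log (g z / g z₀)) z₀ :=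
      (hg.div analyticAt_const hg0).clog (by simp [h1])
    exact analyticAt_const.mul (h2.div_const).cexp
  have hq0 : q z₀ = w := by simp [hq, h1]
  refine ⟨n, hn, fun z ↦ (z - z₀) * q z, (analyticAt_id.sub analyticAt_const).mul hqa, by simp,
    ?_, ?_⟩
  · have h3 : HasDerivAt (fun z ↦ (z - z₀) * q z) (1 * q z₀ + (z₀ - z₀) * deriv q z₀) z₀ :=
      ((hasDerivAt_id z₀).sub_const z₀).mul hqa.differentiableAt.hasDerivAt
    rw [h3.deriv, hq0]
    simpa using hw0
  · filter_upwards [hgh, hg.continuousAt.eventually_ne hg0] with z hz hgz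
    have hn' : (n : ℂ) ≠ 0 := by exact_mod_cast hn
    rw [hz, smul_eq_mul, mul_pow, hq]
    simp only
    rw [mul_pow, hw, ← Complex.exp_nat_mul, mul_div_cancel₀ _ hn',
      Complex.exp_log (div_ne_zero hgz hg0), mul_div_cancel₀ _ hg0]

/-- If xⁿ is real, its square is |x|²ⁿ, so x/|x| is a 2n-th root of unity. -/
lemma exists_real_mul_root {n : ℕ} (hn : n ≠ 0) {θ : ℂ} (hθ : IsPrimitiveRoot θ (2 * n)) {x : ℂ}
    (hx : (x ^ n).im = 0) : ∃ j < 2 * n, ∃ t : ℝ, |t| = ‖x‖ ∧ x = t * θ ^ j := by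
  have : NeZero (2 * n) := ⟨by positivity⟩
  by_cases hx0 : x = 0
  · exact ⟨0, by positivity, 0, by simp [hx0], by simp [hx0]⟩
  have hxn : (‖x‖ : ℂ) ≠ 0 := by exact_mod_cast norm_ne_zero_iff.2 hx0
  have h1 : (x / ‖x‖) ^ (2 * n) = 1 := by
    rw [div_pow, div_eq_one_iff_eq (pow_ne_zero _ hxn)]
    obtain ⟨ρ, hρ⟩ : ∃ ρ : ℝ, x ^ n = ρ := ⟨(x ^ n).re, Complex.ext rfl (by simpa using hx)⟩
    have h2 : ‖x‖ ^ n = |ρ| := by rw [← norm_pow, hρ, Complex.norm_real, Real.norm_eq_abs]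
    rw [mul_comm, pow_mul, pow_mul, hρ]
    norm_cast
    rw [h2, sq_abs]
  obtain ⟨j, hj, hθj⟩ := hθ.eq_pow_of_pow_eq_one h1
  refine ⟨j, hj, ‖x‖, by simp, ?_⟩
  rw [hθj, mul_div_cancel₀ _ hxn]

/-- Near a zero, the real locus of a nonconstant analytic function is a finite union of arcs. -/
lemma exists_arcs_im_eq_zero {h : ℂ → ℂ} {z₀ : ℂ} (hh : AnalyticAt ℂ h z₀) (h0 : h z₀ = 0)
    (hne : ¬ ∀ᶠ z in 𝓝 z₀, h z = 0) {V : Set ℂ} (hV : V ∈ 𝓝 z₀) :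
    ∃ X : Set (Set ℂ), X.Finite ∧ (∀ S ∈ X, IsPlaneArc S ∧ S ⊆ V ∩ {z | (h z).im = 0}) ∧
      ∃ U ∈ 𝓝 z₀, U ∩ {z | (h z).im = 0} ⊆ ⋃₀ X := by
  obtain ⟨n, hn, k, hk, hk0, hk', hkh⟩ := exists_eventually_eq_pow hh h0 hne
  set ψ := hk.hasStrictDerivAt.localInverse _ _ _ hk' with hψ
  have hs := hk.hasStrictDerivAt.hasStrictFDerivAt_equiv hk'
  have hψa : AnalyticAt ℂ ψ 0 := by
    have := hk.analyticAt_localInverse hk'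
    rwa [hk0] at this
  have hψ0 : ψ 0 = z₀ := by
    have := hs.localInverse_apply_image
    rwa [hk0] at this
  have hψ' : deriv ψ 0 ≠ 0 := by
    have := (hk.hasStrictDerivAt.to_localInverse hk').hasDerivAt.deriv
    rw [hk0] at this
    rw [hψ, this]
    exact inv_ne_zero hk'
  have hleft : ∀ᶠ z in 𝓝 z₀, ψ (k z) = z := hs.eventually_left_inverse
  have hright : ∀ᶠ y in 𝓝 (0 : ℂ), k (ψ y) = y := by
    have := hs.eventually_right_inverse
    rwa [hk0] at this
  have hev : ∀ᶠ y in 𝓝 (0 : ℂ), AnalyticAt ℂ ψ y ∧ deriv ψ y ≠ 0 ∧ k (ψ y) = y ∧ ψ y ∈ V ∧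
      h (ψ y) = k (ψ y) ^ n := by
    have hc : Tendsto ψ (𝓝 0) (𝓝 z₀) := by
      have := hψa.continuousAt.tendsto
      rwa [hψ0] at this
    exact hψa.eventually_analyticAt.and ((hψa.deriv.continuousAt.eventually_ne hψ').and
      (hright.and ((hc.eventually hV).and (hc.eventually hkh))))
  obtain ⟨δ, hδ, hball⟩ := Metric.eventually_nhds_iff_ball.1 hev
  set ε := δ / 2 with hε
  have hε0 : 0 < ε := by positivity
  have hθ := Complex.isPrimitiveRoot_exp (2 * n) (by positivity)
  set θ := Complex.exp (2 * Real.pi * Complex.I / ((2 * n : ℕ) : ℂ)) with hθdef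
  have hθn : ‖θ‖ = 1 := hθ.norm'_eq_one (by positivity)
  have hθ0 : θ ≠ 0 := by
    intro h
    simp [h] at hθn
  -- In the coordinate k the locus Im kⁿ = 0 is a star of n lines through 0. The arcs are the images
  -- under ψ of the segments of half-length ε on these lines; with 2n indices each line occurs
  -- twice, harmlessly.
  set ℓ : ℕ → ℝ → ℂ := fun j t ↦ ((ε * (2 * t - 1) : ℝ) : ℂ) * θ ^ j with hℓ
  have hℓb : ∀ j, ∀ t ∈ Set.Icc (0 : ℝ) 1, ℓ j t ∈ Metric.ball 0 δ := by
    intro j t ht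
    have h1 : |2 * t - 1| ≤ 1 := abs_le.2 ⟨by linarith [ht.1], by linarith [ht.2]⟩
    rw [mem_ball_zero_iff, hℓ, norm_mul, norm_pow, hθn, one_pow, mul_one, Complex.norm_real,
      Real.norm_eq_abs, abs_mul, abs_of_pos hε0]
    nlinarith
  have hℓd : ∀ j t, HasDerivAt (ℓ j) ((2 * ε : ℝ) * θ ^ j) t := by
    intro j t
    have h1 : HasDerivAt (fun t : ℝ ↦ ε * (2 * t - 1)) (ε * (2 * 1)) t :=
      (((hasDerivAt_id t).const_mul 2).sub_const 1).const_mul ε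
    have h2 := (h1.ofReal_comp).mul_const (θ ^ j)
    refine h2.congr_deriv ?_
    push_cast
    ring
  have hℓa : ∀ j t, AnalyticAt ℝ (ℓ j) t := by
    intro j t
    have h1 : AnalyticAt ℝ (fun t : ℝ ↦ ε * (2 * t - 1)) t := by fun_prop
    exact ((Complex.ofRealCLM.analyticAt _).comp h1).mul analyticAt_const
  refine ⟨(fun j ↦ (fun t ↦ ψ (ℓ j t)) '' Set.Icc 0 1) '' (Set.Iio (2 * n)),
    (Set.finite_Iio _).image _, ?_, ?_⟩
  · rintro _ ⟨j, -, rfl⟩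
    refine ⟨⟨_, fun t ht ↦ ?_, fun t ht ↦ ?_, rfl⟩, ?_⟩
    · exact ((hball _ (hℓb j t ht)).1.restrictScalars (𝕜 := ℝ)).comp (hℓa j t)
    · have h1 := (hball _ (hℓb j t ht)).1.differentiableAt.hasDerivAt
      have h2 := h1.comp_of_eq t (hℓd j t) rfl
      have h3 : deriv (fun t ↦ ψ (ℓ j t)) t = _ := h2.deriv
      rw [h3]
      refine mul_ne_zero (hball _ (hℓb j t ht)).2.1 (mul_ne_zero ?_ (pow_ne_zero _ hθ0))
      exact_mod_cast (by positivity : (2 * ε) ≠ 0)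
    · rintro _ ⟨t, ht, rfl⟩
      obtain ⟨-, -, h1, h2, h3⟩ := hball _ (hℓb j t ht)
      refine ⟨h2, ?_⟩
      change (h (ψ (ℓ j t))).im = 0
      rw [h3, h1, hℓ]
      simp only
      -- θⁿ = ±1, so n-th powers of real multiples of θʲ are real.
      have h4 : (θ ^ n) ^ 2 = 1 := by rw [← pow_mul, mul_comm, hθ.pow_eq_one]
      rw [mul_pow, ← pow_mul, mul_comm j n, pow_mul]
      rcases mul_self_eq_one_iff.1 ((sq _).symm.trans h4) with h5 | h5 <;> rw [h5] <;> norm_cast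
  · refine ⟨_, (hleft.and (hkh.and (hk.continuousAt.eventually
      (Metric.ball_mem_nhds _ hε0)))), ?_⟩
    rintro z ⟨⟨h1, h2, h3⟩, h4⟩
    change (h z).im = 0 at h4
    rw [h2] at h4
    rw [hk0, dist_zero_right] at h3
    obtain ⟨j, hj, t, ht, hkz⟩ := exists_real_mul_root hn hθ h4
    refine ⟨_, ⟨j, hj, rfl⟩, (t / ε + 1) / 2, ?_, ?_⟩
    · rw [← ht, abs_lt] at h3
      have h5 : -1 ≤ t / ε := by rw [le_div_iff₀ hε0]; linarith
      have h6 : t / ε ≤ 1 := by rw [div_le_iff₀ hε0]; linarith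
      constructor <;> linarith
    · have h5 : ℓ j ((t / ε + 1) / 2) = k z := by
        rw [hkz, hℓ]
        simp only
        congr 2
        field_simp
        ring
      simp only [h5, h1]

/-- Near a point where its value is not zero, a level set of the absolute value of a nonconstant
analytic function is a finite union of arcs. -/
lemma exists_arcs_norm_eq {F : ℂ → ℂ} {z₀ : ℂ} (hF : AnalyticAt ℂ F z₀) (h0 : F z₀ ≠ 0)
    (hne : ¬ ∀ᶠ z in 𝓝 z₀, F z = F z₀) {V : Set ℂ} (hV : V ∈ 𝓝 z₀) :
    ∃ X : Set (Set ℂ), X.Finite ∧ (∀ S ∈ X, IsPlaneArc S ∧ S ⊆ V ∩ {z | ‖F z‖ = ‖F z₀‖}) ∧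
      ∃ U ∈ 𝓝 z₀, U ∩ {z | ‖F z‖ = ‖F z₀‖} ⊆ ⋃₀ X := by
  -- Im(i log(F/F(z₀))) = log|F/F(z₀)|, so the level set is the real locus of h.
  set h : ℂ → ℂ := fun z ↦ Complex.I * Complex.log (F z / F z₀) with hh
  have hone : F z₀ / F z₀ = 1 := div_self h0
  have hha : AnalyticAt ℂ h z₀ := analyticAt_const.mul
    ((hF.div analyticAt_const h0).clog (by simp [hone]))
  have hF0 : ∀ᶠ z in 𝓝 z₀, F z ≠ 0 := hF.continuousAt.eventually_ne h0
  have him : ∀ z, F z ≠ 0 → ((h z).im = 0 ↔ ‖F z‖ = ‖F z₀‖) := by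
    intro z hz
    have h1 : (h z).im = Real.log (‖F z‖ / ‖F z₀‖) := by
      rw [hh, Complex.I_mul_im, Complex.log_re, norm_div]
    have h2 : 0 < ‖F z‖ / ‖F z₀‖ := div_pos (norm_pos_iff.2 hz) (norm_pos_iff.2 h0)
    rw [h1, Real.log_eq_zero, ← div_eq_one_iff_eq (norm_ne_zero_iff.2 h0)]
    constructor
    · rintro (h | h | h) <;> linarith
    · exact fun h ↦ Or.inr (Or.inl h)
  have hnz : ¬ ∀ᶠ z in 𝓝 z₀, h z = 0 := by
    intro hz
    apply hne
    filter_upwards [hz, hF0] with z h1 h2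
    have h3 := (mul_eq_zero.1 h1).resolve_left Complex.I_ne_zero
    have h4 := Complex.exp_log (div_ne_zero h2 h0)
    rw [h3, Complex.exp_zero] at h4
    exact ((div_eq_one_iff_eq h0).1 h4.symm)
  obtain ⟨X, hX, hXV, U, hU, hUX⟩ := exists_arcs_im_eq_zero hha (by simp [hh, hone]) hnz
    (Filter.inter_mem hV hF0)
  refine ⟨X, hX, fun S hS ↦ ⟨(hXV S hS).1, fun z hz ↦ ?_⟩, _, Filter.inter_mem hU hF0, ?_⟩
  · obtain ⟨⟨h1, h2⟩, h3⟩ := (hXV S hS).2 hz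
    exact ⟨h1, (him z h2).1 h3⟩
  · rintro z ⟨⟨h1, h2⟩, h3⟩
    exact hUX ⟨h1, (him z h2).2 h3⟩

section LevelSet

/-- There is a compact set of representatives of the points of the torus. -/
lemma exists_isCompact_representatives (L : PeriodPair) :
    ∃ Q : Set ℂ, IsCompact Q ∧ ∀ z, ∃ l ∈ L.lattice, z + l ∈ Q := by
  refine ⟨closure (ZSpan.fundamentalDomain L.basis),
    (ZSpan.fundamentalDomain_isBounded L.basis).isCompact_closure, fun z ↦ ?_⟩
  refine ⟨-(ZSpan.floor L.basis z : ℂ), neg_mem ?_, ?_⟩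
  · have := (ZSpan.floor L.basis z).2
    rwa [L.lattice_eq_span_range_basis]
  · apply subset_closure
    have := ZSpan.fract_mem_fundamentalDomain L.basis z
    rwa [ZSpan.fract_apply, sub_eq_add_neg] at this

lemma tendsto_wp_cobounded (L : PeriodPair) {l : ℂ} (hl : l ∈ L.lattice) :
    Tendsto L.weierstrassP (𝓝[≠] l) (Bornology.cobounded ℂ) := by
  apply tendsto_cobounded_of_meromorphicOrderAt_neg
  rw [L.order_weierstrassP l hl]
  decide

/-- The level sets of `‖℘ + c‖` are finite unions of analytic arcs modulo the lattice. -/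
lemma exists_arcs_wp (L : PeriodPair) (c : ℂ) {r : ℝ} (hr : 0 < r) :
    ∃ X : Set (Set ℂ), X.Finite ∧ (∀ S ∈ X, IsPlaneArc S ∧
      S ⊆ {z | z ∉ L.lattice ∧ ‖L.weierstrassP z + c‖ = r}) ∧
      ∀ z ∉ L.lattice, ‖L.weierstrassP z + c‖ = r → ∃ l ∈ L.lattice, z + l ∈ ⋃₀ X := by
  obtain ⟨Q, hQ, hQL⟩ := exists_isCompact_representatives L
  set A : Set ℂ := {z | z ∉ L.lattice ∧ ‖L.weierstrassP z + c‖ = r} with hA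
  have key : ∃ X : Set (Set ℂ), X.Finite ∧ (∀ S ∈ X, IsPlaneArc S ∧ S ⊆ A) ∧ Q ∩ A ⊆ ⋃₀ X := by
    refine hQ.induction_on (p := fun K ↦ ∃ X : Set (Set ℂ), X.Finite ∧
      (∀ S ∈ X, IsPlaneArc S ∧ S ⊆ A) ∧ K ∩ A ⊆ ⋃₀ X) ?_ ?_ ?_ ?_
    · exact ⟨∅, Set.finite_empty, by simp, by simp⟩
    · rintro s t hst ⟨X, h1, h2, h3⟩
      exact ⟨X, h1, h2, (Set.inter_subset_inter_left _ hst).trans h3⟩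
    · rintro s t ⟨X, h1, h2, h3⟩ ⟨Y, h4, h5, h6⟩
      refine ⟨X ∪ Y, h1.union h4, fun S hS ↦ hS.elim (h2 S) (h5 S), ?_⟩
      rw [Set.union_inter_distrib_right, Set.sUnion_union]
      exact Set.union_subset_union h3 h6
    · intro z₀ _
      suffices h : ∃ X : Set (Set ℂ), X.Finite ∧ (∀ S ∈ X, IsPlaneArc S ∧ S ⊆ A) ∧
          ∃ U ∈ 𝓝 z₀, U ∩ A ⊆ ⋃₀ X by
        obtain ⟨X, h1, h2, U, hU, h3⟩ := h
        exact ⟨U, mem_nhdsWithin_of_mem_nhds hU, X, h1, h2, h3⟩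
      by_cases hz : z₀ ∈ L.lattice
      · refine ⟨∅, Set.finite_empty, by simp, ?_⟩
        -- The pole of ℘ keeps the level set away from the lattice, so no arcs are needed here.
        have h1 : ∀ᶠ z in 𝓝[≠] z₀, r < ‖L.weierstrassP z + c‖ := by
          have := (tendsto_norm_atTop_iff_cobounded.2 (tendsto_wp_cobounded L hz)).eventually
            (eventually_gt_atTop (r + ‖c‖))
          filter_upwards [this] with z hz
          have := norm_sub_le (L.weierstrassP z + c) c
          rw [add_sub_cancel_right] at this
          linarith
        rw [eventually_nhdsWithin_iff] at h1
        refine ⟨_, h1, ?_⟩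
        rintro z ⟨h2, h3, h4⟩
        have h5 := h2 (by rintro rfl; exact h3 hz)
        linarith
      have hFa : AnalyticAt ℂ (fun z ↦ L.weierstrassP z + c) z₀ :=
        (L.analyticOnNhd_weierstrassP z₀ hz).add analyticAt_const
      by_cases hzr : ‖L.weierstrassP z₀ + c‖ = r
      · obtain ⟨X, h1, h2, U, hU, h3⟩ := exists_arcs_norm_eq hFa
          (by rw [← norm_pos_iff, hzr]; exact hr) (by
            intro hev
            refine not_eventually_wp_const L hz (L.weierstrassP z₀) ?_
            filter_upwards [hev] with z hz
            exact add_right_cancel hz) ((isOpen_compl_lattice L).mem_nhds hz)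
        rw [hzr] at h2 h3
        exact ⟨X, h1, h2, U, hU, fun z hz ↦ h3 ⟨hz.1, hz.2.2⟩⟩
      · refine ⟨∅, Set.finite_empty, by simp, _, hFa.continuousAt.norm.eventually_ne hzr, ?_⟩
        rintro z ⟨h1, -, h2⟩
        exact absurd h2 h1
  obtain ⟨X, h1, h2, h3⟩ := key
  refine ⟨X, h1, h2, fun z hz hzr ↦ ?_⟩
  obtain ⟨l, hl, hlQ⟩ := hQL z
  refine ⟨l, hl, h3 ⟨hlQ, by rwa [add_mem_lattice_iff hl], ?_⟩⟩
  have := L.weierstrassP_add_coe z ⟨l, hl⟩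
  simp only at this
  rwa [this]

variable {τ : UpperHalfPlane} {G : Torus τ → ℝ} {c : ℂ} {r : ℝ}

lemma exists_half_period_sub_mem {a : ℂ} (ha : a + a ∈ (periods τ).lattice) :
    ∃ b ∈ ({0, 1 / 2, (τ : ℂ) / 2, (1 + (τ : ℂ)) / 2} : Set ℂ), b + b ∈ (periods τ).lattice ∧
      a - b ∈ (periods τ).lattice := by
  have h := proj_mem_twoTorsion_iff.2 ha
  have hb : ∀ b, a - b ∈ (periods τ).lattice → b + b ∈ (periods τ).lattice := by
    intro b hb
    have := sub_mem ha (add_mem hb hb)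
    convert this using 1
    ring
  simp only [twoTorsion, Set.mem_insert_iff, Set.mem_singleton_iff, proj_eq_proj_iff] at h
  rcases h with h | h | h | h <;> exact ⟨_, by simp, hb _ h, h⟩

/-- Degeneracy at a half period a reads |℘(p + a) + c| = r and depends only on a modulo periods, so
the set consists of the translates of one level curve by the four half periods. -/
lemma GradientData.exists_arcs (hd : GradientData G c r) :
    ∃ C : Set (Set (Torus τ)), C.Finite ∧ (∀ S ∈ C, IsAnalyticArc S) ∧
      degenerateTrivialSet G = (⋃₀ C) \ twoTorsion τ := by
  set L := periods τ with hL
  obtain ⟨X, hX, hXA, hXc⟩ := exists_arcs_wp L c hd.pos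
  set H : Set ℂ := {b ∈ ({0, 1 / 2, (τ : ℂ) / 2, (1 + (τ : ℂ)) / 2} : Set ℂ) | b + b ∈ L.lattice}
    with hH
  have hHf : H.Finite := (Set.toFinite _).subset (Set.sep_subset _ _)
  refine ⟨Set.image2 (fun b S ↦ (fun z ↦ proj τ (z - b)) '' S) H X, hHf.image2 _ hX, ?_, ?_⟩
  · rintro _ ⟨b, -, S, hS, rfl⟩
    exact (hXA S hS).1.isAnalyticArc b
  ext p
  obtain ⟨p, rfl⟩ := proj_surjective τ p
  rw [hd.proj_mem_degenerateTrivialSet_iff, Set.mem_sdiff, proj_mem_twoTorsion_iff, and_comm]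
  refine and_congr_left fun hp ↦ ?_
  constructor
  · rintro ⟨a, ha, har⟩
    obtain ⟨b, hb, hb2, hab⟩ := exists_half_period_sub_mem ha
    have h1 : p + a ∉ L.lattice := by
      rw [add_comm]
      exact (half_sub_notMem ha hp).2
    obtain ⟨l, hl, S, hS, hlS⟩ := hXc _ h1 har
    refine ⟨_, ⟨b, ⟨hb, hb2⟩, S, hS, rfl⟩, _, hlS, ?_⟩
    simp only [proj_eq_proj_iff]
    have := add_mem hab hl
    convert this using 1
    ring
  · rintro ⟨_, ⟨b, ⟨-, hb⟩, S, hS, rfl⟩, z, hz, hzp⟩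
    refine ⟨b, hb, ?_⟩
    simp only [proj_eq_proj_iff] at hzp
    have h1 := L.weierstrassP_add_coe (p + b) ⟨_, hzp⟩
    have h2 : p + b + (z - b - p) = z := by ring
    simp only [h2] at h1
    rw [← h1]
    exact ((hXA S hS).2 hz).2

lemma GradientData.area_degenerateTrivialSet (hd : GradientData G c r) :
    area τ (degenerateTrivialSet G) = 0 := by
  obtain ⟨C, hC, hCa, hCe⟩ := hd.exists_arcs
  rw [hCe]
  refine measure_mono_null Set.sdiff_subset ?_
  exact (measure_sUnion_null_iff hC.countable).2 fun S hS ↦ area_analyticArc (hCa S hS)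

end LevelSet

end

/-! ### Openness of the nondegenerate part of Ω_τ -/

section

open Filter Asymptotics
open scoped ComplexConjugate

section Open

variable {τ : UpperHalfPlane} {G : Torus τ → ℝ} {c : ℂ} {r : ℝ}

lemma tendsto_norm_zetaPer_zero (L : PeriodPair) (c : ℂ) (r : ℝ) :
    Tendsto (fun z ↦ ‖zetaPer L c r z‖) (𝓝[≠] 0) atTop := by
  have h1 : Tendsto (fun z ↦ ‖weierstrassZeta L z * z‖ * ‖z⁻¹‖) (𝓝[≠] (0 : ℂ)) atTop := by
    refine Tendsto.pos_mul_atTop (C := ‖(1 : ℂ)‖) (by simp) (tendsto_zeta_mul L).norm ?_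
    exact tendsto_norm_atTop_iff_cobounded.2 tendsto_inv₀_nhdsNE_zero
  have h2 : Tendsto (fun z ↦ -‖c * z + r * conj z‖) (𝓝[≠] (0 : ℂ)) (𝓝 (-‖c * 0 + r * conj 0‖)) := by
    have : Continuous fun z : ℂ ↦ -‖c * z + r * conj z‖ := by fun_prop
    exact (this.tendsto 0).mono_left nhdsWithin_le_nhds
  refine tendsto_atTop_mono' _ ?_ (h1.atTop_add h2)
  filter_upwards [self_mem_nhdsWithin] with z hz
  rw [← norm_mul, mul_assoc, mul_inv_cancel₀ hz, mul_one]
  have h3 : zetaPer L c r z = weierstrassZeta L z - (c * z + r * conj z) := by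
    rw [zetaPer]
    ring
  rw [h3]
  exact (norm_sub_norm_le _ _)

lemma GradientData.tendsto_norm_zetaPer (hd : GradientData G c r) {l : ℂ}
    (hl : l ∈ (periods τ).lattice) :
    Tendsto (fun z ↦ ‖zetaPer (periods τ) c r z‖) (𝓝[≠] l) atTop := by
  have h1 : Tendsto (fun z ↦ z - l) (𝓝[≠] l) (𝓝[≠] 0) := by
    refine tendsto_nhdsWithin_iff.2 ⟨?_, ?_⟩
    · have : Continuous fun z : ℂ ↦ z - l := by fun_prop
      have := (this.tendsto l).mono_left (nhdsWithin_le_nhds (s := {l}ᶜ))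
      rwa [sub_self] at this
    · filter_upwards [self_mem_nhdsWithin] with z hz
      exact sub_ne_zero.2 hz
  refine ((tendsto_norm_zetaPer_zero (periods τ) c r).comp h1).congr' ?_
  have h2 : ∀ᶠ z in 𝓝[≠] l, z ∉ (periods τ).lattice := eventually_notMem_lattice _ _
  filter_upwards [h2] with z hz
  have h3 := hd.zetaPer_add (neg_mem hl) hz
  rw [← sub_eq_add_neg] at h3
  rw [Function.comp_apply, h3]

/-- One term is large because of its pole and the other stays bounded. Applied to `pairGrad`, this
keeps critical points from accumulating at ±p. -/
lemma GradientData.eventually_add_ne_zero (hd : GradientData G c r) {X : Type*}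
    [TopologicalSpace X] {u v : X → ℂ} {x : X} (hu : ContinuousAt u x) (hv : ContinuousAt v x)
    (hux : u x ∈ (periods τ).lattice) (hvx : v x ∉ (periods τ).lattice) :
    ∀ᶠ y in 𝓝 x, u y ∉ (periods τ).lattice →
      zetaPer (periods τ) c r (u y) + zetaPer (periods τ) c r (v y) ≠ 0 := by
  set M := ‖zetaPer (periods τ) c r (v x)‖ + 1
  have h1 : ∀ᶠ z in 𝓝 (u x), z ≠ u x → M < ‖zetaPer (periods τ) c r z‖ :=
    eventually_nhdsWithin_iff.1 ((hd.tendsto_norm_zetaPer hux).eventually (eventually_gt_atTop M))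
  have h2 : ContinuousAt (fun y ↦ ‖zetaPer (periods τ) c r (v y)‖) x :=
    ((hasStrictFDerivAt_zetaPer (periods τ) c r hvx).hasFDerivAt.continuousAt.comp hv).norm
  filter_upwards [hu.eventually h1, h2.eventually_lt_const (lt_add_one _)] with y e1 e2 hy h0
  have e3 := e1 fun h ↦ hy (h ▸ hux)
  rw [eq_neg_of_add_eq_zero_left h0, norm_neg] at e3
  exact lt_asymm e2 e3

lemma GradientData.isCrit_add (hd : GradientData G c r) {a p l : ℂ}
    (hl : l ∈ (periods τ).lattice) (h : IsCrit τ c r a p) : IsCrit τ c r (a + l) p := by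
  obtain ⟨h1, h2, h3⟩ := h
  have e1 : a + l - p = a - p + l := by ring
  have e2 : a + l + p = a + p + l := by ring
  refine ⟨by rwa [e1, add_mem_lattice_iff hl], by rwa [e2, add_mem_lattice_iff hl], ?_⟩
  rw [pairGrad, e1, e2, hd.zetaPer_add hl h1, hd.zetaPer_add hl h2]
  exact h3

lemma pairHess_add {a p l : ℂ} (hl : l ∈ (periods τ).lattice) :
    pairHess τ c (a + l) p = pairHess τ c a p := by
  have e1 := (periods τ).weierstrassP_add_coe (a - p) ⟨l, hl⟩
  have e2 := (periods τ).weierstrassP_add_coe (a + p) ⟨l, hl⟩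
  simp only at e1 e2
  rw [pairHess, pairHess, ← e1, ← e2]
  ring_nf

lemma continuousAt_pairHess {u : ℂ × ℂ} (h1 : u.1 - u.2 ∉ (periods τ).lattice)
    (h2 : u.1 + u.2 ∉ (periods τ).lattice) :
    ContinuousAt (fun u : ℂ × ℂ ↦ pairHess τ c u.1 u.2) u := by
  have e1 : ContinuousAt (fun u : ℂ × ℂ ↦ (periods τ).weierstrassP (u.1 - u.2)) u :=
    ContinuousAt.comp (f := fun u : ℂ × ℂ ↦ u.1 - u.2)
      ((periods τ).analyticOnNhd_weierstrassP _ h1).continuousAt (by fun_prop)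
  have e2 : ContinuousAt (fun u : ℂ × ℂ ↦ (periods τ).weierstrassP (u.1 + u.2)) u :=
    ContinuousAt.comp (f := fun u : ℂ × ℂ ↦ u.1 + u.2)
      ((periods τ).analyticOnNhd_weierstrassP _ h2).continuousAt (by fun_prop)
  exact (e1.add e2).add continuousAt_const

lemma eventually_notMem_of_continuousAt {L : PeriodPair} {X : Type*} [TopologicalSpace X]
    {u : X → ℂ} {x : X} (hu : ContinuousAt u x) (hx : u x ∉ L.lattice) :
    ∀ᶠ y in 𝓝 x, u y ∉ L.lattice :=
  hu.eventually ((isOpen_compl_lattice L).mem_nhds hx)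

/-- If `G_p` has no degenerate critical point, neither has `G_q` for `q` near `p`. -/
lemma GradientData.eventually_nondegenerate (hd : GradientData G c r) {p₀ : ℂ}
    (hp : p₀ + p₀ ∉ (periods τ).lattice)
    (h : ∀ a, IsCrit τ c r a p₀ → ‖pairHess τ c a p₀‖ ≠ 2 * r) :
    ∀ᶠ p in 𝓝 p₀, ∀ a, IsCrit τ c r a p → ‖pairHess τ c a p‖ ≠ 2 * r := by
  obtain ⟨Q, hQ, hQL⟩ := exists_isCompact_representatives (periods τ)
  -- By periodicity in a, a compact set of representatives suffices, and the claim becomes local at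
  -- each (a₀, p₀). Near a pole there are no critical points; elsewhere either `pairGrad` ≠ 0 or
  -- ‖`pairHess`‖ ≠ 2r holds at (a₀, p₀), and both are open conditions.
  have key : ∀ᶠ p in 𝓝 p₀, ∀ a ∈ Q, IsCrit τ c r a p → ‖pairHess τ c a p‖ ≠ 2 * r := by
    refine hQ.eventually_forall_of_forall_eventually fun a₀ _ ↦ ?_
    suffices hs : ∀ᶠ u : ℂ × ℂ in 𝓝 (a₀, p₀), IsCrit τ c r u.1 u.2 →
        ‖pairHess τ c u.1 u.2‖ ≠ 2 * r by
      exact (continuous_swap.tendsto (p₀, a₀)).eventually hs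
    by_cases h1 : a₀ - p₀ ∈ (periods τ).lattice
    · have h2 : a₀ + p₀ ∉ (periods τ).lattice := by
        intro h2
        apply hp
        have := sub_mem h2 h1
        rwa [add_sub_sub_cancel] at this
      have h3 := hd.eventually_add_ne_zero (u := fun u : ℂ × ℂ ↦ u.1 - u.2)
        (v := fun u : ℂ × ℂ ↦ u.1 + u.2) (x := (a₀, p₀)) (by fun_prop) (by fun_prop) h1 h2
      filter_upwards [h3] with u hu hcrit
      exact absurd hcrit.2.2 (hu hcrit.1)
    by_cases h2 : a₀ + p₀ ∈ (periods τ).lattice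
    · have h3 := hd.eventually_add_ne_zero (u := fun u : ℂ × ℂ ↦ u.1 + u.2)
        (v := fun u : ℂ × ℂ ↦ u.1 - u.2) (x := (a₀, p₀)) (by fun_prop) (by fun_prop) h2 h1
      filter_upwards [h3] with u hu hcrit
      refine absurd hcrit.2.2 ?_
      rw [pairGrad, add_comm]
      exact hu hcrit.2.1
    by_cases h3 : pairGrad τ c r a₀ p₀ = 0
    · have h4 := (continuousAt_pairHess (c := c) (u := (a₀, p₀)) h1 h2).norm.eventually_ne
        (h a₀ ⟨h1, h2, h3⟩)
      exact h4.mono fun u hu _ ↦ hu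
    · have h4 := (contDiffAt_pairGrad (c := c) (r := r) (u := (a₀, p₀)) h1
        h2).continuousAt.eventually_ne h3
      exact h4.mono fun u hu hcrit ↦ absurd hcrit.2.2 hu
  filter_upwards [key] with p hp a ha
  obtain ⟨l, hl, hlQ⟩ := hQL a
  have := hp _ hlQ (hd.isCrit_add hl ha)
  rwa [pairHess_add hl] at this

/-- Nondegenerate nontrivial critical points persist. -/
lemma eventually_exists_isCrit (hr : 0 < r) {a₀ p₀ : ℂ} (ha : a₀ + a₀ ∉ (periods τ).lattice)
    (hcrit : IsCrit τ c r a₀ p₀) (hH : ‖pairHess τ c a₀ p₀‖ ≠ 2 * r) :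
    ∀ᶠ p in 𝓝 p₀, ∃ a, a + a ∉ (periods τ).lattice ∧ IsCrit τ c r a p := by
  obtain ⟨h1, h2, h3⟩ := hcrit
  -- The arguments are swapped because here a is solved for as a function of p, whereas in the Sard
  -- argument p is a function of a.
  set f : ℂ × ℂ → ℂ := fun u ↦ pairGrad τ c r u.2 u.1 with hf
  have hfc : ContDiffAt ℝ 1 f (p₀, a₀) :=
    (contDiffAt_pairGrad (c := c) (r := r) (u := (a₀, p₀)) h1 h2).comp (p₀, a₀)
      (contDiffAt_snd.prodMk contDiffAt_fst)
  have hinv : (fderiv ℝ f (p₀, a₀) ∘L .inr ℝ ℂ ℂ).IsInvertible := by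
    refine isInvertible_of_forall_eq_zero fun k hk ↦ ?_
    have e1 := (hfc.differentiableAt one_ne_zero).hasFDerivAt
    have e2 := HasFDerivAt.comp (f := fun a : ℂ ↦ (p₀, a)) a₀ e1
      ((hasFDerivAt_const p₀ a₀).prodMk (hasFDerivAt_id a₀))
    have e3 := e2.unique (hasStrictFDerivAt_pairGrad_left h1 h2).hasFDerivAt
    have e4 := congrArg (fun T : ℂ →L[ℝ] ℂ ↦ T k) e3
    have e5 : wirtinger (-pairHess τ c a₀ p₀) (-(2 * r : ℝ)) k = 0 := e4.symm.trans hk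
    refine eq_zero_of_wirtinger_eq_zero ?_ e5
    rw [norm_neg, norm_neg, Complex.norm_real, Real.norm_eq_abs, abs_of_pos (by positivity)]
    exact hH
  set φ := hfc.implicitFunction one_ne_zero hinv with hφ
  have hφ0 : φ p₀ = a₀ := hfc.implicitFunction_apply_self one_ne_zero hinv
  have hφc : ContinuousAt φ p₀ := (hfc.contDiffAt_implicitFunction one_ne_zero hinv).continuousAt
  have hev := hfc.eventually_apply_implicitFunction one_ne_zero hinv
  have e1 := eventually_notMem_of_continuousAt (L := periods τ) (hφc.add hφc) (by simpa [hφ0])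
  have e2 := eventually_notMem_of_continuousAt (L := periods τ) (hφc.sub continuousAt_id)
    (by simpa [hφ0])
  have e3 := eventually_notMem_of_continuousAt (L := periods τ) (hφc.add continuousAt_id)
    (by simpa [hφ0])
  filter_upwards [hev, e1, e2, e3] with p i1 i2 i3 i4
  exact ⟨φ p, i2, i3, i4, i1.trans h3⟩

/-- Half periods are always critical, so avoiding both degenerate sets amounts to one condition on
all critical points, trivial or not, which can be treated uniformly by compactness. -/
lemma GradientData.proj_mem_nondegenerate_iff (hd : GradientData G c r) {p : ℂ} :
    proj τ p ∈ hitchinSet τ \ (twoTorsion τ ∪ degenerateNontrivialSet G ∪ degenerateTrivialSet G) ↔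
      p + p ∉ (periods τ).lattice ∧ (∃ a, a + a ∉ (periods τ).lattice ∧ IsCrit τ c r a p) ∧
        ∀ a, IsCrit τ c r a p → ‖pairHess τ c a p‖ ≠ 2 * r := by
  rw [Set.mem_sdiff, Set.mem_union, Set.mem_union, not_or, not_or, proj_mem_twoTorsion_iff,
    hd.proj_mem_degenerateNontrivialSet_iff, hd.proj_mem_degenerateTrivialSet_iff]
  constructor
  · rintro ⟨h1, ⟨hp, h2⟩, h3⟩
    refine ⟨hp, (hd.proj_mem_hitchinSet_iff hp).1 h1, fun a ha hH ↦ ?_⟩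
    by_cases haa : a + a ∈ (periods τ).lattice
    · refine h3 ⟨hp, a, haa, ?_⟩
      rw [pairHess_of_half haa, norm_mul, Complex.norm_ofNat] at hH
      exact mul_left_cancel₀ two_ne_zero hH
    · exact h2 ⟨hp, a, haa, ha, hH⟩
  · rintro ⟨hp, h1, h2⟩
    refine ⟨(hd.proj_mem_hitchinSet_iff hp).2 h1, ⟨hp, ?_⟩, ?_⟩
    · rintro ⟨-, a, -, ha, hH⟩
      exact h2 a ha hH
    · rintro ⟨-, a, ha, hH⟩
      refine h2 a (hd.isCrit_of_half ha hp) ?_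
      rw [pairHess_of_half ha, norm_mul, Complex.norm_ofNat, hH]

lemma GradientData.isOpen_nondegenerate (hd : GradientData G c r) :
    IsOpen (hitchinSet τ \
      (twoTorsion τ ∪ degenerateNontrivialSet G ∪ degenerateTrivialSet G)) := by
  rw [← (QuotientAddGroup.isQuotientMap_mk
    (N := (periods τ).lattice.toAddSubgroup)).isOpen_preimage, isOpen_iff_mem_nhds]
  intro p hp
  obtain ⟨h1, ⟨a, ha, hcrit⟩, h3⟩ := hd.proj_mem_nondegenerate_iff.1 hp
  have e1 : ∀ᶠ q : ℂ in 𝓝 p, q + q ∉ (periods τ).lattice :=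
    eventually_notMem_of_continuousAt (continuousAt_id.add continuousAt_id) h1
  filter_upwards [e1, eventually_exists_isCrit hd.pos ha hcrit (h3 a hcrit),
    hd.eventually_nondegenerate h1 h3] with q i1 i2 i3
  exact hd.proj_mem_nondegenerate_iff.2 ⟨i1, i2, i3⟩

end Open

end

end TorusGreen

end

theorem theorem1p7 (τ : UpperHalfPlane) (G : TorusGreen.Torus τ → ℝ)
    (hG : TorusGreen.IsGreenFunction τ G) :
    (TorusGreen.area τ) (TorusGreen.degenerateNontrivialSet G) = 0 ∧
    (∃ C : Set (Set (TorusGreen.Torus τ)), C.Finite ∧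
      (∀ S ∈ C, TorusGreen.IsAnalyticArc S) ∧
      TorusGreen.degenerateTrivialSet G = (⋃₀ C) \ TorusGreen.twoTorsion τ) ∧
    IsOpen (TorusGreen.hitchinSet τ \
      (TorusGreen.twoTorsion τ ∪ TorusGreen.degenerateNontrivialSet G ∪
        TorusGreen.degenerateTrivialSet G)) ∧
    ∀ᵐ p ∂(TorusGreen.area τ), p ∉ TorusGreen.twoTorsion τ →
      ∀ a : TorusGreen.Torus τ, TorusGreen.IsCriticalPoint (TorusGreen.pairGreen G p) a →
        TorusGreen.IsNondegenerate (TorusGreen.pairGreen G p) a := by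
  obtain ⟨c, r, hd⟩ := hG.exists_gradientData
  exact ⟨hd.area_degenerateNontrivialSet, hd.exists_arcs, hd.isOpen_nondegenerate,
    hd.ae_nondegenerate hd.area_degenerateTrivialSet⟩
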